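/- Let $M$ be a real-analytic manifold of dimension $2n+1$ and let $H\subset \mathbb{C}TM$ be a real-analytic CR structure of hypersurface type, i.e. a real-analytic complex distribution of rank $n$ with $[H,H]\subset H$ and $H\cap\overline H=0$. Let $K\subset H$ be its Levi kernel, the kernel of the Levi form $\mathcal L(X_p,Y_p)=\frac i2[X,\overline Y]_p \bmod H_p\oplus\overline H_p$. Assume that $K$ has constant rank $r$ and that $H$ is 2-nondegenerate at every point $p$: $K_p\neq 0$, and for every local section $V$ of $K$ with $V_p\ne0$ there is a local section $Y$ of $H$ with $[V,\overline Y]_p\notin K_p\oplus\overline H_p$. Locally (after shrinking $M$ to a neighbourhood of a point), let $\mathbb{C}M$ be a connected complexification of $M$ with conjugation $\tau$, extend $H$ and $K$ holomorphically to $\mathbb{C}M$, put $\overline H=\tau_*H$, $\overline K=\tau_*K$, and shrink so that $H\cap\overline H=0$ and the space $\mathcal N$ of leaves of the foliation integrating $K\oplus\overline K$ is a complex manifold with holomorphic submersion $\pi:\mathbb{C}M\to\mathcal N$. Then $\mathcal D=\pi_*(H\oplus\overline H)$ is a contact distribution on $\mathcal N$; for a local 1-form $\alpha$ with $\ker\alpha=\mathcal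 D$, the form $d\alpha|_{\mathcal D_\gamma}$ defines a conformal symplectic structure on $\mathcal D_\gamma$. For $p\in\mathbb{C}M$ and $\gamma=\pi(p)$ set $$\mathfrak g_{-1}(p)=\mathcal D_\gamma,\quad \mathfrak g_{-1,1}(p)=\pi_*H_p,\quad \mathfrak g_{-1,-1}(p)=\pi_*\overline H_p,\quad \mathfrak g_{-2}(p)=T_\gamma\mathcal N/\mathcal D_\gamma .$$ Let $\mathfrak g_-(p)=\mathfrak g_{-1}(p)\oplus\mathfrak g_{-2}(p)$ be the Heisenberg algebra of the conformal symplectic space $\mathcal D_\gamma$. Let $\mathfrak g_{0,2}(p)\subset \mathrm{Hom}(\mathfrak g_{-1,-1}(p),\mathfrak g_{-1,1}(p))$ be the tangent space at $\pi_*\overline H_p$ of the family of Lagrangian subspaces $\{\pi_*\overline H_q: q\in\pi^{-1}(\gamma)\}$ of $\mathcal D_\gamma$, and let $\mathfrak g_{0,-2}(p)\subset\mathrm{Hom}(\mathfrak g_{-1,1}(p),\mathfrak g_{-1,-1}(p))$ be the tangent space at $\pi_*H_p$ of $\{\pi_*H_q: q\in\pi^{-1}(\gamma)\}$; both are extended by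 zero to subspaces of $\mathfrak{csp}(\mathcal D_\gamma)$. A (model) CR symbol consists of a conformal symplectic space $\mathfrak g_{-1}$ with an antilinear involution $\sigma$, a splitting $\mathfrak g_{-1}=\mathfrak g_{-1,-1}\oplus\mathfrak g_{-1,1}$ into Lagrangian subspaces exchanged by $\sigma$, and $r$-dimensional subspaces $\mathfrak g_{0,2}\subset\mathrm{Sym}^2(\mathfrak g_{-1,-1}^*)$, $\mathfrak g_{0,-2}\subset\mathrm{Sym}^2(\mathfrak g_{-1,1}^*)$ of $\mathfrak{csp}(\mathfrak g_{-1})$ exchanged by $\sigma$. Let $\mathfrak g_-=\mathfrak g_{-1}\oplus\mathfrak g_{-2}$ be the associated Heisenberg algebra, and let $\mathfrak g_{0,0}$ be the largest subalgebra of $\mathfrak{csp}(\mathfrak g_{-1})$ with $[\mathfrak g_{0,0},\mathfrak g_{-1,\pm1}]\subset\mathfrak g_{-1,\pm1}$ and $[\mathfrak g_{0,0},\mathfrak g_{0,\pm2}]\subset\mathfrak g_{0,\pm2}$. Write $\mathfrak g_0=\mathfrak g_{0,-2}\oplus\mathfrak g_{0,0}\oplus\mathfrak g_{0,2}$ and $\mathfrak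 g^0=\mathfrak g_-\oplus\mathfrak g_0$. The symbol is regular if $[\mathfrak g_{0,-2},\mathfrak g_{0,2}]\subset\mathfrak g_{0,0}$. Assume that $H$ has constant CR symbol $\mathfrak g^0$: for every $p\in\mathbb{C}M$ there is an adapted frame at $p$, that is, a graded Lie algebra isomorphism $\varphi:\mathfrak g_-\to\mathfrak g_-(p)$ with $\varphi(\mathfrak g_{-1,\pm1})=\mathfrak g_{-1,\pm1}(p)$ and $\varphi^{-1}\circ\mathfrak g_{0,\pm2}(p)\circ\varphi=\mathfrak g_{0,\pm2}$. Let $P^0$ be the bundle of all adapted frames at all points of $\mathbb{C}M$, and let $(P^0)_\gamma$ be its part over the leaf $\gamma\in\mathcal N$. For $\psi\in (P^0)_\gamma$ let $\mathfrak g_0^{\mathrm{mod}}(\psi)\subset\mathfrak{csp}(\mathfrak g_{-1})$ be the set of all $\psi(0)^{-1}\psi'(0)$ for smooth curves $\psi(t)$ in $(P^0)_\gamma$ with $\psi(0)=\psi$, and let $\mathfrak g^{0,\mathrm{mod}}(\psi)=\mathfrak g_-\oplus\mathfrak g_0^{\mathrm{mod}}(\psi)$ be the modified CR symbol at $\psi$.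 Theorem. If the modified CR symbol is constant, $\mathfrak g^{0,\mathrm{mod}}(\psi)=\mathfrak g^{0,\mathrm{mod}}$ for all $\psi\in P^0$, then the CR symbol $\mathfrak g^0$ is regular and $\mathfrak g^{0,\mathrm{mod}}=\mathfrak g^0$. -/

import Mathlib

open Set Filter Topology
open scoped Manifold ContDiff TensorProduct

noncomputable section

/-! ## Complex distributions on domains of `ℝ^d` and their brackets -/

/-- The complex conjugate of a complex subspace of `ℂ^d`. -/
def conjSub {d : ℕ} (S : Submodule ℂ (Fin d → ℂ)) : Submodule ℂ (Fin d → ℂ) where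
  carrier := {z | star z ∈ S}
  add_mem' := fun {a b} ha hb => by
    simpa only [mem_ofPred_eq, star_add] using S.add_mem ha hb
  zero_mem' := by simp
  smul_mem' := fun c z hz => by
    simpa only [mem_ofPred_eq, star_smul] using S.smul_mem (star c) hz

/-- The inclusion of `ℝ^d` into `ℂ^d`. -/
def toC {d : ℕ} (x : Fin d → ℝ) : Fin d → ℂ := fun i => (x i : ℂ)

/-- The derivative of `Y : ℝ^d → ℂ^d` at `x` along the complexified tangent vector `v`
(the real derivative, extended complex linearly in the direction). -/
def dirDeriv {d : ℕ} (Y : (Fin d → ℝ) → (Fin d → ℂ)) (x : Fin d → ℝ) (v : Fin d → ℂ) :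
    Fin d → ℂ :=
  fderiv ℝ Y x (fun i => (v i).re) + Complex.I • fderiv ℝ Y x (fun i => (v i).im)

/-- The Lie bracket `[X, Y]` at `x` of two sections of the complexified tangent bundle of `ℝ^d`. -/
def cBracket {d : ℕ} (X Y : (Fin d → ℝ) → (Fin d → ℂ)) (x : Fin d → ℝ) : Fin d → ℂ :=
  dirDeriv Y x (X x) - dirDeriv X x (Y x)

/-- `X` is a smooth local section, near `x`, of the complex distribution `H`. -/
def IsSectionAt {d : ℕ} (H : (Fin d → ℝ) → Submodule ℂ (Fin d → ℂ)) (x : Fin d → ℝ)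
    (X : (Fin d → ℝ) → (Fin d → ℂ)) : Prop :=
  ContDiffAt ℝ ∞ X x ∧ ∀ᶠ y in 𝓝 x, X y ∈ H y

/-- `H` is a real-analytic complex distribution of rank `k` on `Ω ⊆ ℝ^d`, that is, a real-analytic
subbundle of rank `k` of the complexified tangent bundle of `Ω`. -/
def IsAnalyticDistribution {d : ℕ} (Ω : Set (Fin d → ℝ))
    (H : (Fin d → ℝ) → Submodule ℂ (Fin d → ℂ)) (k : ℕ) : Prop :=
  ∀ x ∈ Ω, ∃ X : Fin k → (Fin d → ℝ) → (Fin d → ℂ), (∀ i, AnalyticAt ℝ (X i) x) ∧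
    ∀ᶠ y in 𝓝 x, LinearIndependent ℂ (fun i => X i y) ∧
      Submodule.span ℂ (range fun i => X i y) = H y

lemma dirDeriv_add_vec {d : ℕ} (Y : (Fin d → ℝ) → (Fin d → ℂ)) (x : Fin d → ℝ)
    (v w : Fin d → ℂ) : dirDeriv Y x (v + w) = dirDeriv Y x v + dirDeriv Y x w := by
  have h1 : (fun i => ((v + w) i).re) = (fun i => (v i).re) + fun i => (w i).re := by
    ext i; simp
  have h2 : (fun i => ((v + w) i).im) = (fun i => (v i).im) + fun i => (w i).im := by
    ext i; simp
  simp only [dirDeriv, h1, h2, map_add, smul_add]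
  abel

lemma dirDeriv_smul_vec {d : ℕ} (Y : (Fin d → ℝ) → (Fin d → ℂ)) (x : Fin d → ℝ)
    (c : ℂ) (v : Fin d → ℂ) : dirDeriv Y x (c • v) = c • dirDeriv Y x v := by
  have h1 : (fun i => ((c • v) i).re) =
      c.re • (fun i => (v i).re) - c.im • fun i => (v i).im := by
    ext i; simp
  have h2 : (fun i => ((c • v) i).im) =
      c.re • (fun i => (v i).im) + c.im • fun i => (v i).re := by
    ext i; simp
  simp only [dirDeriv, h1, h2, map_add, map_sub, map_smul]
  ext i
  apply Complex.ext <;> simp <;> ring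

lemma dirDeriv_add {d : ℕ} {X Y : (Fin d → ℝ) → (Fin d → ℂ)} {x : Fin d → ℝ}
    (hX : DifferentiableAt ℝ X x) (hY : DifferentiableAt ℝ Y x) (v : Fin d → ℂ) :
    dirDeriv (X + Y) x v = dirDeriv X x v + dirDeriv Y x v := by
  simp only [dirDeriv, fderiv_add hX hY, add_apply, smul_add]
  abel

lemma dirDeriv_smul {d : ℕ} {X : (Fin d → ℝ) → (Fin d → ℂ)} {x : Fin d → ℝ}
    (hX : DifferentiableAt ℝ X x) (c : ℂ) (v : Fin d → ℂ) :
    dirDeriv (c • X) x v = c • dirDeriv X x v := by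
  simp only [dirDeriv, fderiv_const_smul hX c, smul_apply, smul_add]
  rw [smul_comm c Complex.I]

/-! ## The Levi form, its kernel, CR structures and 2-nondegeneracy, in coordinates -/

/-- The Levi kernel at `x`: the values at `x` of the local sections `X` of `H` such that the Levi
form `𝓛(X_x, Y_x) = (i/2) [X, Ȳ]_x mod H_x ⊕ H̄_x` vanishes for all local sections `Y` of `H`.
(By tensoriality the condition depends only on the value `X_x`.) -/
def leviKernel {d : ℕ} (H : (Fin d → ℝ) → Submodule ℂ (Fin d → ℂ)) (x : Fin d → ℝ) :
    Submodule ℂ (Fin d → ℂ) where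
  carrier := {v | ∃ X, IsSectionAt H x X ∧ X x = v ∧ ∀ Y, IsSectionAt H x Y →
    (Complex.I / 2) • cBracket X (fun y => star (Y y)) x ∈ H x ⊔ conjSub (H x)}
  add_mem' := by
    rintro _ _ ⟨X₁, h₁, rfl, k₁⟩ ⟨X₂, h₂, rfl, k₂⟩
    refine ⟨X₁ + X₂, ⟨h₁.1.add h₂.1, ?_⟩, rfl, fun Y hY => ?_⟩
    · filter_upwards [h₁.2, h₂.2] with y a b using (H y).add_mem a b
    · have e := (H x ⊔ conjSub (H x)).add_mem (k₁ Y hY) (k₂ Y hY)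
      have d₁ : DifferentiableAt ℝ X₁ x := h₁.1.differentiableAt (by simp)
      have d₂ : DifferentiableAt ℝ X₂ x := h₂.1.differentiableAt (by simp)
      rw [← smul_add] at e
      convert e using 2
      simp only [cBracket, Pi.add_apply X₁ X₂, dirDeriv_add_vec, dirDeriv_add d₁ d₂]
      abel
  zero_mem' := by
    refine ⟨0, ⟨contDiffAt_const, Eventually.of_forall fun y => (H y).zero_mem⟩, rfl,
      fun Y _ => ?_⟩
    have h : cBracket (0 : (Fin d → ℝ) → (Fin d → ℂ)) (fun y => star (Y y)) x = 0 := by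
      have h0 : (fun _ : Fin d => (0 : ℝ)) = 0 := rfl
      simp [cBracket, dirDeriv, h0]
    rw [h, smul_zero]
    exact Submodule.zero_mem _
  smul_mem' := by
    rintro c _ ⟨X, h, rfl, k⟩
    refine ⟨c • X, ⟨h.1.const_smul c, ?_⟩, rfl, fun Y hY => ?_⟩
    · filter_upwards [h.2] with y a using (H y).smul_mem c a
    · have e := (H x ⊔ conjSub (H x)).smul_mem c (k Y hY)
      have d₁ : DifferentiableAt ℝ X x := h.1.differentiableAt (by simp)
      rw [smul_comm] at e
      convert e using 2
      simp only [cBracket, Pi.smul_apply c X, dirDeriv_smul_vec, dirDeriv_smul d₁, smul_sub]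

/-- A real-analytic CR structure of hypersurface type on a domain `Ω` of `ℝ^(2n+1)`: a real-analytic
complex distribution `H` of rank `n` with `[H, H] ⊆ H` and `H ∩ H̄ = 0`. -/
structure IsCRDomain {n : ℕ} (Ω : Set (Fin (2 * n + 1) → ℝ))
    (H : (Fin (2 * n + 1) → ℝ) → Submodule ℂ (Fin (2 * n + 1) → ℂ)) : Prop where
  analytic : IsAnalyticDistribution Ω H n
  involutive : ∀ x ∈ Ω, ∀ X Y, IsSectionAt H x X → IsSectionAt H x Y → cBracket X Y x ∈ H x
  totally_real : ∀ x ∈ Ω, Disjoint (H x) (conjSub (H x))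

/-- The Levi kernel `K` of `H` has constant rank `r` and `H` is 2-nondegenerate at every point:
`K_x ≠ 0`, and for every local section `V` of `K` with `V_x ≠ 0` the map
`ad_V : H̄_x / K̄_x → H_x / K_x`, `Ȳ ↦ [V, Ȳ]_x mod K_x ⊕ H̄_x`, is not zero. -/
structure IsTwoNondegenerateDomain {n : ℕ} (Ω : Set (Fin (2 * n + 1) → ℝ))
    (H : (Fin (2 * n + 1) → ℝ) → Submodule ℂ (Fin (2 * n + 1) → ℂ)) (r : ℕ) : Prop where
  rank_kernel : ∀ x ∈ Ω, Module.finrank ℂ (leviKernel H x) = r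
  kernel_ne : ∀ x ∈ Ω, leviKernel H x ≠ ⊥
  nondegenerate : ∀ x ∈ Ω, ∀ V, IsSectionAt (leviKernel H) x V → V x ≠ 0 →
    ∃ Y, IsSectionAt H x Y ∧
      cBracket V (fun y => star (Y y)) x ∉ leviKernel H x ⊔ conjSub (H x)

/-! ## CR structures on real-analytic manifolds -/

section CRManifold

variable {n : ℕ} {M : Type*} [TopologicalSpace M] [ChartedSpace (Fin (2 * n + 1) → ℝ) M]

/-- The coordinate expression at `x ∈ e.target`, in the chart `e`, of a field `H` of subspaces
`H_p ⊆ ℂ ⊗ T_p M`: the image of `H_p`, `p = e⁻¹(x)`, under the complexified differential of `e`. -/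
def coordExpr (H : ∀ p : M, Submodule ℂ (ℂ ⊗[ℝ] TangentSpace 𝓘(ℝ, Fin (2 * n + 1) → ℝ) p))
    (e : OpenPartialHomeomorph M (Fin (2 * n + 1) → ℝ)) (x : Fin (2 * n + 1) → ℝ) :
    Submodule ℂ (Fin (2 * n + 1) → ℂ) :=
  (H (e.symm x)).map
    ((TensorProduct.piScalarRight ℝ ℂ ℂ (Fin (2 * n + 1))).toLinearMap ∘ₗ
      LinearMap.baseChange ℂ
        (mfderiv 𝓘(ℝ, Fin (2 * n + 1) → ℝ) 𝓘(ℝ, Fin (2 * n + 1) → ℝ) e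
          (e.symm x)).toLinearMap)

/-- `H` is a real-analytic, 2-nondegenerate CR structure of hypersurface type on the
`(2n+1)`-dimensional real-analytic manifold `M`, with Levi kernel of constant rank `r`.
All conditions are invariant under changes of coordinates and are read off in the charts of `M`. -/
def IsTwoNondegenerateCRStructure
    (H : ∀ p : M, Submodule ℂ (ℂ ⊗[ℝ] TangentSpace 𝓘(ℝ, Fin (2 * n + 1) → ℝ) p))
    (r : ℕ) : Prop :=
  ∀ e ∈ IsManifold.maximalAtlas 𝓘(ℝ, Fin (2 * n + 1) → ℝ) ω M,
    IsCRDomain e.target (coordExpr H e) ∧ IsTwoNondegenerateDomain e.target (coordExpr H e) r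

end CRManifold

/-! ## The local complexification and the Levi leaf space -/

/-- `H` is a holomorphic distribution of rank `k` on `U ⊆ ℂ^d`. -/
def IsHolomorphicDistribution {d : ℕ} (U : Set (Fin d → ℂ))
    (H : (Fin d → ℂ) → Submodule ℂ (Fin d → ℂ)) (k : ℕ) : Prop :=
  ∀ z ∈ U, ∃ X : Fin k → (Fin d → ℂ) → (Fin d → ℂ), (∀ i, AnalyticAt ℂ (X i) z) ∧
    ∀ᶠ y in 𝓝 z, LinearIndependent ℂ (fun i => X i y) ∧
      Submodule.span ℂ (range fun i => X i y) = H y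

/-- The conjugate `τ_* H` of a distribution on `ℂ^d`, where `τ(z) = z̄`. -/
def conjDist {d : ℕ} (H : (Fin d → ℂ) → Submodule ℂ (Fin d → ℂ)) (z : Fin d → ℂ) :
    Submodule ℂ (Fin d → ℂ) := conjSub (H (star z))

/-- A local complexification `U` (invariant under the involution `τ(z) = z̄`) of the CR structure
`H₀` on a domain `Ω ⊆ ℝ^(2n+1)`, with the holomorphic extensions `H` and `K` of `H₀` and of its Levi
kernel, shrunk so that `H ∩ H̄ = 0` and that the space of leaves of the foliation integrating
`K ⊕ K̄` is a complex manifold covered by one chart: the leaf space is the open set `π(U) ⊆ ℂ^k`,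
and the leaves are the fibres of the holomorphic submersion `π` on `U`
(so `k = 2n + 1 - 2r`). -/
structure LeviComplexification {n : ℕ} (Ω : Set (Fin (2 * n + 1) → ℝ))
    (H₀ : (Fin (2 * n + 1) → ℝ) → Submodule ℂ (Fin (2 * n + 1) → ℂ)) (r k : ℕ) where
  U : Set (Fin (2 * n + 1) → ℂ)
  isOpen : IsOpen U
  connected : IsConnected U
  star_mem : ∀ z ∈ U, star z ∈ U
  real_mem : ∀ x, toC x ∈ U → x ∈ Ω
  real_nonempty : ∃ x, toC x ∈ U
  H : (Fin (2 * n + 1) → ℂ) → Submodule ℂ (Fin (2 * n + 1) → ℂ)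
  K : (Fin (2 * n + 1) → ℂ) → Submodule ℂ (Fin (2 * n + 1) → ℂ)
  holomorphic_H : IsHolomorphicDistribution U H n
  holomorphic_K : IsHolomorphicDistribution U K r
  extends_H : ∀ x, toC x ∈ U → H (toC x) = H₀ x
  extends_K : ∀ x, toC x ∈ U → K (toC x) = leviKernel H₀ x
  disjoint : ∀ z ∈ U, Disjoint (H z) (conjDist H z)
  π : (Fin (2 * n + 1) → ℂ) → (Fin k → ℂ)
  holomorphic_π : AnalyticOnNhd ℂ π U
  submersion : ∀ z ∈ U, Function.Surjective (fderiv ℂ π z)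
  ker_π : ∀ z ∈ U, LinearMap.ker (fderiv ℂ π z).toLinearMap = K z ⊔ conjDist K z
  leaf_connected : ∀ γ, IsPreconnected (U ∩ π ⁻¹' {γ})

/-! ## Abstract CR symbols -/

section Symbol

variable {W : Type*} [AddCommGroup W] [Module ℂ W]

/-- `A` lies in `csp(W)`: it is an infinitesimal conformal symplectic transformation of `(W, [B])`. -/
def IsCsp (B : LinearMap.BilinForm ℂ W) (A : Module.End ℂ W) : Prop :=
  ∃ c : ℂ, ∀ x y, B (A x) y + B x (A y) = c * B x y

/-- `L` is a Lagrangian subspace: it is its own `B`-orthogonal complement. -/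
def IsLagrangian (B : LinearMap.BilinForm ℂ W) (L : Submodule ℂ W) : Prop :=
  ∀ x, x ∈ L ↔ ∀ y ∈ L, B x y = 0

variable (W) in
/-- A CR symbol with involution, with Levi kernel of rank `r`: a conformal symplectic space
`W = 𝔤_{-1}` (`form` is a representative of its conformal class) with an antilinear
involution `σ`, a splitting into Lagrangian subspaces `neg = 𝔤_{-1,-1}` and `pos = 𝔤_{-1,1}`
exchanged by `σ`, and two `r`-dimensional spaces `up = 𝔤_{0,2} ⊆ Sym²(𝔤_{-1,-1}^*)` and
`down = 𝔤_{0,-2} ⊆ Sym²(𝔤_{-1,1}^*)` of elements of `csp(W)`, exchanged by `σ`. -/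
structure CRSymbol (r : ℕ) where
  form : LinearMap.BilinForm ℂ W
  alt : form.IsAlt
  nondegenerate : form.Nondegenerate
  σ : W →ₛₗ[starRingEnd ℂ] W
  σ_σ : ∀ x, σ (σ x) = x
  σ_conformal : ∃ c : ℂ, c ≠ 0 ∧ ∀ x y, form (σ x) (σ y) = c * starRingEnd ℂ (form x y)
  neg : Submodule ℂ W
  pos : Submodule ℂ W
  isCompl : IsCompl neg pos
  neg_lagrangian : IsLagrangian form neg
  pos_lagrangian : IsLagrangian form pos
  σ_neg : ∀ x, σ x ∈ pos ↔ x ∈ neg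
  up : Submodule ℂ (Module.End ℂ W)
  down : Submodule ℂ (Module.End ℂ W)
  up_mem : ∀ A ∈ up, (∀ x ∈ pos, A x = 0) ∧ (∀ x ∈ neg, A x ∈ pos) ∧
    ∀ x y, form (A x) y + form x (A y) = 0
  down_mem : ∀ A ∈ down, (∀ x ∈ neg, A x = 0) ∧ (∀ x ∈ pos, A x ∈ neg) ∧
    ∀ x y, form (A x) y + form x (A y) = 0
  finrank_up : Module.finrank ℂ up = r
  finrank_down : Module.finrank ℂ down = r
  σ_up : ∀ A, σ.comp (A.comp σ) ∈ down ↔ A ∈ up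

namespace CRSymbol

variable {r : ℕ} (g : CRSymbol W r)

/-- `𝔤_{0,0}`: the set of all `A ∈ csp(W)` with `[A, 𝔤_{-1,±1}] ⊆ 𝔤_{-1,±1}` and
`[A, 𝔤_{0,±2}] ⊆ 𝔤_{0,±2}`. By `lie_mem_zero` it is closed under commutators, so it is the largest
Lie subalgebra with these properties. -/
def zero : Submodule ℂ (Module.End ℂ W) where
  carrier := {A | IsCsp g.form A ∧ (∀ x ∈ g.neg, A x ∈ g.neg) ∧ (∀ x ∈ g.pos, A x ∈ g.pos) ∧
    (∀ B ∈ g.up, ⁅A, B⁆ ∈ g.up) ∧ (∀ B ∈ g.down, ⁅A, B⁆ ∈ g.down)}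
  add_mem' := by
    rintro A B ⟨⟨a, ha⟩, h1, h2, h3, h4⟩ ⟨⟨b, hb⟩, k1, k2, k3, k4⟩
    have e : ∀ C : Module.End ℂ W, ⁅A + B, C⁆ = ⁅A, C⁆ + ⁅B, C⁆ := fun C => by
      simp only [Ring.lie_def]; noncomm_ring
    refine ⟨⟨a + b, fun x y => ?_⟩, fun x hx => g.neg.add_mem (h1 x hx) (k1 x hx),
      fun x hx => g.pos.add_mem (h2 x hx) (k2 x hx), fun C hC => ?_, fun C hC => ?_⟩
    · simp only [LinearMap.add_apply, map_add]
      linear_combination ha x y + hb x y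
    · rw [e]; exact g.up.add_mem (h3 C hC) (k3 C hC)
    · rw [e]; exact g.down.add_mem (h4 C hC) (k4 C hC)
  zero_mem' := by
    have e : ∀ C : Module.End ℂ W, ⁅(0 : Module.End ℂ W), C⁆ = 0 := fun C => by
      simp [Ring.lie_def]
    refine ⟨⟨0, by simp⟩, by simp, by simp, fun B _ => ?_, fun B _ => ?_⟩
    · rw [e]; exact g.up.zero_mem
    · rw [e]; exact g.down.zero_mem
  smul_mem' := by
    rintro c A ⟨⟨a, ha⟩, h1, h2, h3, h4⟩
    have e : ∀ C : Module.End ℂ W, ⁅c • A, C⁆ = c • ⁅A, C⁆ := fun C => by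
      simp only [Ring.lie_def, smul_mul_assoc, mul_smul_comm, smul_sub]
    refine ⟨⟨c * a, fun x y => ?_⟩, fun x hx => g.neg.smul_mem c (h1 x hx),
      fun x hx => g.pos.smul_mem c (h2 x hx), fun C hC => ?_, fun C hC => ?_⟩
    · simp only [LinearMap.smul_apply, map_smul, smul_eq_mul]
      linear_combination c * ha x y
    · rw [e]; exact g.up.smul_mem c (h3 C hC)
    · rw [e]; exact g.down.smul_mem c (h4 C hC)

lemma lie_mem_zero {A B : Module.End ℂ W} (hA : A ∈ g.zero) (hB : B ∈ g.zero) :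
    ⁅A, B⁆ ∈ g.zero := by
  obtain ⟨⟨a, ha⟩, h1, h2, h3, h4⟩ := hA
  obtain ⟨⟨b, hb⟩, k1, k2, k3, k4⟩ := hB
  have e : ∀ C : Module.End ℂ W, ⁅⁅A, B⁆, C⁆ = ⁅A, ⁅B, C⁆⁆ - ⁅B, ⁅A, C⁆⁆ := fun C => by
    simp only [Ring.lie_def]; noncomm_ring
  have f : ∀ x, ⁅A, B⁆ x = A (B x) - B (A x) := fun x => rfl
  refine ⟨⟨0, fun x y => ?_⟩, fun x hx => ?_, fun x hx => ?_, fun C hC => ?_, fun C hC => ?_⟩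
  · simp only [f, LinearMap.sub_apply, map_sub]
    linear_combination ha (B x) y - hb (A x) y + ha x (B y) - hb x (A y)
      + a * hb x y - b * ha x y
  · rw [f]; exact g.neg.sub_mem (h1 _ (k1 x hx)) (k1 _ (h1 x hx))
  · rw [f]; exact g.pos.sub_mem (h2 _ (k2 x hx)) (k2 _ (h2 x hx))
  · rw [e]; exact g.up.sub_mem (h3 _ (k3 C hC)) (k3 _ (h3 C hC))
  · rw [e]; exact g.down.sub_mem (h4 _ (k4 C hC)) (k4 _ (h4 C hC))

/-- `𝔤_0 = 𝔤_{0,-2} ⊕ 𝔤_{0,0} ⊕ 𝔤_{0,2}`. -/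
def degreeZero : Submodule ℂ (Module.End ℂ W) := g.down ⊔ g.zero ⊔ g.up

/-- The CR symbol `𝔤^0 = 𝔤_- ⊕ 𝔤_0` as a subspace of `𝔤_- ⊕ End(𝔤_{-1})`. Here
`𝔤_- = 𝔤_{-1} ⊕ 𝔤_{-2} = W × ℂ` is the Heisenberg algebra with `[(x, s), (y, t)] = (0, form x y)`. -/
def total : Submodule ℂ ((W × ℂ) × Module.End ℂ W) := (⊤ : Submodule ℂ (W × ℂ)).prod g.degreeZero

/-- The CR symbol is regular: `[𝔤_{0,-2}, 𝔤_{0,2}] ⊆ 𝔤_{0,0}`. -/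
def IsRegular : Prop := ∀ A ∈ g.down, ∀ B ∈ g.up, ⁅A, B⁆ ∈ g.zero

end CRSymbol

end Symbol

/-! ## Symbols at points, the bundle `P⁰` and modified symbols -/

namespace LeviComplexification

variable {n r k : ℕ} {Ω : Set (Fin (2 * n + 1) → ℝ)}
  {H₀ : (Fin (2 * n + 1) → ℝ) → Submodule ℂ (Fin (2 * n + 1) → ℂ)}
  (C : LeviComplexification Ω H₀ r k)

/-- `𝔤_{-1,1}(z) = π_* H_z`. -/
def posAt (z : Fin (2 * n + 1) → ℂ) : Submodule ℂ (Fin k → ℂ) :=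
  (C.H z).map (fderiv ℂ C.π z).toLinearMap

/-- `𝔤_{-1,-1}(z) = π_* H̄_z`. -/
def negAt (z : Fin (2 * n + 1) → ℂ) : Submodule ℂ (Fin k → ℂ) :=
  (conjDist C.H z).map (fderiv ℂ C.π z).toLinearMap

/-- The contact distribution `𝓓 = π_* (H ⊕ H̄)` on the leaf space (the image is the same at all points
`z` of the leaf `γ`). -/
def contactD (γ : Fin k → ℂ) : Submodule ℂ (Fin k → ℂ) :=
  ⨆ z ∈ C.U ∩ C.π ⁻¹' {γ}, (C.H z ⊔ conjDist C.H z).map (fderiv ℂ C.π z).toLinearMap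

/-- `α` is a holomorphic 1-form near `γ` on the leaf space whose kernel is the contact
distribution. -/
def IsContactForm (γ : Fin k → ℂ) (α : (Fin k → ℂ) → ((Fin k → ℂ) →L[ℂ] ℂ)) : Prop :=
  AnalyticAt ℂ α γ ∧ ∀ᶠ γ' in 𝓝 γ, LinearMap.ker (α γ').toLinearMap = C.contactD γ'

/-- A smooth curve near `t = 0` in the leaf through `z`, starting at `z`. -/
def IsLeafCurve (z : Fin (2 * n + 1) → ℂ) (c : ℝ → (Fin (2 * n + 1) → ℂ)) : Prop :=
  c 0 = z ∧ ContDiffAt ℝ ∞ c 0 ∧ ∀ᶠ t in 𝓝 0, c t ∈ C.U ∧ C.π (c t) = C.π z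

/-- The velocity at `t = 0` of the curve `t ↦ Λ t` of subspaces of `D`, as an element of
`Hom(Λ 0, D / Λ 0)`, is induced by `A`: for every smooth curve `x(t) ∈ Λ t` one has
`x'(0) ≡ A x(0) mod Λ 0`. -/
def IsVelocity {D : Submodule ℂ (Fin k → ℂ)} (Λ : ℝ → Submodule ℂ (Fin k → ℂ))
    (A : Module.End ℂ D) : Prop :=
  ∀ x : ℝ → (Fin k → ℂ), ContDiffAt ℝ ∞ x 0 → (∀ᶠ t in 𝓝 0, x t ∈ Λ t) →
    ∀ w : D, (w : Fin k → ℂ) = x 0 → deriv x 0 - (A w : Fin k → ℂ) ∈ Λ 0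

/-- `𝔤_{0,2}(z)`: the tangent space at `π_* H̄_z` of the submanifold of the Lagrangian Grassmannian of
`𝓓_γ` formed by the spaces `π_* H̄_{z'}`, `z'` in the leaf `γ` of `z`, viewed in
`Hom(𝔤_{-1,-1}(z), 𝔤_{-1,1}(z))` and extended by zero to `𝔤_{-1,1}(z)`. -/
def upAt (z : Fin (2 * n + 1) → ℂ) : Set (Module.End ℂ (C.contactD (C.π z))) :=
  {A | (∀ x : C.contactD (C.π z), (x : Fin k → ℂ) ∈ C.posAt z → A x = 0) ∧
    (∀ x : C.contactD (C.π z), (x : Fin k → ℂ) ∈ C.negAt z → (A x : Fin k → ℂ) ∈ C.posAt z) ∧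
    ∃ c, C.IsLeafCurve z c ∧ IsVelocity (fun t => C.negAt (c t)) A}

/-- `𝔤_{0,-2}(z)`: the same for the spaces `π_* H_{z'}`, viewed in
`Hom(𝔤_{-1,1}(z), 𝔤_{-1,-1}(z))` and extended by zero to `𝔤_{-1,-1}(z)`. -/
def downAt (z : Fin (2 * n + 1) → ℂ) : Set (Module.End ℂ (C.contactD (C.π z))) :=
  {A | (∀ x : C.contactD (C.π z), (x : Fin k → ℂ) ∈ C.negAt z → A x = 0) ∧
    (∀ x : C.contactD (C.π z), (x : Fin k → ℂ) ∈ C.posAt z → (A x : Fin k → ℂ) ∈ C.negAt z) ∧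
    ∃ c, C.IsLeafCurve z c ∧ IsVelocity (fun t => C.posAt (c t)) A}

variable {W : Type*} [AddCommGroup W] [Module ℂ W]

/-- The bundle `P⁰` of adapted frames for the model symbol `g`. A point consists of a point `pt` of
the complexification and a graded isomorphism `𝔤_- → 𝔤_-(pt)` of Heisenberg algebras which respects
`𝔤_{-1,±1}` and conjugates `𝔤_{0,±2}(pt)` to `𝔤_{0,±2}`. Such an isomorphism is given by its degree
`-1` part `frame : 𝔤_{-1} → 𝓓_γ`, which has to be conformally symplectic, that is,
to carry the symplectic form of `g` to `dα|_{𝓓_γ}` for some contact form `α`; its degree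
`-2` part is then determined. -/
structure P0 (g : CRSymbol W r) where
  pt : Fin (2 * n + 1) → ℂ
  pt_mem : pt ∈ C.U
  frame : W ≃ₗ[ℂ] C.contactD (C.π pt)
  conformal : ∃ α, C.IsContactForm (C.π pt) α ∧ ∀ x y : W,
    fderiv ℂ α (C.π pt) (frame x) (frame y) - fderiv ℂ α (C.π pt) (frame y) (frame x) = g.form x y
  map_neg : ∀ x, (frame x : Fin k → ℂ) ∈ C.negAt pt ↔ x ∈ g.neg
  map_pos : ∀ x, (frame x : Fin k → ℂ) ∈ C.posAt pt ↔ x ∈ g.pos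
  conj_up : ∀ A, frame.conj A ∈ C.upAt pt ↔ A ∈ g.up
  conj_down : ∀ A, frame.conj A ∈ C.downAt pt ↔ A ∈ g.down

/-- The CR structure has constant symbol, represented by the model `g`: at every point of the
complexification the symbol is isomorphic to `g`. -/
def HasConstantSymbol (g : CRSymbol W r) : Prop := ∀ z ∈ C.U, ∃ ψ : C.P0 g, ψ.pt = z

/-- `𝔤_0^mod(ψ) = θ₀(T_ψ (P⁰)_γ)`, where `γ` is the leaf of `ψ` and `(P⁰)_γ` the fibre of `P⁰` over `γ`:
the set of all `ψ(0)⁻¹ ∘ ψ'(0)` for smooth curves `ψ(t)` in `(P⁰)_γ` with `ψ(0) = ψ`. -/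
def modZero {g : CRSymbol W r} (ψ : C.P0 g) : Set (Module.End ℂ W) :=
  {A | ∃ c : ℝ → C.P0 g, c 0 = ψ ∧ (∀ᶠ t in 𝓝 0, C.π (c t).pt = C.π ψ.pt) ∧
    ContDiffAt ℝ ∞ (fun t => (c t).pt) 0 ∧
    ∀ w : W, ContDiffAt ℝ ∞ (fun t => ((c t).frame w : Fin k → ℂ)) 0 ∧
      deriv (fun t => ((c t).frame w : Fin k → ℂ)) 0 = (ψ.frame (A w) : Fin k → ℂ)}

/-- The modified CR symbol `𝔤^{0,mod}(ψ) = 𝔤_- ⊕ 𝔤_0^mod(ψ)`. -/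
def modifiedSymbol {g : CRSymbol W r} (ψ : C.P0 g) : Set ((W × ℂ) × Module.End ℂ W) :=
  {u | u.2 ∈ C.modZero ψ}

end LeviComplexification

end

/-! Along a leaf the contact hyperplane is constant, so a frame at one point identifies it with `W`
for all points of the leaf. What varies is the splitting: in a chart of the leaf it is the image of
the model splitting under an analytic family `F q` of automorphisms of `W`. An adapted frame is then
`T = F q * h` with `h` block diagonal, conformal up to the factor coming from `F`, and with `h`
conjugating `𝔤_{0,±2}` to the off-diagonal parts of `F⁻¹ dF`, which are the velocities of the
splitting. The adapted frames at one point form a torsor under a group with Lie algebra `𝔤_{0,0}`.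

Take a local section `T` of adapted frames and put `θ = T⁻¹ dT`. The velocities of frames at `T` are
the sums of a value of `θ` and an element of `𝔤_{0,0}`. Suppose that they form the same set `S` at
every frame. Then `θ` takes values in `S` at all nearby points, and the Maurer-Cartan equation `dθ +
θ ∧ θ = 0` makes `S` closed under commutators. Comparing a frame with its translates shows that `S`
is invariant under the structure group. This group contains `c p + c⁻¹ p'`, where `p`, `p'` are the
projections to `𝔤_{-1,1}`, `𝔤_{-1,-1}`, so `S` contains the components of weight `-2`, `0`, `2` of
its elements. The components of weight `±2` fill exactly `𝔤_{0,±2}`, because the off-diagonal part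
of a frame velocity is the velocity of the splitting. An element of `S` of weight `0` has brackets
with `𝔤_{0,±2}` that lie in `S` and have weight `±2`, so it normalizes both spaces and belongs to
`𝔤_{0,0}`. Applied to `[𝔤_{0,-2}, 𝔤_{0,2}] ⊆ S` this is regularity, and the decomposition by weight
gives `S = 𝔤_0`. This is `AlgebraSymbol.regular_of_velocities_eq`.

The argument differentiates a section, while a constant symbol only provides a frame at each point
separately. The data that an adapted frame must normalize (the splitting, the form, bases of the two
spaces of velocities) depend analytically on the point and stay in a single orbit of the units of a
finite dimensional algebra. Such a map lifts analytically to the units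
(`exists_analyticAt_lift_of_orbit`), which yields `AlgebraSymbol.exists_analytic_section`. The
geometry enters through `IsMovingFrame.movesBy_iff`, `IsMovingFrame.isAdapted_iff` and
`IsMovingFrame.mem_modZero_iff`. -/

noncomputable section

/-! ## Analytic lifts to the orbits of a group of units -/

/-- The analytic inverse function theorem for maps with bijective derivative. -/
theorem AnalyticAt.exists_openPartialHomeomorph_of_bijective {𝕜 E F : Type*} [RCLike 𝕜]
    [NormedAddCommGroup E] [NormedSpace 𝕜 E] [FiniteDimensional 𝕜 E]
    [NormedAddCommGroup F] [NormedSpace 𝕜 F] [CompleteSpace F] {f : E → F} {a : E}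
    {f' : E →L[𝕜] F} (hf : AnalyticAt 𝕜 f a) (hf' : HasFDerivAt f f' a)
    (hbij : Function.Bijective f') :
    ∃ e : OpenPartialHomeomorph E F, (e : E → F) = f ∧ a ∈ e.source ∧
      AnalyticAt 𝕜 e.symm (f a) := by
  have : CompleteSpace E := FiniteDimensional.complete 𝕜 E
  let i : E ≃L[𝕜] F := (LinearEquiv.ofBijective f'.toLinearMap hbij).toContinuousLinearEquiv
  have hi : (i : E →L[𝕜] F) = f' := by ext; rfl
  have hs : HasStrictFDerivAt f (i : E →L[𝕜] F) a := by
    rw [hi, ← hf'.fderiv]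
    exact hf.hasStrictFDerivAt
  refine ⟨hs.toOpenPartialHomeomorph f, hs.toOpenPartialHomeomorph_coe,
    hs.mem_toOpenPartialHomeomorph_source, ?_⟩
  exact (hs.toOpenPartialHomeomorph f).analyticAt_symm' (i := i)
    hs.mem_toOpenPartialHomeomorph_source hf (hf'.fderiv.trans hi.symm)

/-- A map which is locally constant on an open set has countably many values there. -/
theorem countable_image_of_eventually_eq {X Y : Type*} [TopologicalSpace X]
    [SecondCountableTopology X] {s : Set X} {f : X → Y}
    (h : ∀ x ∈ s, ∀ᶠ y in 𝓝 x, f y = f x) : (f '' s).Countable := by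
  obtain ⟨t, hts, ht, hst⟩ := TopologicalSpace.countable_cover_nhdsWithin
    (f := fun x => {y | f y = f x}) (s := s) fun x hx => mem_nhdsWithin_of_mem_nhds (h x hx)
  refine (ht.image f).mono ?_
  rintro _ ⟨x, hx, rfl⟩
  obtain ⟨y, hy, hxy⟩ := mem_iUnion₂.1 (hst hx)
  exact ⟨y, hy, hxy.symm⟩

section Orbit

variable {𝔹 V : Type*} [NormedRing 𝔹] [NormedAlgebra ℝ 𝔹] [FiniteDimensional ℝ 𝔹]
  [NormedAddCommGroup V] [NormedSpace ℝ V] [FiniteDimensional ℝ V]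

/-- A slice for an analytic action of the units of a finite dimensional algebra: near `x₀` there are
analytic maps `m` and `σ` with `x = (1 + m x) · (x₀ + σ x)`, and `σ` is locally constant along the
orbit of `x₀`. -/
theorem exists_slice {R : 𝔹 → V → V}
    (hR : ∀ b v, IsUnit b → AnalyticAt ℝ (fun x : 𝔹 × V => R x.1 x.2) (b, v))
    (one : ∀ v, R 1 v = v) (mul : ∀ b c v, IsUnit b → IsUnit c → R (b * c) v = R b (R c v))
    (x₀ : V) :
    ∃ (O : Set V) (m : V → 𝔹) (σ : V → V), IsOpen O ∧ x₀ ∈ O ∧ AnalyticAt ℝ m x₀ ∧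
      ContinuousOn σ O ∧ σ x₀ = 0 ∧
      (∀ x ∈ O, IsUnit (1 + m x) ∧ R (1 + m x) (x₀ + σ x) = x) ∧
      ∀ b, IsUnit b → R b x₀ ∈ O → ∀ᶠ c in 𝓝 b, σ (R c x₀) = σ (R b x₀) := by
  have : CompleteSpace 𝔹 := FiniteDimensional.complete ℝ 𝔹
  have : CompleteSpace V := FiniteDimensional.complete ℝ V
  set Θ : 𝔹 → V := fun b => R b x₀ with hΘ
  have hΘa : ∀ b, IsUnit b → AnalyticAt ℝ Θ b := fun b hb =>
    (hR b x₀ hb).comp₂ (h := fun x : 𝔹 × V => R x.1 x.2) (f := fun b : 𝔹 => b)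
      (g := fun _ => x₀) analyticAt_id analyticAt_const
  set L := fderiv ℝ Θ 1 with hL
  -- `M` parametrizes the directions along the orbit and `S` the directions across it, so that the
  -- derivative of `Φ` at the origin is an isomorphism.
  obtain ⟨M, hM⟩ := Submodule.exists_isCompl (LinearMap.ker L.toLinearMap)
  obtain ⟨S, hS⟩ := Submodule.exists_isCompl (LinearMap.range L.toLinearMap)
  set Φ : M × S → V := fun y => R (1 + y.1) (x₀ + y.2) with hΦ
  have hΦa : ∀ y : M × S, IsUnit (1 + (y.1 : 𝔹)) → AnalyticAt ℝ Φ y := by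
    intro y hy
    have h1 : AnalyticAt ℝ (fun y : M × S => 1 + (y.1 : 𝔹)) y :=
      analyticAt_const.add ((M.subtypeL.comp (ContinuousLinearMap.fst ℝ M S)).analyticAt y)
    have h2 : AnalyticAt ℝ (fun y : M × S => x₀ + (y.2 : V)) y :=
      analyticAt_const.add ((S.subtypeL.comp (ContinuousLinearMap.snd ℝ M S)).analyticAt y)
    exact (hR _ (x₀ + y.2) hy).comp₂ (h := fun x : 𝔹 × V => R x.1 x.2) h1 h2
  have hΦ0 : Φ 0 = x₀ := by simp [hΦ, one]
  -- the derivative at the origin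
  have hd : ∀ y : M × S, fderiv ℝ Φ 0 y = L y.1 + y.2 := by
    intro y
    have hdΦ : HasFDerivAt Φ (fderiv ℝ Φ 0) 0 := (hΦa 0 (by simp)).differentiableAt.hasFDerivAt
    have e1 : HasFDerivAt (fun u : M => Φ (u, 0)) (L.comp M.subtypeL) 0 := by
      have a : HasFDerivAt (fun u : M => 1 + (u : 𝔹)) M.subtypeL 0 :=
        (M.subtypeL.hasFDerivAt (x := 0)).const_add 1
      have b : HasFDerivAt Θ L (1 + ((0 : M) : 𝔹)) := by
        simpa using (hΘa 1 isUnit_one).differentiableAt.hasFDerivAt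
      have := b.comp (0 : M) a
      simpa [hΦ, hΘ, Function.comp_def] using this
    have e1' : HasFDerivAt (fun u : M => Φ (u, 0))
        ((fderiv ℝ Φ 0).comp (ContinuousLinearMap.inl ℝ M S)) 0 :=
      HasFDerivAt.comp (g := Φ) (0 : M) hdΦ (ContinuousLinearMap.inl ℝ M S).hasFDerivAt
    have e2 : HasFDerivAt (fun u : S => Φ (0, u)) S.subtypeL 0 := by
      have := (S.subtypeL.hasFDerivAt (x := 0)).const_add x₀
      simpa [hΦ, one] using this
    have e2' : HasFDerivAt (fun u : S => Φ (0, u))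
        ((fderiv ℝ Φ 0).comp (ContinuousLinearMap.inr ℝ M S)) 0 :=
      HasFDerivAt.comp (g := Φ) (0 : S) hdΦ (ContinuousLinearMap.inr ℝ M S).hasFDerivAt
    have k1 := congrArg (fun f => f y.1) (e1.unique e1')
    have k2 := congrArg (fun f => f y.2) (e2.unique e2')
    simp only [ContinuousLinearMap.comp_apply, ContinuousLinearMap.inl_apply,
      ContinuousLinearMap.inr_apply, Submodule.subtypeL_apply] at k1 k2
    rw [k1, k2, ← map_add]
    simp
  have hbij : Function.Bijective (fderiv ℝ Φ 0) := by
    constructor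
    · rw [injective_iff_map_eq_zero]
      rintro ⟨u, s⟩ h
      rw [hd] at h
      simp only at h
      have hs : (s : V) ∈ LinearMap.range L.toLinearMap :=
        ⟨-(u : 𝔹), by simpa using (eq_neg_of_add_eq_zero_right h).symm⟩
      have hs0 := hS.disjoint.le_bot ⟨hs, s.2⟩
      have hs1 : (s : V) = 0 := hs0
      have hu0 := hM.disjoint.le_bot
        ⟨show (u : 𝔹) ∈ LinearMap.ker L.toLinearMap by simpa [hs1] using h, u.2⟩
      have hu1 : (u : 𝔹) = 0 := hu0
      ext <;> simp [hs1, hu1]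
    · intro v
      obtain ⟨_, ⟨b, rfl⟩, s, hs, rfl⟩ := Submodule.mem_sup.1
        (show v ∈ LinearMap.range L.toLinearMap ⊔ S by rw [hS.sup_eq_top]; trivial)
      obtain ⟨k, hk, u, hu, rfl⟩ := Submodule.mem_sup.1
        (show b ∈ LinearMap.ker L.toLinearMap ⊔ M by rw [hM.sup_eq_top]; trivial)
      refine ⟨(⟨u, hu⟩, ⟨s, hs⟩), ?_⟩
      rw [hd]
      have : L k = 0 := hk
      simp [this]
  obtain ⟨e, he, he0, hea⟩ := (hΦa 0 (by simp)).exists_openPartialHomeomorph_of_bijective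
    (hΦa 0 (by simp)).differentiableAt.hasFDerivAt hbij
  rw [hΦ0] at hea
  have hesymm0 : e.symm x₀ = 0 := by
    rw [← hΦ0, ← he]; exact e.left_inv he0
  have hx₀t : x₀ ∈ e.target := by rw [← hΦ0, ← he]; exact e.map_source he0
  have hnear : ∀ᶠ x in 𝓝 x₀, x ∈ e.target ∧ AnalyticAt ℝ e.symm x ∧
      IsUnit (1 + ((e.symm x).1 : 𝔹)) := by
    refine (e.open_target.eventually_mem hx₀t).and (hea.eventually_analyticAt.and ?_)
    have hc : ContinuousAt (fun x => 1 + ((e.symm x).1 : 𝔹)) x₀ := by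
      have := hea.continuousAt
      fun_prop
    refine hc.eventually ?_
    simp only [hesymm0, Prod.fst_zero, ZeroMemClass.coe_zero, add_zero]
    exact Units.isOpen.eventually_mem isUnit_one
  obtain ⟨O, hOsub, hO, hxO⟩ := eventually_nhds_iff.1 hnear
  have hRe : ∀ x ∈ O, R (1 + ((e.symm x).1 : 𝔹)) (x₀ + (e.symm x).2) = x := by
    intro x hx
    have := e.right_inv (hOsub x hx).1
    rwa [he] at this
  refine ⟨O, fun x => (e.symm x).1, fun x => (e.symm x).2, hO, hxO, ?_, ?_, ?_, ?_, ?_⟩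
  · exact ((M.subtypeL.comp (ContinuousLinearMap.fst ℝ M S)).analyticAt _).comp hea
  · intro x hx
    have := (hOsub x hx).2.1.continuousAt
    exact ContinuousAt.continuousWithinAt (by fun_prop)
  · simp [hesymm0]
  · exact fun x hx => ⟨(hOsub x hx).2.2, hRe x hx⟩
  -- `σ` is constant along the orbit
  set 𝒰 : Set 𝔹 := {b | IsUnit b ∧ Θ b ∈ O} with h𝒰
  have h𝒰o : IsOpen 𝒰 := by
    rw [isOpen_iff_mem_nhds]
    rintro b ⟨hb, hbO⟩
    filter_upwards [Units.isOpen.eventually_mem hb,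
      (hΘa b hb).continuousAt.eventually (hO.eventually_mem hbO)] with c h1 h2 using ⟨h1, h2⟩
  have key : ∀ b ∈ 𝒰, HasFDerivAt (fun c => (e.symm (Θ c)).2) (0 : 𝔹 →L[ℝ] S) b := by
    rintro b ⟨hb, hbO⟩
    obtain ⟨hxt, hxa, hxu⟩ := hOsub _ hbO
    have hΘb : HasFDerivAt Θ (fderiv ℝ Θ b) b := (hΘa b hb).differentiableAt.hasFDerivAt
    have hE : HasFDerivAt e.symm (fderiv ℝ e.symm (Θ b)) (Θ b) :=
      hxa.differentiableAt.hasFDerivAt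
    have hcomp := (ContinuousLinearMap.snd ℝ M S).hasFDerivAt.comp b (hE.comp b hΘb)
    suffices h0 : (ContinuousLinearMap.snd ℝ M S).comp
        ((fderiv ℝ e.symm (Θ b)).comp (fderiv ℝ Θ b)) = 0 by
      rw [h0] at hcomp
      exact hcomp
    -- rank of the derivative of the orbit map
    have hrank : Module.finrank ℝ (LinearMap.range (fderiv ℝ Θ b).toLinearMap) ≤
        Module.finrank ℝ M := by
      obtain ⟨β, rfl⟩ := hb
      have hRb : AnalyticAt ℝ (fun v => R β v) (Θ 1) :=
        (hR β (Θ 1) β.isUnit).comp₂ (h := fun x : 𝔹 × V => R x.1 x.2) (f := fun _ : V => (β : 𝔹))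
          (g := fun v => v) analyticAt_const analyticAt_id
      have h1 : HasFDerivAt (fun c : 𝔹 => (↑β⁻¹ : 𝔹) * c)
          (ContinuousLinearMap.mul ℝ 𝔹 (↑β⁻¹ : 𝔹)) (β : 𝔹) :=
        (ContinuousLinearMap.mul ℝ 𝔹 (↑β⁻¹ : 𝔹)).hasFDerivAt
      have h2 : HasFDerivAt Θ L ((↑β⁻¹ : 𝔹) * β) := by
        rw [Units.inv_mul]; exact (hΘa 1 isUnit_one).differentiableAt.hasFDerivAt
      have h3 : HasFDerivAt (fun v => R β v) (fderiv ℝ (fun v => R β v) (Θ 1))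
          (Θ ((↑β⁻¹ : 𝔹) * β)) := by
        rw [Units.inv_mul]; exact hRb.differentiableAt.hasFDerivAt
      -- Equivariance: near `β` one has `Θ c = R β (Θ (β⁻¹ * c))`, so the rank of the derivative at
      -- `β` is at most the rank at `1`, which is `finrank M`.
      have h4 := h3.comp (β : 𝔹) (h2.comp (β : 𝔹) h1)
      have h5 : HasFDerivAt Θ _ (β : 𝔹) := h4.congr_of_eventuallyEq (by
        filter_upwards [Units.isOpen.eventually_mem β.isUnit] with c hc
        have hc : IsUnit c := hc
        simp only [hΘ, Function.comp_apply]
        rw [← mul _ _ _ β.isUnit (β⁻¹.isUnit.mul hc), Units.mul_inv_cancel_left])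
      rw [h5.fderiv]
      have hfr : Module.finrank ℝ M = Module.finrank ℝ (LinearMap.range L.toLinearMap) := by
        have a := Submodule.finrank_add_eq_of_isCompl hM
        have b := L.toLinearMap.finrank_range_add_finrank_ker
        omega
      rw [hfr]
      refine (Submodule.finrank_mono (t := (LinearMap.range L.toLinearMap).map
        (fderiv ℝ (fun v => R β v) (Θ 1)).toLinearMap) ?_).trans (Submodule.finrank_map_le _ _)
      rintro _ ⟨c, rfl⟩
      exact ⟨_, ⟨_, rfl⟩, rfl⟩
    -- the directions along the slice
    set y := e.symm (Θ b) with hy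
    -- Chosen so that `Θ (ρ u) = Φ (u, y.2)` near `y.1`: the path stays in the orbit and moves only
    -- the first slice coordinate.
    set ρ : M → 𝔹 := fun u => (1 + (u : 𝔹)) * (Ring.inverse (1 + (y.1 : 𝔹)) * b) with hρ
    have hρd : HasFDerivAt ρ
        (((ContinuousLinearMap.mul ℝ 𝔹).flip (Ring.inverse (1 + (y.1 : 𝔹)) * b)).comp
          M.subtypeL) y.1 := by
      have a : HasFDerivAt (fun u : M => 1 + (u : 𝔹)) M.subtypeL y.1 :=
        (M.subtypeL.hasFDerivAt (x := y.1)).const_add 1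
      exact HasFDerivAt.comp (g := fun c : 𝔹 => c * (Ring.inverse (1 + (y.1 : 𝔹)) * b)) y.1
        ((ContinuousLinearMap.mul ℝ 𝔹).flip (Ring.inverse (1 + (y.1 : 𝔹)) * b)).hasFDerivAt a
    have hρy : ρ y.1 = b := by
      simp only [hρ]
      rw [← mul_assoc, Ring.mul_inverse_cancel _ hxu, one_mul]
    have hx' : x₀ + (y.2 : V) = R (Ring.inverse (1 + (y.1 : 𝔹)) * b) x₀ := by
      have h1 := hRe _ hbO
      have hui : IsUnit (Ring.inverse (1 + (y.1 : 𝔹))) := hxu.ringInverse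
      rw [mul _ _ _ hui hb]
      change _ = R _ (Θ b)
      rw [← h1, ← mul _ _ _ hui hxu, Ring.inverse_mul_cancel _ hxu, one]
    have hev : ∀ᶠ u in 𝓝 y.1, Θ (ρ u) = Φ (u, y.2) ∧ (u, y.2) ∈ e.source := by
      have hc : ContinuousAt (fun u : M => 1 + (u : 𝔹)) y.1 := by fun_prop
      have hys : y ∈ e.source := e.map_target hxt
      have hc2 : ContinuousAt (fun u : M => (u, y.2)) y.1 := by fun_prop
      filter_upwards [hc.eventually (Units.isOpen.eventually_mem hxu),
        hc2.eventually (e.open_source.eventually_mem hys)] with u hu hu2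
      refine ⟨?_, hu2⟩
      simp only [hΘ, hρ, hΦ]
      rw [mul _ _ _ hu (hxu.ringInverse.mul hb), ← hx']
    set D := (fderiv ℝ Θ b).comp (((ContinuousLinearMap.mul ℝ 𝔹).flip
      (Ring.inverse (1 + (y.1 : 𝔹)) * b)).comp M.subtypeL) with hD
    have hΘρ : HasFDerivAt (fun u => Θ (ρ u)) D y.1 :=
      HasFDerivAt.comp (g := Θ) y.1 (by rw [hρy]; exact hΘb) hρd
    have hleft : HasFDerivAt (fun u : M => e.symm (Θ (ρ u)))
        ((fderiv ℝ e.symm (Θ b)).comp D) y.1 :=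
      HasFDerivAt.comp (g := e.symm) y.1 (by rw [hρy]; exact hE) hΘρ
    have hleft' : HasFDerivAt (fun u : M => e.symm (Θ (ρ u)))
        (ContinuousLinearMap.inl ℝ M S) y.1 := by
      have : HasFDerivAt (fun u : M => (u, y.2)) (ContinuousLinearMap.inl ℝ M S) y.1 :=
        hasFDerivAt_prodMk_left y.1 y.2
      refine this.congr_of_eventuallyEq ?_
      filter_upwards [hev] with u hu
      rw [hu.1, ← he, e.left_inv hu.2]
    have hinl := hleft.unique hleft'
    have hinj : Function.Injective D := by
      intro u v huv
      have := congrArg (fun f => f (u - v)) hinl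
      simp only [ContinuousLinearMap.comp_apply, ContinuousLinearMap.inl_apply] at this
      rw [map_sub, huv, sub_self, map_zero] at this
      exact sub_eq_zero.1 (congrArg Prod.fst this).symm
    have hle : LinearMap.range D.toLinearMap ≤ LinearMap.range (fderiv ℝ Θ b).toLinearMap := by
      rintro _ ⟨u, rfl⟩
      exact ⟨_, rfl⟩
    -- The image of `D` already has the maximal possible dimension `finrank M`, so every direction
    -- tangent to the orbit leaves the second slice coordinate fixed to first order.
    have heq := Submodule.eq_of_le_of_finrank_le hle
      (hrank.trans_eq (LinearMap.finrank_range_of_inj hinj).symm)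
    ext c
    obtain ⟨u, hu⟩ : fderiv ℝ Θ b c ∈ LinearMap.range D.toLinearMap := by
      rw [heq]; exact ⟨c, rfl⟩
    have hu' : D u = fderiv ℝ Θ b c := hu
    have := congrArg (fun f => f u) hinl
    simp only [ContinuousLinearMap.comp_apply, ContinuousLinearMap.inl_apply] at this
    simp only [ContinuousLinearMap.comp_apply, ContinuousLinearMap.coe_snd', ← hu', this,
      zero_apply]
  intro b hb hbO
  have hopen := h𝒰o.isOpen_inter_preimage_of_fderiv_eq_zero (𝕜 := ℝ)
    (f := fun c => (e.symm (Θ c)).2) (fun c hc => (key c hc).differentiableAt.differentiableWithinAt)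
    (fun c hc => (key c hc).fderiv) {(e.symm (Θ b)).2}
  filter_upwards [hopen.eventually_mem ⟨⟨hb, hbO⟩, rfl⟩] with c hc
  exact congrArg Subtype.val hc.2

/-- An analytic map into a single orbit of an analytic action of the units of a finite dimensional
algebra lifts analytically to the units. -/
theorem exists_analyticAt_lift_of_orbit {E : Type*} [NormedAddCommGroup E] [NormedSpace ℝ E]
    {R : 𝔹 → V → V}
    (hR : ∀ b v, IsUnit b → AnalyticAt ℝ (fun x : 𝔹 × V => R x.1 x.2) (b, v))
    (one : ∀ v, R 1 v = v) (mul : ∀ b c v, IsUnit b → IsUnit c → R (b * c) v = R b (R c v))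
    (x₀ : V) {f : E → V} {a : E} (hf : AnalyticAt ℝ f a)
    (horb : ∀ᶠ q in 𝓝 a, ∃ b, IsUnit b ∧ R b x₀ = f q) :
    ∃ s : E → 𝔹, AnalyticAt ℝ s a ∧ ∀ᶠ q in 𝓝 a, IsUnit (s q) ∧ R (s q) x₀ = f q := by
  have : CompleteSpace 𝔹 := FiniteDimensional.complete ℝ 𝔹
  have : CompleteSpace V := FiniteDimensional.complete ℝ V
  obtain ⟨O, m, σ, hO, hxO, hma, hσ, hσ0, hRm, hloc⟩ := exists_slice hR one mul x₀
  obtain ⟨b₀, ⟨β, rfl⟩, hb₀⟩ := horb.self_of_nhds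
  have hinvf : R (↑β⁻¹ : 𝔹) (f a) = x₀ := by
    rw [← hb₀, ← mul _ _ _ β⁻¹.isUnit β.isUnit, Units.inv_mul, one]
  -- Translation by `β⁻¹` moves the value at `a` to `x₀`, the centre of the slice.
  set f' : E → V := fun q => R (↑β⁻¹ : 𝔹) (f q) with hf'
  have hf'a : AnalyticAt ℝ f' a :=
    (hR _ _ β⁻¹.isUnit).comp₂ (h := fun x : 𝔹 × V => R x.1 x.2)
      (f := fun _ : E => (↑β⁻¹ : 𝔹)) analyticAt_const hf
  have hcount : (σ '' (O ∩ (fun b => R b x₀) '' {b | IsUnit b})).Countable := by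
    have : SecondCountableTopology 𝔹 := by
      have : ProperSpace 𝔹 := FiniteDimensional.proper ℝ 𝔹
      infer_instance
    refine (countable_image_of_eventually_eq (s := {b | IsUnit b ∧ R b x₀ ∈ O})
      (f := fun b => σ (R b x₀)) fun b hb => hloc b hb.1 hb.2).mono ?_
    rintro _ ⟨_, ⟨hO, b, hb, rfl⟩, rfl⟩
    exact ⟨b, ⟨hb, hO⟩, rfl⟩
  have hev : ∀ᶠ q in 𝓝 a, (f' q ∈ O ∧ ∃ b, IsUnit b ∧ R b x₀ = f' q) ∧ ContinuousAt f' q := by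
    refine ((hf'a.continuousAt.eventually (hO.eventually_mem (by simpa [hf', hinvf] using hxO))).and
      ?_).and (hf'a.eventually_analyticAt.mono fun q h => h.continuousAt)
    filter_upwards [horb] with q ⟨b, hb, hq⟩
    exact ⟨_, β⁻¹.isUnit.mul hb, by rw [mul _ _ _ β⁻¹.isUnit hb, hq]⟩
  obtain ⟨ε, hε, hball⟩ := Metric.eventually_nhds_iff_ball.1 hev
  -- The orbit may return to the slice neighbourhood on other sheets, even accumulating at `x₀`, so
  -- local constancy along the orbit is not enough. But `σ` has only countably many values on the
  -- orbit, and the connected image of the ball under `σ ∘ f'` must be a single point.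
  have hσf : ∀ q ∈ Metric.ball a ε, σ (f' q) = 0 := by
    intro q hq
    have hcont : ContinuousOn (fun q => σ (f' q)) (Metric.ball a ε) :=
      hσ.comp (fun q hq => (hball q hq).2.continuousWithinAt) fun q hq => (hball q hq).1.1
    have hpre := (convex_ball a ε).isPreconnected.image _ hcont
    have hsub := hcount.isTotallyDisconnected _ (by
      rintro _ ⟨q, hq, rfl⟩
      obtain ⟨⟨h1, b, hb, h2⟩, -⟩ := hball q hq
      exact ⟨_, ⟨h1, b, hb, h2⟩, rfl⟩) hpre
    have ha0 : σ (f' a) = 0 := by simp only [hf', hinvf, hσ0]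
    rw [← ha0]
    exact hsub ⟨q, hq, rfl⟩ ⟨a, Metric.mem_ball_self hε, rfl⟩
  refine ⟨fun q => β * (1 + m (f' q)), ?_, ?_⟩
  · have hma' : AnalyticAt ℝ m (f' a) := by simpa only [hf', hinvf] using hma
    exact analyticAt_const.mul (analyticAt_const.add (hma'.comp hf'a))
  · filter_upwards [Metric.ball_mem_nhds a hε] with q hq
    obtain ⟨hu, hRq⟩ := hRm _ (hball q hq).1.1
    refine ⟨β.isUnit.mul hu, ?_⟩
    rw [hσf q hq, add_zero] at hRq
    rw [mul _ _ _ β.isUnit hu, hRq]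
    obtain ⟨b, hb, hq'⟩ := horb.self_of_nhds
    simp only [hf']
    rw [← mul _ _ _ β.isUnit β⁻¹.isUnit, Units.mul_inv, one]

end Orbit

end

noncomputable section

/-! ## Symbols in a finite dimensional algebra and their adapted frames -/

/-- A velocity of a curve in a closed subspace lies in the subspace. -/
theorem Submodule.hasDerivAt_mem {V : Type*} [NormedAddCommGroup V] [NormedSpace ℝ V]
    [FiniteDimensional ℝ V] (U : Submodule ℝ V) {f : ℝ → V} {f' : V} {x : ℝ}
    (hf : HasDerivAt f f' x) (hU : ∀ᶠ t in 𝓝 x, f t ∈ U) : f' ∈ U := by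
  have hx := hU.self_of_nhds
  refine U.closed_of_finiteDimensional.mem_of_tendsto (hasDerivAt_iff_tendsto_slope.1 hf) ?_
  filter_upwards [nhdsWithin_le_nhds hU] with t ht
  exact U.smul_mem _ (U.sub_mem ht hx)

/-- The algebraic data of a CR symbol inside the algebra `𝔸` of endomorphisms of `𝔤_{-1}`: the
projections `p`, `p'` to `𝔤_{-1,1}` and `𝔤_{-1,-1}`, the adjunction `ι` of the symplectic form, and the
spaces `up`, `down`. -/
structure AlgebraSymbol (𝔸 : Type*) [NormedRing 𝔸] [NormedAlgebra ℂ 𝔸] where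
  p : 𝔸
  p' : 𝔸
  add_eq_one : p + p' = 1
  mul_eq_zero : p * p' = 0
  mul_eq_zero' : p' * p = 0
  ι : 𝔸 →ₗ[ℂ] 𝔸
  ι_mul : ∀ a b, ι (a * b) = ι b * ι a
  ι_one : ι 1 = 1
  ι_p : ι p = p'
  ι_p' : ι p' = p
  up : Submodule ℂ 𝔸
  down : Submodule ℂ 𝔸
  up_mem : ∀ a ∈ up, p * a * p' = a
  down_mem : ∀ a ∈ down, p' * a * p = a
  ι_up : ∀ a ∈ up, ι a = -a
  ι_down : ∀ a ∈ down, ι a = -a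

namespace AlgebraSymbol

variable {𝔸 : Type*} [NormedRing 𝔸] [NormedAlgebra ℂ 𝔸] (s : AlgebraSymbol 𝔸)

/-- The symbol with the roles of `up` and `down` exchanged. -/
@[simps]
def swap : AlgebraSymbol 𝔸 where
  p := s.p'
  p' := s.p
  add_eq_one := by rw [add_comm, s.add_eq_one]
  mul_eq_zero := s.mul_eq_zero'
  mul_eq_zero' := s.mul_eq_zero
  ι := s.ι
  ι_mul := s.ι_mul
  ι_one := s.ι_one
  ι_p := s.ι_p'
  ι_p' := s.ι_p
  up := s.down
  down := s.up
  up_mem := s.down_mem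
  down_mem := s.up_mem
  ι_up := s.ι_down
  ι_down := s.ι_up

lemma p_mul_p : s.p * s.p = s.p := by
  have h := congrArg (s.p * ·) s.add_eq_one
  simpa [mul_add, s.mul_eq_zero] using h

lemma p'_mul_p' : s.p' * s.p' = s.p' := s.swap.p_mul_p

lemma commute_p' {a : 𝔸} (h : a * s.p = s.p * a) : a * s.p' = s.p' * a := by
  have e : s.p' = 1 - s.p := by rw [← s.add_eq_one]; abel
  rw [e, mul_sub, sub_mul, h, mul_one, one_mul]

/-- Infinitesimal conformal symplectic elements commuting with `p` which normalize `up` and `down`. -/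
def IsZero (a : 𝔸) : Prop :=
  (∃ c : ℂ, a + s.ι a = c • 1) ∧ a * s.p = s.p * a ∧
    (∀ b ∈ s.up, a * b - b * a ∈ s.up) ∧ ∀ b ∈ s.down, a * b - b * a ∈ s.down

/-- The group of conformal symplectic units commuting with `p` and preserving `up` and `down`. -/
def IsStab (k : 𝔸ˣ) : Prop :=
  (∃ c : ℂ, c ≠ 0 ∧ s.ι k * k = c • 1) ∧ (k : 𝔸) * s.p = s.p * k ∧
    (∀ b : 𝔸, b ∈ s.up ↔ k * b * ↑k⁻¹ ∈ s.up) ∧ ∀ b : 𝔸, b ∈ s.down ↔ k * b * ↑k⁻¹ ∈ s.down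

variable {E : Type*} [NormedAddCommGroup E] [NormedSpace ℝ E]

/-- The logarithmic derivative `F⁻¹ dF`. -/
def logDeriv (F : E → 𝔸) (q v : E) : 𝔸 := Ring.inverse (F q) * fderiv ℝ F q v

/-- `T = F(q) h` is a frame adapted at `q` to the moving splitting `F(q) p F(q)⁻¹`. -/
def IsAdapted (F : E → 𝔸) (q : E) (T : 𝔸) : Prop :=
  (∃ c : ℂ, c ≠ 0 ∧ s.ι T * T = c • 1) ∧ ∃ h : 𝔸ˣ, T = F q * h ∧ (h : 𝔸) * s.p = s.p * h ∧
    (∀ a : 𝔸, a ∈ s.up ↔ ∃ v, (h : 𝔸) * a * ↑h⁻¹ = s.p * logDeriv F q v * s.p') ∧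
    ∀ a : 𝔸, a ∈ s.down ↔ ∃ v, (h : 𝔸) * a * ↑h⁻¹ = s.p' * logDeriv F q v * s.p

/-- The velocities `T⁻¹ T'` of the curves of adapted frames through `T`. -/
def velocities (F : E → 𝔸) (q : E) (T : 𝔸) : Set 𝔸 :=
  {A | ∃ (c : ℝ → E) (τ : ℝ → 𝔸), c 0 = q ∧ τ 0 = T ∧ ContDiffAt ℝ ∞ c 0 ∧ ContDiffAt ℝ ∞ τ 0 ∧
    (∀ᶠ t in 𝓝 0, s.IsAdapted F (c t) (τ t)) ∧ deriv τ 0 = T * A}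

variable {s} {F : E → 𝔸} {q : E}

lemma IsAdapted.swap {T : 𝔸} (h : s.IsAdapted F q T) : s.swap.IsAdapted F q T := by
  obtain ⟨h1, k, h2, h3, h4, h5⟩ := h
  exact ⟨h1, k, h2, s.commute_p' h3, h5, h4⟩

lemma velocities_swap (T : 𝔸) : s.swap.velocities F q T = s.velocities F q T := by
  ext A
  constructor <;> rintro ⟨c, τ, h1, h2, h3, h4, h5, h6⟩ <;>
    exact ⟨c, τ, h1, h2, h3, h4, h5.mono fun t ht => ht.swap, h6⟩

lemma IsAdapted.mul_stab {T : 𝔸} (hT : s.IsAdapted F q T) {k : 𝔸ˣ} (hk : s.IsStab k) :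
    s.IsAdapted F q (T * k) := by
  obtain ⟨⟨c, hc, h1⟩, h, h2, h3, h4, h5⟩ := hT
  obtain ⟨⟨d, hd, k1⟩, k2, k3, k4⟩ := hk
  refine ⟨⟨c * d, mul_ne_zero hc hd, ?_⟩, h * k, ?_, ?_, fun a => ?_, fun a => ?_⟩
  · rw [s.ι_mul, mul_assoc, ← mul_assoc _ T, h1, smul_mul_assoc, one_mul, mul_smul_comm, k1,
      smul_smul]
  · rw [h2, Units.val_mul, mul_assoc]
  · rw [Units.val_mul, mul_assoc, k2, ← mul_assoc, h3, mul_assoc]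
  · rw [k3, h4]
    simp only [mul_inv_rev, Units.val_mul, mul_assoc]
  · rw [k4, h5]
    simp only [mul_inv_rev, Units.val_mul, mul_assoc]

/-- Writing the frames as `F q * h` and `F q * k`, both `h` and `k` conjugate `up` and `down` to the
same spaces of velocities, so `h⁻¹ * k` normalizes them. Together with `IsAdapted.mul_stab` this
makes the frames at one point a torsor. -/
lemma IsAdapted.exists_stab {T T' : 𝔸} (hT : s.IsAdapted F q T) (hT' : s.IsAdapted F q T') :
    ∃ k : 𝔸ˣ, s.IsStab k ∧ T' = T * k := by
  obtain ⟨⟨c, hc, h1⟩, h, h2, h3, h4, h5⟩ := hT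
  obtain ⟨⟨d, hd, k1⟩, k, k2, k3, k4, k5⟩ := hT'
  have hTT : T' = T * ↑(h⁻¹ * k) := by
    rw [h2, k2, Units.val_mul, mul_assoc, Units.mul_inv_cancel_left]
  have hinv : (↑h⁻¹ : 𝔸) * s.p = s.p * ↑h⁻¹ := by
    rw [Units.inv_mul_eq_iff_eq_mul, ← mul_assoc, h3, mul_assoc, Units.mul_inv, mul_one]
  have hconj : ∀ b : 𝔸, (h : 𝔸) * (((h⁻¹ * k : 𝔸ˣ) : 𝔸) * b * ↑(h⁻¹ * k)⁻¹) * ↑h⁻¹ =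
      k * b * ↑k⁻¹ := by
    intro b
    simp only [Units.val_mul, mul_inv_rev, inv_inv, mul_assoc, Units.mul_inv, mul_one,
      Units.mul_inv_cancel_left]
  refine ⟨h⁻¹ * k, ⟨⟨c⁻¹ * d, mul_ne_zero (inv_ne_zero hc) hd, ?_⟩, ?_, fun b => ?_, fun b => ?_⟩,
    hTT⟩
  · rw [hTT, s.ι_mul, mul_assoc, ← mul_assoc _ T, h1, smul_mul_assoc, one_mul, mul_smul_comm] at k1
    rw [mul_smul, ← k1, smul_smul, inv_mul_cancel₀ hc, one_smul]
  · rw [Units.val_mul, mul_assoc, k3, ← mul_assoc, hinv, mul_assoc]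
  · rw [h4 (((h⁻¹ * k : 𝔸ˣ) : 𝔸) * b * ↑(h⁻¹ * k)⁻¹), hconj, k4]
  · rw [h5 (((h⁻¹ * k : 𝔸ˣ) : 𝔸) * b * ↑(h⁻¹ * k)⁻¹), hconj, k5]

/-- A curve of frames stays one after right translation by a constant stabilizer element. A set of
velocities common to all frames is therefore invariant under conjugation. -/
lemma conj_velocity {T : 𝔸} {k : 𝔸ˣ} (hk : s.IsStab k) {A : 𝔸}
    (hA : A ∈ s.velocities F q T) : ↑k⁻¹ * A * k ∈ s.velocities F q (T * k) := by
  obtain ⟨c, τ, h1, h2, h3, h4, h5, h6⟩ := hA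
  refine ⟨c, fun t => τ t * k, h1, by simp [h2], h3, h4.mul contDiffAt_const,
    h5.mono fun t ht => ht.mul_stab hk, ?_⟩
  rw [deriv_mul_const (h4.differentiableAt (by simp)), h6]
  simp only [mul_assoc, Units.mul_inv_cancel_left]

variable [FiniteDimensional ℂ 𝔸]

variable (s) in
/-- The adjunction as a continuous real linear map. -/
def ιL : 𝔸 →L[ℝ] 𝔸 := LinearMap.toContinuousLinearMap (s.ι.restrictScalars ℝ)

@[simp] lemma ιL_apply (a : 𝔸) : s.ιL a = s.ι a := rfl

/-- The derivative at the unit of a curve in the stabilizer. -/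
lemma isZero_of_hasDerivAt {k : ℝ → 𝔸} {a : 𝔸} (hk : HasDerivAt k a 0) (hk0 : k 0 = 1)
    (hs : ∀ᶠ t in 𝓝 0, ∃ u : 𝔸ˣ, (u : 𝔸) = k t ∧ s.IsStab u) : s.IsZero a := by
  have : CompleteSpace 𝔸 := FiniteDimensional.complete ℂ 𝔸
  have hinv : HasDerivAt (fun t => Ring.inverse (k t)) (-a) 0 := by
    have h : HasFDerivAt Ring.inverse (-ContinuousLinearMap.mulLeftRight ℝ 𝔸 1 1) (k 0) := by
      rw [hk0]
      simpa using hasFDerivAt_ringInverse (𝕜 := ℝ) (1 : 𝔸ˣ)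
    have := h.comp_hasDerivAt (0 : ℝ) hk
    simpa using! this
  have hconj : ∀ b : 𝔸, HasDerivAt (fun t => k t * b * Ring.inverse (k t)) (a * b - b * a) 0 := by
    intro b
    have := (hk.mul_const b).mul hinv
    simpa [hk0, sub_eq_add_neg] using! this
  refine ⟨?_, ?_, fun b hb => ?_, fun b hb => ?_⟩
  · have h : HasDerivAt (fun t => s.ι (k t) * k t) (a + s.ι a) 0 := by
      have := (s.ιL.hasFDerivAt.comp_hasDerivAt (0 : ℝ) hk).mul hk
      simpa [hk0, s.ι_one, add_comm] using! this
    have hm := ((ℂ ∙ (1 : 𝔸)).restrictScalars ℝ).hasDerivAt_mem h (by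
      filter_upwards [hs] with t ⟨u, hu, ⟨c, _, hc⟩, _⟩
      rw [← hu, hc]
      exact Submodule.smul_mem _ _ (Submodule.mem_span_singleton_self _))
    obtain ⟨c, hc⟩ := Submodule.mem_span_singleton.1 (show a + s.ι a ∈ ℂ ∙ (1 : 𝔸) from hm)
    exact ⟨c, hc.symm⟩
  · have h1 := hk.mul_const s.p
    have h2 := (hk.const_mul s.p).congr_of_eventuallyEq (f₁ := fun t => k t * s.p) (by
      filter_upwards [hs] with t ⟨u, hu, _, h, _⟩
      rw [← hu, h])
    exact h1.unique h2
  · refine (s.up.restrictScalars ℝ).hasDerivAt_mem (hconj b) ?_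
    filter_upwards [hs] with t ⟨u, hu, _, _, h, _⟩
    rw [← hu, Ring.inverse_unit]
    exact (h b).1 hb
  · refine (s.down.restrictScalars ℝ).hasDerivAt_mem (hconj b) ?_
    filter_upwards [hs] with t ⟨u, hu, _, _, _, h⟩
    rw [← hu, Ring.inverse_unit]
    exact (h b).1 hb

/-- A subspace invariant under the commutator with `a` is invariant under conjugation by `exp a`. -/
lemma exp_conj_mem {U : Submodule ℂ 𝔸} {a : 𝔸} (ha : ∀ b ∈ U, a * b - b * a ∈ U) {b : 𝔸}
    (hb : b ∈ U) : NormedSpace.exp a * b * NormedSpace.exp (-a) ∈ U := by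
  have : CompleteSpace 𝔸 := FiniteDimensional.complete ℂ 𝔸
  let Lm : 𝔸 →L[ℂ] (𝔸 →L[ℂ] 𝔸) := ContinuousLinearMap.mul ℂ 𝔸
  let Rm : 𝔸 →L[ℂ] (𝔸 →L[ℂ] 𝔸) := (ContinuousLinearMap.mul ℂ 𝔸).flip
  have hLp : ∀ n : ℕ, Lm a ^ n = Lm (a ^ n) := by
    intro n
    induction n with
    | zero => ext x; simp [Lm]
    | succ n ih => rw [pow_succ, ih]; ext x; simp [Lm, pow_succ, mul_assoc]
  have hRp : ∀ (c : 𝔸) (n : ℕ), Rm c ^ n = Rm (c ^ n) := by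
    intro c n
    induction n with
    | zero => ext x; simp [Rm]
    | succ n ih => rw [pow_succ', ih]; ext x; simp [Rm, pow_succ, mul_assoc]
  have hL : NormedSpace.exp (Lm a) = Lm (NormedSpace.exp a) := by
    have h1 := NormedSpace.exp_series_hasSum_exp' (𝕂 := ℂ) (Lm a)
    have h2 := (NormedSpace.exp_series_hasSum_exp' (𝕂 := ℂ) a).mapL Lm
    refine h1.unique ?_
    simpa [hLp] using h2
  have hR : NormedSpace.exp (Rm (-a)) = Rm (NormedSpace.exp (-a)) := by
    have h1 := NormedSpace.exp_series_hasSum_exp' (𝕂 := ℂ) (Rm (-a))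
    have h2 := (NormedSpace.exp_series_hasSum_exp' (𝕂 := ℂ) (-a)).mapL Rm
    refine h1.unique ?_
    simpa only [hRp, map_smul] using h2
  have hcomm : Commute (Lm a) (Rm (-a)) := by
    ext x; simp [Lm, Rm, mul_assoc]
  -- `Lm a + Rm (-a)` is the commutator with `a`. Left and right multiplications commute, so its
  -- exponential is conjugation by `exp a`, and the partial sums of the series applied to `b` stay
  -- in the closed subspace `U`.
  have hexp : NormedSpace.exp (Lm a + Rm (-a)) b = NormedSpace.exp a * b * NormedSpace.exp (-a) := by
    let _ : NormedAlgebra ℚ (𝔸 →L[ℂ] 𝔸) := NormedAlgebra.restrictScalars ℚ ℂ _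
    rw [NormedSpace.exp_add_of_commute hcomm, hL, hR]
    simp [Lm, Rm, mul_assoc]
  rw [← hexp]
  have hs := NormedSpace.exp_series_hasSum_exp' (𝕂 := ℂ) (Lm a + Rm (-a))
  have hs' := hs.mapL (ContinuousLinearMap.apply ℂ 𝔸 b)
  refine U.closed_of_finiteDimensional.mem_of_tendsto hs' (Eventually.of_forall fun t => ?_)
  refine U.sum_mem fun n hn => ?_
  clear hn
  simp only [map_smul, ContinuousLinearMap.apply_apply]
  refine U.smul_mem _ ?_
  induction n with
  | zero => simpa using hb
  | succ n ih =>
    rw [pow_succ']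
    have := ha _ ih
    simpa [Lm, Rm, sub_eq_add_neg] using this

/-- The exponential of a real multiple as a unit. -/
def expUnit (a : 𝔸) : 𝔸ˣ :=
  letI : CompleteSpace 𝔸 := FiniteDimensional.complete ℂ 𝔸
  letI : NormedAlgebra ℚ 𝔸 := NormedAlgebra.restrictScalars ℚ ℂ 𝔸
  ⟨NormedSpace.exp a, NormedSpace.exp (-a),
    by rw [← NormedSpace.exp_add_of_commute (Commute.neg_right (Commute.refl a)), add_neg_cancel,
      NormedSpace.exp_zero],
    by rw [← NormedSpace.exp_add_of_commute (Commute.neg_left (Commute.refl a)), neg_add_cancel,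
      NormedSpace.exp_zero]⟩

/-- From `a + ι a = c` the adjoint `ι a = c - a` commutes with `a`, so `ι (exp a) * exp a = exp c`
is a nonzero scalar. The equivalences for `up` and `down` use the inverse `exp (-a)` for the
converse. -/
lemma isStab_expUnit {a : 𝔸} (ha : s.IsZero a) : s.IsStab (expUnit a) := by
  have : CompleteSpace 𝔸 := FiniteDimensional.complete ℂ 𝔸
  let _ : NormedAlgebra ℚ 𝔸 := NormedAlgebra.restrictScalars ℚ ℂ 𝔸
  obtain ⟨⟨c, hc⟩, h1, h2, h3⟩ := ha
  have hneg : ∀ {U : Submodule ℂ 𝔸}, (∀ b ∈ U, a * b - b * a ∈ U) →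
      ∀ b ∈ U, (-a) * b - b * (-a) ∈ U := by
    intro U h b hb
    convert! U.neg_mem (h b hb) using 1
    noncomm_ring
  have conj : ∀ {U : Submodule ℂ 𝔸}, (∀ b ∈ U, a * b - b * a ∈ U) → ∀ b : 𝔸, b ∈ U ↔
      (expUnit a : 𝔸) * b * ↑(expUnit a)⁻¹ ∈ U := by
    intro U h b
    refine ⟨fun hb => exp_conj_mem h hb, fun hb => ?_⟩
    have := exp_conj_mem (hneg h) hb
    rw [neg_neg] at this
    convert! this using 1
    change b = (↑(expUnit a)⁻¹ : 𝔸) * _ * (expUnit a : 𝔸)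
    simp [mul_assoc]
  refine ⟨⟨NormedSpace.exp c, by
    rw [← Complex.exp_eq_exp_ℂ]; exact Complex.exp_ne_zero c, ?_⟩, ?_, conj h2, conj h3⟩
  · have hι : s.ι (NormedSpace.exp a) = NormedSpace.exp (s.ι a) := by
      have e1 := (NormedSpace.exp_series_hasSum_exp' (𝕂 := ℂ) a).mapL
        (LinearMap.toContinuousLinearMap s.ι)
      refine e1.unique ?_
      have e2 := NormedSpace.exp_series_hasSum_exp' (𝕂 := ℂ) (s.ι a)
      convert! e2 using 2 with n
      simp only [map_smul, LinearMap.coe_toContinuousLinearMap']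
      congr 1
      induction n with
      | zero => simp [s.ι_one]
      | succ n ih => rw [pow_succ, s.ι_mul, ih, pow_succ']
    have hιa : s.ι a = algebraMap ℂ 𝔸 c - a := by
      rw [Algebra.algebraMap_eq_smul_one, ← hc]; abel
    have hcomm : Commute (s.ι a) a := by
      rw [hιa]
      have h0 : Commute (algebraMap ℂ 𝔸 c) a := Algebra.commutes c a
      exact h0.sub_left (Commute.refl a)
    change s.ι (NormedSpace.exp a) * NormedSpace.exp a = _
    rw [hι, ← NormedSpace.exp_add_of_commute hcomm, hιa, sub_add_cancel,
      ← NormedSpace.algebraMap_exp_comm c, Algebra.algebraMap_eq_smul_one]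
  · have : Commute a s.p := h1
    exact this.exp_left

end AlgebraSymbol

end

/-! ### Velocities of adapted frames and analytic local sections. -/

noncomputable section

namespace AlgebraSymbol

variable {𝔸 : Type*} [NormedRing 𝔸] [NormedAlgebra ℂ 𝔸] {s : AlgebraSymbol 𝔸}
  {E : Type*} [NormedAddCommGroup E] [NormedSpace ℝ E] {F : E → 𝔸} {q : E}

/-- Conjugation by a unit. -/
@[simps]
def conj (h : 𝔸ˣ) : 𝔸 ≃ₗ[ℂ] 𝔸 where
  toFun x := h * x * ↑h⁻¹
  invFun x := ↑h⁻¹ * x * h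
  map_add' x y := by rw [mul_add, add_mul]
  map_smul' c x := by simp
  left_inv x := by simp [mul_assoc]
  right_inv x := by simp [mul_assoc]

section Family

variable {r : ℕ}

/-- The action of `h` and of a matrix on families of elements. -/
def familyAct (h : 𝔸) (a : Matrix (Fin r) (Fin r) ℂ) (u : Fin r → 𝔸) : Fin r → 𝔸 :=
  fun i => ∑ j, a i j • (h * u j * Ring.inverse h)

lemma familyAct_one (u : Fin r → 𝔸) : familyAct 1 1 u = u := by
  ext i
  simp [familyAct, Matrix.one_apply]

lemma familyAct_mul {h k : 𝔸} (hh : IsUnit h) (hk : IsUnit k) (a b : Matrix (Fin r) (Fin r) ℂ)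
    (u : Fin r → 𝔸) : familyAct (h * k) (a * b) u = familyAct h a (familyAct k b u) := by
  obtain ⟨h, rfl⟩ := hh
  obtain ⟨k, rfl⟩ := hk
  ext i
  simp only [familyAct, Matrix.mul_apply, Finset.sum_smul, Finset.smul_sum, Finset.mul_sum,
    Finset.sum_mul, ← Units.val_mul, Ring.inverse_unit, mul_inv_rev]
  rw [Finset.sum_comm]
  refine Finset.sum_congr rfl fun j _ => Finset.sum_congr rfl fun l _ => ?_
  simp only [mul_smul, Units.val_mul, mul_assoc, mul_smul_comm, smul_mul_assoc]

/-- A linearly independent family in the conjugate of a space of its size is obtained from a basis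
by the action of an invertible matrix. -/
lemma exists_familyAct_eq {U : Submodule ℂ 𝔸} (b : Module.Basis (Fin r) ℂ U) (h : 𝔸ˣ)
    {u : Fin r → 𝔸} (hu : LinearIndependent ℂ u)
    (hU : ∀ i, u i ∈ U.map (conj h).toLinearMap) :
    ∃ a : Matrix (Fin r) (Fin r) ℂ, IsUnit a ∧ familyAct (h : 𝔸) a (fun i => (b i : 𝔸)) = u := by
  simp only [Submodule.mem_map_equiv] at hU
  refine ⟨Matrix.of fun i j => b.repr ⟨_, hU i⟩ j, ?_, ?_⟩
  · rw [← Matrix.linearIndependent_rows_iff_isUnit]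
    have h1 : LinearIndependent ℂ fun i => (conj h).symm (u i) :=
      hu.map' (conj h).symm.toLinearMap (conj h).symm.ker
    have h2 : LinearIndependent ℂ fun i => (⟨_, hU i⟩ : U) :=
      LinearIndependent.of_comp U.subtype h1
    exact h2.map' b.equivFun.toLinearMap b.equivFun.ker
  · ext i
    have := congrArg (fun x : U => conj h (x : 𝔸)) (b.sum_repr ⟨_, hU i⟩)
    simp only [LinearEquiv.apply_symm_apply, Submodule.coe_sum, Submodule.coe_smul, map_sum,
      map_smul] at this
    rw [← this]
    simp [familyAct]

lemma mem_map_conj_of_familyAct {U : Submodule ℂ 𝔸} {b : Fin r → 𝔸} (hb : ∀ i, b i ∈ U) (h : 𝔸ˣ)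
    (a : Matrix (Fin r) (Fin r) ℂ) (i : Fin r) :
    familyAct (h : 𝔸) a b i ∈ U.map (conj h).toLinearMap := by
  refine Submodule.sum_mem _ fun j _ => Submodule.smul_mem _ _ ⟨b j, hb j, ?_⟩
  simp

end Family

variable [FiniteDimensional ℂ 𝔸]

lemma eventually_isUnit_comp {X : Type*} [TopologicalSpace X] {f : X → 𝔸} {x : X}
    (hf : ContinuousAt f x) (hx : IsUnit (f x)) : ∀ᶠ y in 𝓝 x, IsUnit (f y) := by
  have : CompleteSpace 𝔸 := FiniteDimensional.complete ℂ 𝔸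
  exact hf.eventually (Units.isOpen.eventually_mem hx)

lemma hasDerivAt_inverse {f : ℝ → 𝔸} {f' : 𝔸} {t : ℝ} (hf : HasDerivAt f f' t)
    (hu : IsUnit (f t)) :
    HasDerivAt (fun t => Ring.inverse (f t)) (-(Ring.inverse (f t) * f' * Ring.inverse (f t))) t := by
  have : CompleteSpace 𝔸 := FiniteDimensional.complete ℂ 𝔸
  obtain ⟨u, hu⟩ := hu
  have h : HasFDerivAt Ring.inverse (-ContinuousLinearMap.mulLeftRight ℝ 𝔸 ↑u⁻¹ ↑u⁻¹) (f t) := by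
    rw [← hu]
    exact hasFDerivAt_ringInverse (𝕜 := ℝ) u
  have := h.comp_hasDerivAt t hf
  simpa [← hu] using! this

/-- The off-diagonal part of a frame velocity is the velocity of the splitting. The curve `F(c t)⁻¹
* τ t` commutes with `p`, hence so does its derivative `h * A - logDeriv F q (deriv c 0) * h`;
multiplying by `p'` on the right kills one side. -/
lemma conj_up_component (hF : DifferentiableAt ℝ F q) (hu : IsUnit (F q)) {T A : 𝔸} {c : ℝ → E}
    {τ : ℝ → 𝔸} (h1 : c 0 = q) (h2 : τ 0 = T) (h3 : ContDiffAt ℝ ∞ c 0) (h4 : ContDiffAt ℝ ∞ τ 0)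
    (h5 : ∀ᶠ t in 𝓝 0, s.IsAdapted F (c t) (τ t)) (h6 : deriv τ 0 = T * A) {h : 𝔸ˣ}
    (e1 : T = F q * h) (e2 : (h : 𝔸) * s.p = s.p * h) :
    (h : 𝔸) * (s.p * A * s.p') * ↑h⁻¹ = s.p * logDeriv F q (deriv c 0) * s.p' := by
  have dc : HasDerivAt c (deriv c 0) 0 := (h3.differentiableAt (by simp)).hasDerivAt
  have dτ : HasDerivAt τ (T * A) 0 := h6 ▸ (h4.differentiableAt (by simp)).hasDerivAt
  have dF : HasDerivAt (fun t => F (c t)) (fderiv ℝ F q (deriv c 0)) 0 := by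
    have : HasFDerivAt F (fderiv ℝ F q) (c 0) := by rw [h1]; exact hF.hasFDerivAt
    exact this.comp_hasDerivAt (0 : ℝ) dc
  have di := hasDerivAt_inverse dF (by rwa [h1])
  have dk := di.mul dτ
  rw [h1, h2] at dk
  have hunit : ∀ᶠ t in 𝓝 (0 : ℝ), IsUnit (F (c t)) :=
    eventually_isUnit_comp dF.continuousAt (by rwa [h1])
  have comm := (dk.mul_const s.p).unique ((dk.const_mul s.p).congr_of_eventuallyEq (by
    filter_upwards [h5, hunit] with t ⟨_, k, k1, k2, _⟩ k3
    simp only [Pi.mul_apply, k1, Ring.inverse_mul_cancel_left _ _ k3, k2]))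
  have hθ : -(Ring.inverse (F q) * fderiv ℝ F q (deriv c 0) * Ring.inverse (F q)) * T +
      Ring.inverse (F q) * (T * A) = h * A - logDeriv F q (deriv c 0) * h := by
    rw [e1, logDeriv]
    simp only [neg_mul, mul_assoc, Ring.inverse_mul_cancel_left _ _ hu]
    abel
  rw [hθ] at comm
  rw [Units.mul_inv_eq_iff_eq_mul]
  have hp' := s.commute_p' e2
  have := congrArg (· * s.p') comm
  simp only [mul_assoc, s.mul_eq_zero, mul_zero, mul_sub, sub_mul, sub_zero] at this
  calc (h : 𝔸) * (s.p * A * s.p') = s.p * (h * (A * s.p')) := by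
        rw [← mul_assoc, ← mul_assoc, e2]; simp only [mul_assoc]
    _ = s.p * (logDeriv F q (deriv c 0) * (h * s.p')) := (sub_eq_zero.1 this.symm)
    _ = _ := by rw [hp']; simp only [mul_assoc]

lemma up_component_mem (hF : DifferentiableAt ℝ F q) (hu : IsUnit (F q)) {T A : 𝔸}
    (hA : A ∈ s.velocities F q T) : s.p * A * s.p' ∈ s.up := by
  obtain ⟨c, τ, h1, h2, h3, h4, h5, h6⟩ := hA
  obtain ⟨-, h, e1, e2, e3, -⟩ := h5.self_of_nhds
  rw [h2, h1] at e1
  rw [h1] at e3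
  exact (e3 _).2 ⟨_, conj_up_component hF hu h1 h2 h3 h4 h5 h6 e1 e2⟩

lemma down_component_mem (hF : DifferentiableAt ℝ F q) (hu : IsUnit (F q)) {T A : 𝔸}
    (hA : A ∈ s.velocities F q T) : s.p' * A * s.p ∈ s.down :=
  s.swap.up_component_mem hF hu (by rwa [velocities_swap])

/-- Along a curve of frames `ι (τ t) * τ t` stays on the line of scalars, and so does its
derivative; dividing by the conformal factor of `T` gives the claim. -/
lemma conformal_component_mem {T A : 𝔸}
    (hA : A ∈ s.velocities F q T) : ∃ c : ℂ, A + s.ι A = c • 1 := by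
  obtain ⟨c, τ, h1, h2, h3, h4, h5, h6⟩ := hA
  have dτ : HasDerivAt τ (T * A) 0 := h6 ▸ (h4.differentiableAt (by simp)).hasDerivAt
  have h : HasDerivAt (fun t => s.ι (τ t) * τ t) (s.ι (T * A) * T + s.ι T * (T * A)) 0 := by
    have := (s.ιL.hasFDerivAt.comp_hasDerivAt (0 : ℝ) dτ).mul dτ
    simpa [h2] using! this
  have hm := ((ℂ ∙ (1 : 𝔸)).restrictScalars ℝ).hasDerivAt_mem h (by
    filter_upwards [h5] with t ⟨⟨d, _, hd⟩, _⟩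
    rw [hd]
    exact Submodule.smul_mem _ _ (Submodule.mem_span_singleton_self _))
  obtain ⟨d, hd⟩ := Submodule.mem_span_singleton.1
    (show s.ι (T * A) * T + s.ι T * (T * A) ∈ ℂ ∙ (1 : 𝔸) from hm)
  obtain ⟨⟨e, he, hT⟩, _⟩ := h5.self_of_nhds
  rw [h2] at hT
  rw [s.ι_mul, mul_assoc, ← mul_assoc _ T A, hT, mul_smul_comm, mul_one, smul_mul_assoc, one_mul,
    ← smul_add] at hd
  exact ⟨e⁻¹ * d, by rw [mul_smul, hd, smul_smul, inv_mul_cancel₀ he, one_smul, add_comm]⟩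

lemma analyticAt_logDeriv (hF : AnalyticAt ℝ F q) (hu : IsUnit (F q)) (v : E) :
    AnalyticAt ℝ (fun x => logDeriv F x v) q := by
  have : CompleteSpace 𝔸 := FiniteDimensional.complete ℂ 𝔸
  obtain ⟨u, hu⟩ := hu
  have h1 : AnalyticAt ℝ (fun x => Ring.inverse (F x)) q :=
    AnalyticAt.comp (g := Ring.inverse) (hu ▸ analyticAt_inverse u) hF
  have h2 : AnalyticAt ℝ (fun x => fderiv ℝ F x v) q :=
    ((ContinuousLinearMap.apply ℝ 𝔸 v).analyticAt _).comp hF.fderiv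
  exact h1.mul h2

/-- Near a point with an adapted frame, the velocities of the moving splitting contain an analytic
linearly independent family of the size of the rank of `up`. -/
lemma exists_up_family (hF : AnalyticAt ℝ F q) (hu : IsUnit (F q)) {T : 𝔸}
    (hT : s.IsAdapted F q T) :
    ∃ u : E → Fin (Module.finrank ℂ s.up) → 𝔸, AnalyticAt ℝ u q ∧
      ∀ᶠ x in 𝓝 q, LinearIndependent ℂ (u x) ∧ ∀ i, ∃ v, u x i = s.p * logDeriv F x v * s.p' := by
  obtain ⟨-, h, -, -, h4, -⟩ := hT
  let b := Module.finBasis ℂ s.up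
  -- The directions are chosen at `q` and kept fixed at nearby points, where independence persists
  -- because it is an open condition.
  choose v hv using fun i => (h4 (b i)).1 (b i).2
  have ha : AnalyticAt ℝ (fun x i => s.p * logDeriv F x (v i) * s.p') q := by
    rw [analyticAt_pi_iff]
    exact fun i => (analyticAt_const.mul (analyticAt_logDeriv hF hu (v i))).mul analyticAt_const
  refine ⟨_, ha, ?_⟩
  have hind : LinearIndependent ℂ fun i => s.p * logDeriv F q (v i) * s.p' := by
    simp only [← hv]
    have h0 : LinearIndependent ℂ fun i => (b i : 𝔸) :=
      b.linearIndependent.map' s.up.subtype (Submodule.ker_subtype _)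
    exact h0.map' (conj h).toLinearMap (conj h).ker
  filter_upwards [ha.continuousAt.eventually
    (isOpen_setOfPred_linearIndependent.eventually_mem hind)] with x hx
  exact ⟨hx, fun i => ⟨v i, rfl⟩⟩

/-- The velocities of the moving splitting are the span of any independent family of full size. -/
lemma IsAdapted.map_conj_up {T : 𝔸} (hT : s.IsAdapted F q T) :
    ∃ h : 𝔸ˣ, T = F q * h ∧ (h : 𝔸) * s.p = s.p * h ∧
      ∀ u : Fin (Module.finrank ℂ s.up) → 𝔸, LinearIndependent ℂ u →
      (∀ i, ∃ v, u i = s.p * logDeriv F q v * s.p') → Submodule.span ℂ (range u) =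
        s.up.map (conj h).toLinearMap ∧ 
      ∀ a, (∃ v, a = s.p * logDeriv F q v * s.p') ↔ a ∈ s.up.map (conj h).toLinearMap := by
  obtain ⟨-, h, h2, h3, h4, -⟩ := hT
  have key : ∀ a, (∃ v, a = s.p * logDeriv F q v * s.p') ↔ a ∈ s.up.map (conj h).toLinearMap := by
    intro a
    rw [Submodule.mem_map_equiv, h4]
    simp [mul_assoc]
  refine ⟨h, h2, h3, fun u hu huv => ⟨?_, key⟩⟩
  refine Submodule.eq_of_le_of_finrank_eq (Submodule.span_le.2 ?_) ?_
  · rintro _ ⟨i, rfl⟩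
    exact (key _).1 (huv i)
  · rw [finrank_span_eq_card hu, LinearEquiv.finrank_map_eq]
    simp

section Family

open scoped Matrix.Norms.Operator

variable {r : ℕ}

lemma analyticAt_ringInverse_comp {X : Type*} [NormedAddCommGroup X] [NormedSpace ℝ X] {h : X → 𝔸}
    {x : X} (hh : AnalyticAt ℝ h x) (hu : IsUnit (h x)) :
    AnalyticAt ℝ (fun y => Ring.inverse (h y)) x := by
  have : CompleteSpace 𝔸 := FiniteDimensional.complete ℂ 𝔸
  obtain ⟨u, hu⟩ := hu
  exact AnalyticAt.comp (g := Ring.inverse) (hu ▸ analyticAt_inverse u) hh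

lemma analyticAt_familyAct {X : Type*} [NormedAddCommGroup X] [NormedSpace ℝ X] {h : X → 𝔸}
    {a : X → Matrix (Fin r) (Fin r) ℂ} {u : X → Fin r → 𝔸} {x : X} (hh : AnalyticAt ℝ h x)
    (hu : IsUnit (h x)) (ha : AnalyticAt ℝ a x) (hua : AnalyticAt ℝ u x) :
    AnalyticAt ℝ (fun y => familyAct (h y) (a y) (u y)) x := by
  rw [analyticAt_pi_iff] at hua ⊢
  intro i
  refine Finset.analyticAt_fun_sum _ fun j _ => ?_
  have hij : AnalyticAt ℝ (fun y => a y i j) x :=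
    ((LinearMap.toContinuousLinearMap
      (Matrix.entryLinearMap ℝ ℂ i j : Matrix (Fin r) (Fin r) ℂ →ₗ[ℝ] ℂ)).analyticAt _).comp ha
  exact hij.smul ((hh.mul (hua j)).mul (analyticAt_ringInverse_comp hh hu))

/-- If adapted frames exist at all points, then there is an analytic local section. -/
theorem exists_analytic_section (hF : AnalyticAt ℝ F q) (hu : IsUnit (F q))
    (hex : ∀ᶠ x in 𝓝 q, ∃ T, s.IsAdapted F x T) :
    ∃ T : E → 𝔸, AnalyticAt ℝ T q ∧ ∀ᶠ x in 𝓝 q, s.IsAdapted F x (T x) := by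
  have : CompleteSpace 𝔸 := FiniteDimensional.complete ℂ 𝔸
  rcases subsingleton_or_nontrivial 𝔸 with hsub | hnt
  · refine ⟨fun _ => 0, analyticAt_const, ?_⟩
    filter_upwards [hex] with x ⟨T, hT⟩
    rwa [Subsingleton.elim T 0] at hT
  obtain ⟨T₀, hT₀⟩ := hex.self_of_nhds
  obtain ⟨u, hua, hu1⟩ := s.exists_up_family hF hu hT₀
  obtain ⟨d, hda, hd1⟩ : ∃ d : E → Fin (Module.finrank ℂ s.down) → 𝔸, AnalyticAt ℝ d q ∧
      ∀ᶠ x in 𝓝 q, LinearIndependent ℂ (d x) ∧ ∀ i, ∃ v, d x i = s.p' * logDeriv F x v * s.p :=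
    s.swap.exists_up_family hF hu hT₀.swap
  let b := Module.finBasis ℂ s.up
  let b' := Module.finBasis ℂ s.down
  -- A subspace is encoded by a basis modulo invertible matrices and a conformal class by a form
  -- modulo scalars. The frame condition thus becomes an equation between points of a vector space
  -- on which the units of a product algebra act: by conjugation on the projection and the bases, by
  -- congruence on the form.
  let R : (𝔸 × ℂ × Matrix (Fin (Module.finrank ℂ s.up)) (Fin (Module.finrank ℂ s.up)) ℂ × Matrix (Fin (Module.finrank ℂ s.down)) (Fin (Module.finrank ℂ s.down)) ℂ) →
      (𝔸 × 𝔸 × (Fin (Module.finrank ℂ s.up) → 𝔸) × (Fin (Module.finrank ℂ s.down) → 𝔸)) → (𝔸 × 𝔸 × (Fin (Module.finrank ℂ s.up) → 𝔸) × (Fin (Module.finrank ℂ s.down) → 𝔸)) :=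
    fun g y => (g.1 * y.1 * Ring.inverse g.1,
      g.2.1 • (s.ι (Ring.inverse g.1) * y.2.1 * Ring.inverse g.1),
      familyAct g.1 g.2.2.1 y.2.2.1, familyAct g.1 g.2.2.2 y.2.2.2)
  have hunit : ∀ {g : 𝔸 × ℂ × Matrix (Fin (Module.finrank ℂ s.up)) (Fin (Module.finrank ℂ s.up)) ℂ × Matrix (Fin (Module.finrank ℂ s.down)) (Fin (Module.finrank ℂ s.down)) ℂ},
      IsUnit g → IsUnit g.1 ∧ IsUnit g.2.1 := fun hg =>
    ⟨(Prod.isUnit_iff.1 hg).1, (Prod.isUnit_iff.1 (Prod.isUnit_iff.1 hg).2).1⟩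
  have hR : ∀ g y, IsUnit g → AnalyticAt ℝ (fun x : (𝔸 × ℂ × Matrix (Fin (Module.finrank ℂ s.up)) (Fin (Module.finrank ℂ s.up)) ℂ ×
      Matrix (Fin (Module.finrank ℂ s.down)) (Fin (Module.finrank ℂ s.down)) ℂ) × (𝔸 × 𝔸 × (Fin (Module.finrank ℂ s.up) → 𝔸) × (Fin (Module.finrank ℂ s.down) → 𝔸)) => R x.1 x.2)
      (g, y) := by
    intro g y hg
    have hg1 := (hunit hg).1
    have ag := analyticAt_fst (𝕜 := ℝ) (p := (g, y))
    have ay := analyticAt_snd (𝕜 := ℝ) (p := (g, y))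
    have ag1 := analyticAt_fst.fun_comp ag
    have ag2 := analyticAt_snd.fun_comp ag
    have ay1 := analyticAt_fst.fun_comp ay
    have ay2 := analyticAt_snd.fun_comp ay
    have ai := analyticAt_ringInverse_comp ag1 hg1
    have aι := (s.ιL.analyticAt _).fun_comp ai
    refine ((ag1.mul ay1).mul ai).prod (((analyticAt_fst.fun_comp ag2).smul
      ((aι.mul (analyticAt_fst.fun_comp ay2)).mul ai)).prod
      ((analyticAt_familyAct ag1 hg1 (analyticAt_fst.fun_comp (analyticAt_snd.fun_comp ag2))
        (analyticAt_fst.fun_comp (analyticAt_snd.fun_comp ay2))).prod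
      (analyticAt_familyAct ag1 hg1 (analyticAt_snd.fun_comp (analyticAt_snd.fun_comp ag2))
        (analyticAt_snd.fun_comp (analyticAt_snd.fun_comp ay2)))))
  have one : ∀ y, R 1 y = y := by
    intro y
    simp [R, familyAct_one, s.ι_one]
  have mul : ∀ g k y, IsUnit g → IsUnit k → R (g * k) y = R g (R k y) := by
    rintro ⟨g, c, m⟩ ⟨k, d, m'⟩ y hg hk
    obtain ⟨g, rfl⟩ := (hunit hg).1
    obtain ⟨k, rfl⟩ := (hunit hk).1
    simp only [R, Prod.mk_mul_mk, Prod.fst_mul, Prod.snd_mul]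
    refine Prod.ext ?_ (Prod.ext ?_ (Prod.ext ?_ ?_))
    · simp only [← Units.val_mul, Ring.inverse_unit, mul_inv_rev]
      simp only [Units.val_mul, mul_assoc]
    · simp only [← Units.val_mul, Ring.inverse_unit, mul_inv_rev]
      simp only [Units.val_mul, s.ι_mul, mul_assoc, mul_smul, mul_smul_comm, smul_mul_assoc]
    · exact familyAct_mul g.isUnit k.isUnit _ _ _
    · exact familyAct_mul g.isUnit k.isUnit _ _ _
  let f : E → 𝔸 × 𝔸 × (Fin (Module.finrank ℂ s.up) → 𝔸) × (Fin (Module.finrank ℂ s.down) → 𝔸) := fun x => (s.p, s.ι (F x) * F x, u x, d x)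
  have hf : AnalyticAt ℝ f q :=
    analyticAt_const.prod ((((s.ιL.analyticAt _).fun_comp hF).mul hF).prod (hua.prod hda))
  -- An adapted frame `F x * h` at `x` supplies the group element: `h`, its conformal factor, and
  -- the two changes of basis.
  have horb : ∀ᶠ x in 𝓝 q, ∃ g, IsUnit g ∧
      R g (s.p, 1, fun i => (b i : 𝔸), fun i => (b' i : 𝔸)) = f x := by
    filter_upwards [hex, hu1, hd1] with x ⟨T, hT⟩ hux hdx
    obtain ⟨⟨c, hc, e1⟩, h, e2, e3, e4, e5⟩ := hT
    have m1 : ∀ i, u x i ∈ s.up.map (conj h).toLinearMap := by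
      intro i
      obtain ⟨v, hv⟩ := hux.2 i
      rw [Submodule.mem_map_equiv, e4]
      exact ⟨v, by simp [mul_assoc, hv]⟩
    have m2 : ∀ i, d x i ∈ s.down.map (conj h).toLinearMap := by
      intro i
      obtain ⟨v, hv⟩ := hdx.2 i
      rw [Submodule.mem_map_equiv, e5]
      exact ⟨v, by simpa [mul_assoc] using hv⟩
    obtain ⟨a₁, ha₁, k1⟩ := exists_familyAct_eq b h hux.1 m1
    obtain ⟨a₂, ha₂, k2⟩ := exists_familyAct_eq b' h hdx.1 m2
    refine ⟨((h : 𝔸), c, a₁, a₂), ?_, ?_⟩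
    · exact Prod.isUnit_iff.2 ⟨h.isUnit, Prod.isUnit_iff.2 ⟨hc.isUnit, Prod.isUnit_iff.2 ⟨ha₁, ha₂⟩⟩⟩
    · refine Prod.ext ?_ (Prod.ext ?_ (Prod.ext k1 k2)) <;>
        simp only [R, f, Ring.inverse_unit, mul_one]
      · rw [e3]
        rw [mul_assoc, Units.mul_inv, mul_one]
      · have e6 : s.ι (↑h⁻¹ : 𝔸) * s.ι (h : 𝔸) = 1 := by
          rw [← s.ι_mul, Units.mul_inv, s.ι_one]
        have := congrArg (fun z => s.ι (↑h⁻¹ : 𝔸) * z * (↑h⁻¹ : 𝔸)) e1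
        simp only [e2, s.ι_mul, mul_smul_comm, smul_mul_assoc, mul_one] at this
        rw [← this]
        simp only [mul_assoc, Units.mul_inv, mul_one]
        rw [← mul_assoc, e6, one_mul]
  obtain ⟨g, hga, hg⟩ := exists_analyticAt_lift_of_orbit hR one mul _ hf horb
  refine ⟨fun x => F x * (g x).1, hF.mul (analyticAt_fst.fun_comp hga), ?_⟩
  filter_upwards [hg, hex, hu1, hd1, eventually_isUnit_comp hF.continuousAt hu] with
    x ⟨hgu, hgx⟩ ⟨T, hT⟩ hux hdx hFu
  obtain ⟨⟨h, hh⟩, hc⟩ := hunit hgu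
  have x1 := congrArg Prod.fst hgx
  have x2 := congrArg (fun y => y.2.1) hgx
  have x3 := congrArg (fun y => y.2.2.1) hgx
  have x4 := congrArg (fun y => y.2.2.2) hgx
  simp only [R, f, ← hh, Ring.inverse_unit, mul_one] at x1 x2 x3 x4
  have hιu : (g x).2.1 • (1 : 𝔸) = s.ι (F x * h) * (F x * h) := by
    have e6 : s.ι (h : 𝔸) * s.ι (↑h⁻¹ : 𝔸) = 1 := by
      rw [← s.ι_mul, Units.inv_mul, s.ι_one]
    have := congrArg (fun z => s.ι (h : 𝔸) * z * (h : 𝔸)) x2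
    simp only [mul_smul_comm, smul_mul_assoc] at this
    rw [← mul_assoc, e6, one_mul, Units.inv_mul] at this
    rw [this, s.ι_mul]
    simp only [mul_assoc]
  -- Two spaces have to agree: the velocities of the splitting and the conjugate of `up` by the
  -- lifted `h`. Both contain the family `w`, and both have its size as dimension; for the
  -- velocities this uses the frame `T` known to exist at `x`.
  have conj_eq : ∀ {s : AlgebraSymbol 𝔸} (_ : s.IsAdapted F x T)
      {w : Fin (Module.finrank ℂ s.up) → 𝔸} (_ : LinearIndependent ℂ w)
      (_ : ∀ i, ∃ v, w i = s.p * logDeriv F x v * s.p')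
      (_ : ∀ i, w i ∈ s.up.map (conj h).toLinearMap) (a : 𝔸),
      a ∈ s.up ↔ ∃ v, (h : 𝔸) * a * ↑h⁻¹ = s.p * logDeriv F x v * s.p' := by
    intro s hT w hw hwv hwm a
    obtain ⟨k, -, -, hk⟩ := hT.map_conj_up
    obtain ⟨k1, k2⟩ := hk w hw hwv
    have k3 : Submodule.span ℂ (range w) = s.up.map (conj h).toLinearMap := by
      refine Submodule.eq_of_le_of_finrank_eq (Submodule.span_le.2 ?_) ?_
      · rintro _ ⟨i, rfl⟩
        exact hwm i
      · rw [finrank_span_eq_card hw, LinearEquiv.finrank_map_eq]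
        simp
    rw [k2, ← k1, k3, Submodule.mem_map_equiv]
    simp [mul_assoc]
  refine ⟨⟨(g x).2.1, hc.ne_zero, hh ▸ hιu.symm⟩, h, by rw [hh], ?_, ?_, ?_⟩
  · exact (Units.mul_inv_eq_iff_eq_mul _).1 x1
  · refine conj_eq hT hux.1 hux.2 fun i => ?_
    rw [← x3]
    exact mem_map_conj_of_familyAct (fun i => (b i).2) h _ i
  · refine conj_eq hT.swap hdx.1 hdx.2 fun i => ?_
    rw [← x4]
    exact mem_map_conj_of_familyAct (fun i => (b' i).2) h _ i

end Family

end AlgebraSymbol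

end

/-! ### Constant velocities: commutators, grading and regularity. -/

noncomputable section

namespace AlgebraSymbol

variable {𝔸 : Type*} [NormedRing 𝔸] [NormedAlgebra ℂ 𝔸] {s : AlgebraSymbol 𝔸}
  {E : Type*} [NormedAddCommGroup E] [NormedSpace ℝ E] {F T : E → 𝔸} {q : E}

lemma IsZero.add {a b : 𝔸} (ha : s.IsZero a) (hb : s.IsZero b) : s.IsZero (a + b) := by
  obtain ⟨⟨c, a1⟩, a2, a3, a4⟩ := ha
  obtain ⟨⟨d, b1⟩, b2, b3, b4⟩ := hb
  have e : ∀ x : 𝔸, (a + b) * x - x * (a + b) = (a * x - x * a) + (b * x - x * b) := by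
    intro x; noncomm_ring
  refine ⟨⟨c + d, ?_⟩, by rw [add_mul, mul_add, a2, b2], fun x hx => ?_, fun x hx => ?_⟩
  · rw [map_add, add_smul, ← a1, ← b1]; abel
  · rw [e]; exact s.up.add_mem (a3 x hx) (b3 x hx)
  · rw [e]; exact s.down.add_mem (a4 x hx) (b4 x hx)

lemma IsZero.smul {a : 𝔸} (c : ℂ) (ha : s.IsZero a) : s.IsZero (c • a) := by
  obtain ⟨⟨d, a1⟩, a2, a3, a4⟩ := ha
  have e : ∀ x : 𝔸, (c • a) * x - x * (c • a) = c • (a * x - x * a) := by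
    intro x; simp [smul_sub]
  refine ⟨⟨c * d, ?_⟩, by rw [smul_mul_assoc, mul_smul_comm, a2], fun x hx => ?_, fun x hx => ?_⟩
  · rw [map_smul, mul_smul, ← a1, smul_add]
  · rw [e]; exact s.up.smul_mem c (a3 x hx)
  · rw [e]; exact s.down.smul_mem c (a4 x hx)

lemma IsZero.real_smul {a : 𝔸} (c : ℝ) (ha : s.IsZero a) : s.IsZero (c • a) := by
  simpa using ha.smul (c : ℂ)

lemma isZero_zero : s.IsZero (0 : 𝔸) :=
  ⟨⟨0, by simp⟩, by simp, fun _ _ => by simp, fun _ _ => by simp⟩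

lemma IsAdapted.isUnit {T : 𝔸} (hT : s.IsAdapted F q T) (hu : IsUnit (F q)) : IsUnit T := by
  obtain ⟨-, h, rfl, -⟩ := hT
  exact hu.mul h.isUnit

/-- The element `c p + c⁻¹ p'`. -/
def gradingUnit (s : AlgebraSymbol 𝔸) (c : ℝ) (hc : c ≠ 0) : 𝔸ˣ where
  val := c • s.p + c⁻¹ • s.p'
  inv := c⁻¹ • s.p + c • s.p'
  val_inv := by
    simp [add_mul, mul_add, smul_smul, hc, s.p_mul_p, s.p'_mul_p', s.mul_eq_zero, s.mul_eq_zero',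
      s.add_eq_one]
  inv_val := by
    simp [add_mul, mul_add, smul_smul, hc, s.p_mul_p, s.p'_mul_p', s.mul_eq_zero, s.mul_eq_zero',
      s.add_eq_one]

@[simp]
lemma gradingUnit_val {c : ℝ} (hc : c ≠ 0) :
    (gradingUnit s c hc : 𝔸) = c • s.p + c⁻¹ • s.p' := rfl

@[simp]
lemma gradingUnit_inv_coe {c : ℝ} (hc : c ≠ 0) :
    (↑(gradingUnit s c hc)⁻¹ : 𝔸) = c⁻¹ • s.p + c • s.p' := rfl

lemma p_mul_up {b : 𝔸} (hb : b ∈ s.up) : s.p * b = b := by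
  rw [← s.up_mem b hb, mul_assoc, ← mul_assoc s.p s.p, s.p_mul_p]

lemma p'_mul_up {b : 𝔸} (hb : b ∈ s.up) : s.p' * b = 0 := by
  rw [← p_mul_up hb, ← mul_assoc, s.mul_eq_zero', zero_mul]

lemma up_mul_p' {b : 𝔸} (hb : b ∈ s.up) : b * s.p' = b := by
  rw [← s.up_mem b hb, mul_assoc, s.p'_mul_p']

lemma up_mul_p {b : 𝔸} (hb : b ∈ s.up) : b * s.p = 0 := by
  rw [← up_mul_p' hb, mul_assoc, s.mul_eq_zero', mul_zero]

/-- Serves to recognize a commutator with `up` as its own component of weight `2`. -/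
lemma lie_up_component {A b : 𝔸} (hp : A * s.p = s.p * A) (hb : b ∈ s.up) :
    s.p * (A * b - b * A) * s.p' = A * b - b * A := by
  have hp' := s.commute_p' hp
  rw [mul_sub, sub_mul, ← mul_assoc, ← hp, mul_assoc A, p_mul_up hb, mul_assoc A, up_mul_p' hb,
    ← mul_assoc, p_mul_up hb, mul_assoc, hp', ← mul_assoc, up_mul_p' hb]

lemma lie_down_up_commute {a b : 𝔸} (ha : a ∈ s.down) (hb : b ∈ s.up) :
    (a * b - b * a) * s.p = s.p * (a * b - b * a) := by
  have k1 : a * s.p = a := up_mul_p' (s := s.swap) ha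
  have k2 : s.p * a = 0 := p'_mul_up (s := s.swap) ha
  rw [sub_mul, mul_sub, mul_assoc a b, up_mul_p hb, mul_assoc b a, k1, ← mul_assoc, k2,
    ← mul_assoc, p_mul_up hb, mul_zero, zero_mul]

lemma eq_add_components (s : AlgebraSymbol 𝔸) (A : 𝔸) :
    A = s.p' * A * s.p + (s.p * A * s.p + s.p' * A * s.p') + s.p * A * s.p' := by
  have : A = (s.p + s.p') * A * (s.p + s.p') := by rw [s.add_eq_one, one_mul, mul_one]
  conv_lhs => rw [this]
  noncomm_ring

lemma gradingUnit_conj_up {c : ℝ} (hc : c ≠ 0) {b : 𝔸} (hb : b ∈ s.up) :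
    (gradingUnit s c hc : 𝔸) * b * ↑(gradingUnit s c hc)⁻¹ = (c * c) • b := by
  rw [gradingUnit_inv_coe, gradingUnit_val]
  simp only [add_mul, mul_add, smul_mul_assoc, mul_smul_comm, p_mul_up hb, p'_mul_up hb,
    up_mul_p' hb, up_mul_p hb, smul_zero, add_zero, zero_add, smul_smul]

lemma gradingUnit_swap {c : ℝ} (hc : c ≠ 0) :
    gradingUnit s c hc = gradingUnit s.swap c⁻¹ (inv_ne_zero hc) := by
  ext
  simp [add_comm]

lemma gradingUnit_inv {c : ℝ} (hc : c ≠ 0) :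
    (gradingUnit s c hc)⁻¹ = gradingUnit s c⁻¹ (inv_ne_zero hc) := by
  ext
  simp

lemma mem_up_iff_gradingUnit_conj {c : ℝ} (hc : c ≠ 0) (b : 𝔸) : 
    b ∈ s.up ↔ (gradingUnit s c hc : 𝔸) * b * ↑(gradingUnit s c hc)⁻¹ ∈ s.up := by
  refine ⟨fun hb => ?_, fun hb => ?_⟩
  · rw [gradingUnit_conj_up hc hb]
    exact (s.up.restrictScalars ℝ).smul_mem _ hb
  · have h := gradingUnit_conj_up (inv_ne_zero hc) hb
    rw [← gradingUnit_inv hc, inv_inv] at h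
    simp only [mul_assoc, Units.inv_mul, mul_one, Units.inv_mul_cancel_left] at h
    rw [h]
    exact (s.up.restrictScalars ℝ).smul_mem _
      (show _ ∈ s.up by simpa only [mul_assoc] using hb)

/-- Since `ι` exchanges `p` and `p'`, the adjoint of `c p + c⁻¹ p'` is its inverse, so it is
symplectic; it acts on `up` by `c²` and on `down` by `c⁻²`. The stabilizer thus always contains the
torus that defines the grading. -/
lemma isStab_gradingUnit {c : ℝ} (hc : c ≠ 0) : s.IsStab (gradingUnit s c hc) := by
  refine ⟨⟨1, one_ne_zero, ?_⟩, ?_, mem_up_iff_gradingUnit_conj hc, fun b => ?_⟩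
  · have : s.ι (gradingUnit s c hc) = ↑(gradingUnit s c hc)⁻¹ := by
      rw [gradingUnit_inv_coe, gradingUnit_val, map_add, LinearMap.map_smul_of_tower,
        LinearMap.map_smul_of_tower, s.ι_p, s.ι_p', add_comm]
    rw [this, Units.inv_mul, one_smul]
  · simp [add_mul, mul_add, s.mul_eq_zero, s.mul_eq_zero']
  · rw [gradingUnit_swap]
    exact mem_up_iff_gradingUnit_conj (s := s.swap) _ b

lemma logDeriv_add (v w : E) : logDeriv T q (v + w) = logDeriv T q v + logDeriv T q w := by
  rw [logDeriv, map_add, mul_add]; rfl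

lemma logDeriv_smul (c : ℝ) (v : E) : logDeriv T q (c • v) = c • logDeriv T q v := by
  rw [logDeriv, map_smul, mul_smul_comm]; rfl

variable [FiniteDimensional ℂ 𝔸]

/-- The curve is `T (q + t • v) * exp (t • a)`: the section moved along a line, combined with a
one-parameter group in the stabilizer. -/
lemma exists_curve_of_section (hu : IsUnit (F q)) (hT : AnalyticAt ℝ T q)
    (hs : ∀ᶠ x in 𝓝 q, s.IsAdapted F x (T x)) (v : E) {a : 𝔸} (ha : s.IsZero a) :
    ∃ (c : ℝ → E) (τ : ℝ → 𝔸), deriv c 0 = v ∧ c 0 = q ∧ τ 0 = T q ∧ ContDiffAt ℝ ∞ c 0 ∧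
      ContDiffAt ℝ ∞ τ 0 ∧ (∀ᶠ t in 𝓝 0, s.IsAdapted F (c t) (τ t)) ∧
      deriv τ 0 = T q * (logDeriv T q v + a) := by
  have : CompleteSpace 𝔸 := FiniteDimensional.complete ℂ 𝔸
  have hTu := hs.self_of_nhds.isUnit hu
  have hc : ContDiffAt ℝ ∞ (fun t : ℝ => q + t • v) 0 := by fun_prop
  have hd : HasDerivAt (fun t : ℝ => q + t • v) v 0 := by
    simpa using ((hasDerivAt_id (0 : ℝ)).smul_const v).const_add q
  have hT' : AnalyticAt ℝ T (q + (0 : ℝ) • v) := by simpa using hT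
  have hTc : ContDiffAt ℝ ∞ (fun t : ℝ => T (q + t • v)) 0 :=
    hT'.contDiffAt.comp (0 : ℝ) hc
  have hTd : HasDerivAt (fun t : ℝ => T (q + t • v)) (fderiv ℝ T q v) 0 := by
    have := hT'.differentiableAt.hasFDerivAt.comp_hasDerivAt (0 : ℝ) hd
    simpa using! this
  have hed : HasDerivAt (fun t : ℝ => (expUnit (t • a) : 𝔸)) a 0 := by
    simpa [expUnit] using! hasDerivAt_exp_smul_const (𝕂 := ℝ) a (0 : ℝ)
  have hec : ContDiffAt ℝ ∞ (fun t : ℝ => (expUnit (t • a) : 𝔸)) 0 := by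
    have h1 : AnalyticAt ℝ (NormedSpace.exp : 𝔸 → 𝔸) ((0 : ℝ) • a) :=
      NormedSpace.exp_analytic (𝕂 := ℝ) _
    exact h1.contDiffAt.comp (0 : ℝ) (f := fun t : ℝ => t • a) (by fun_prop)
  have he0 : (expUnit ((0 : ℝ) • a) : 𝔸) = 1 := by simp [expUnit]
  refine ⟨fun t => q + t • v, fun t => T (q + t • v) * expUnit (t • a), hd.deriv, by simp, ?_, hc,
    hTc.mul hec, ?_, ?_⟩
  · change T (q + (0 : ℝ) • v) * (expUnit ((0 : ℝ) • a) : 𝔸) = _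
    rw [he0, mul_one, zero_smul, add_zero]
  · have : Tendsto (fun t : ℝ => q + t • v) (𝓝 0) (𝓝 q) := by
      simpa using hc.continuousAt.tendsto
    filter_upwards [this.eventually hs] with t ht
    exact ht.mul_stab (isStab_expUnit (ha.real_smul t))
  · refine (hTd.mul hed).deriv.trans ?_
    simp only [zero_smul, add_zero] at he0 ⊢
    rw [he0, mul_one, mul_add, logDeriv, Ring.mul_inverse_cancel_left _ _ hTu]

lemma mem_velocities_of_section (hu : IsUnit (F q)) (hT : AnalyticAt ℝ T q)
    (hs : ∀ᶠ x in 𝓝 q, s.IsAdapted F x (T x)) (v : E) {a : 𝔸} (ha : s.IsZero a) :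
    logDeriv T q v + a ∈ s.velocities F q (T q) := by
  obtain ⟨c, τ, -, h⟩ := exists_curve_of_section hu hT hs v ha
  exact ⟨c, τ, h⟩

/-- Dividing a curve of frames by the section over the same points leaves a curve in the stabilizer,
starting at `1`. Its derivative is the difference in question. -/
lemma isZero_sub_logDeriv (hu : IsUnit (F q)) (hF : ContinuousAt F q) (hT : AnalyticAt ℝ T q)
    (hs : ∀ᶠ x in 𝓝 q, s.IsAdapted F x (T x)) {A : 𝔸} (hA : A ∈ s.velocities F q (T q)) :
    ∃ v, s.IsZero (A - logDeriv T q v) := by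
  obtain ⟨c, τ, h1, h2, h3, h4, h5, h6⟩ := hA
  have hTu := hs.self_of_nhds.isUnit hu
  have dc : HasDerivAt c (deriv c 0) 0 := (h3.differentiableAt (by simp)).hasDerivAt
  have dτ : HasDerivAt τ (T q * A) 0 := h6 ▸ (h4.differentiableAt (by simp)).hasDerivAt
  have dT : HasDerivAt (fun t => T (c t)) (fderiv ℝ T q (deriv c 0)) 0 := by
    have : HasFDerivAt T (fderiv ℝ T q) (c 0) := by
      rw [h1]; exact hT.differentiableAt.hasFDerivAt
    exact this.comp_hasDerivAt (0 : ℝ) dc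
  have dk := (hasDerivAt_inverse dT (by rwa [h1])).mul dτ
  rw [h1, h2] at dk
  refine ⟨deriv c 0, isZero_of_hasDerivAt (dk.congr_deriv ?_) ?_ ?_⟩
  · simp only [neg_mul, mul_assoc, Ring.inverse_mul_cancel_left _ _ hTu,
      Ring.inverse_mul_cancel _ hTu, mul_one, logDeriv]
    abel
  · simp only [Pi.mul_apply, h1, h2, Ring.inverse_mul_cancel _ hTu]
  · have hct : Tendsto c (𝓝 0) (𝓝 q) := h1 ▸ dc.continuousAt.tendsto
    filter_upwards [h5, hct.eventually hs, hct.eventually (eventually_isUnit_comp hF hu)] with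
      t k1 k2 k3
    obtain ⟨k, hk, hk'⟩ := k2.exists_stab k1
    exact ⟨k, by rw [Pi.mul_apply, hk', Ring.inverse_mul_cancel_left _ _ (k2.isUnit k3)], hk⟩

lemma hasDerivAt_logDeriv (hT : AnalyticAt ℝ T q) (hu : IsUnit (T q)) (v w : E) :
    HasDerivAt (fun t : ℝ => logDeriv T (q + t • v) w)
      (-(logDeriv T q v * logDeriv T q w) +
        Ring.inverse (T q) * fderiv ℝ (fderiv ℝ T) q v w) 0 := by
  have : CompleteSpace 𝔸 := FiniteDimensional.complete ℂ 𝔸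
  have hd : HasDerivAt (fun t : ℝ => q + t • v) v 0 := by
    simpa using ((hasDerivAt_id (0 : ℝ)).smul_const v).const_add q
  have h1 : HasFDerivAt T (fderiv ℝ T q) (q + (0 : ℝ) • v) := by
    simpa using hT.differentiableAt.hasFDerivAt
  have h2 : HasFDerivAt (fderiv ℝ T) (fderiv ℝ (fderiv ℝ T) q) (q + (0 : ℝ) • v) := by
    simpa using hT.fderiv.differentiableAt.hasFDerivAt
  have h3 := hasDerivAt_inverse (h1.comp_hasDerivAt (0 : ℝ) hd) (by simpa using hu)
  have h4 := ((ContinuousLinearMap.apply ℝ 𝔸 w).hasFDerivAt.comp_hasDerivAt (0 : ℝ)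
    (h2.comp_hasDerivAt (0 : ℝ) hd))
  have h5 := h3.mul h4
  refine (h5.congr_deriv ?_ :)
  simp [logDeriv, mul_assoc]

/-- The common space of velocities is closed under commutators, along a section of adapted frames. -/
lemma logDeriv_bracket_mem (U : Submodule ℝ 𝔸) (hT : AnalyticAt ℝ T q) (hu : IsUnit (T q))
    (hU : ∀ᶠ x in 𝓝 q, ∀ v, logDeriv T x v ∈ U) (v w : E) :
    logDeriv T q v * logDeriv T q w - logDeriv T q w * logDeriv T q v ∈ U := by
  have : CompleteSpace 𝔸 := FiniteDimensional.complete ℂ 𝔸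
  have key : ∀ v w : E, -(logDeriv T q v * logDeriv T q w) +
        Ring.inverse (T q) * fderiv ℝ (fderiv ℝ T) q v w ∈ U := by
    intro v w
    refine U.hasDerivAt_mem (hasDerivAt_logDeriv hT hu v w) ?_
    have : Tendsto (fun t : ℝ => q + t • v) (𝓝 0) (𝓝 q) := by
      have : ContinuousAt (fun t : ℝ => q + t • v) 0 := by fun_prop
      simpa using this.tendsto
    exact (this.eventually hU).mono fun t ht => ht w
  -- This is the Maurer-Cartan equation: antisymmetrizing the derivative of `T⁻¹ dT` cancels the
  -- symmetric second derivative and leaves the commutator.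
  have hsymm : fderiv ℝ (fderiv ℝ T) q v w = fderiv ℝ (fderiv ℝ T) q w v :=
    (hT.contDiffAt (n := 2)).isSymmSndFDerivAt (by simp) v w
  have := U.sub_mem (key w v) (key v w)
  rw [hsymm] at this
  convert! this using 1
  abel

/-- If the velocities of adapted frames are the same space `S` for all adapted frames near a point,
then `S` is `𝔤_0` and the symbol is regular. -/
theorem regular_of_velocities_eq (hF : AnalyticAt ℝ F q) (hu : IsUnit (F q))
    (hex : ∀ᶠ x in 𝓝 q, ∃ T, s.IsAdapted F x T) {S : Set 𝔸}
    (hS : ∀ᶠ x in 𝓝 q, ∀ T, s.IsAdapted F x T → s.velocities F x T = S) :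
    (∀ a ∈ s.down, ∀ b ∈ s.up, s.IsZero (a * b - b * a)) ∧
      ∀ A, A ∈ S ↔ ∃ d ∈ s.down, ∃ z, s.IsZero z ∧ ∃ u ∈ s.up, A = d + z + u := by
  have : CompleteSpace 𝔸 := FiniteDimensional.complete ℂ 𝔸
  obtain ⟨T, hT, hsec⟩ := exists_analytic_section hF hu hex
  have hunitF := eventually_isUnit_comp hF.continuousAt hu
  have hmem : ∀ᶠ x in 𝓝 q, ∀ v a, s.IsZero a → logDeriv T x v + a ∈ S := by
    filter_upwards [hunitF, hT.eventually_analyticAt, hsec.eventually_nhds, hS] with x x1 x2 x3 x4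
    intro v a ha
    rw [← x4 _ x3.self_of_nhds]
    exact mem_velocities_of_section x1 x2 x3 v ha
  have hmemq := hmem.self_of_nhds
  have hSq := hS.self_of_nhds
  have hadq := hsec.self_of_nhds
  have hTu := hadq.isUnit hu
  have hdec : ∀ A ∈ S, ∃ v, s.IsZero (A - logDeriv T q v) := by
    intro A hA
    rw [← hSq _ hadq] at hA
    exact isZero_sub_logDeriv hu hF.continuousAt hT hsec hA
  -- `S` is the sum of the values of `logDeriv T q` and of the infinitesimal stabilizer, hence a
  -- subspace. Only real linearity is available, since the leaf enters as a real manifold.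
  let U : Submodule ℝ 𝔸 :=
    { carrier := S
      add_mem' := by
        intro A B hA hB
        obtain ⟨v, hv⟩ := hdec A hA
        obtain ⟨w, hw⟩ := hdec B hB
        convert! hmemq (v + w) _ (hv.add hw) using 1
        rw [logDeriv_add]; abel
      zero_mem' := by simpa [logDeriv] using hmemq 0 0 isZero_zero
      smul_mem' := by
        intro c A hA
        obtain ⟨v, hv⟩ := hdec A hA
        convert! hmemq (c • v) _ (hv.real_smul c) using 1
        rw [logDeriv_smul, smul_sub]; abel }
  have hUS : ∀ A, A ∈ U ↔ A ∈ S := fun _ => Iff.rfl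
  have hzero : ∀ a, s.IsZero a → a ∈ U := fun a ha => by
    rw [hUS]
    simpa [logDeriv] using hmemq 0 a ha
  have hconj : ∀ k : 𝔸ˣ, s.IsStab k → ∀ A ∈ U, ↑k⁻¹ * A * k ∈ U := by
    intro k hk A hA
    rw [hUS, ← hSq _ hadq] at hA
    rw [hUS, ← hSq _ (hadq.mul_stab hk)]
    exact conj_velocity hk hA
  -- Invariance under conjugation by `exp (t • a)`, differentiated at `t = 0`.
  have hzbr : ∀ A ∈ U, ∀ a, s.IsZero a → A * a - a * A ∈ U := by
    intro A hA a ha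
    have hed : ∀ b : 𝔸, HasDerivAt (fun t : ℝ => NormedSpace.exp (t • b)) b 0 := by
      intro b
      simpa using hasDerivAt_exp_smul_const (𝕂 := ℝ) b (0 : ℝ)
    have h1 := ((hed (-a)).mul_const A).mul (hed a)
    have h2 := U.hasDerivAt_mem h1 (Eventually.of_forall fun t => by
      have := hconj _ (isStab_expUnit (ha.real_smul t)) A hA
      simpa [expUnit] using! this)
    simpa [sub_eq_add_neg, add_comm] using h2
  -- With `A = θ v + a` and `B = θ w + b`, the commutator is `[θ v, θ w] + [θ v, b] - [B, a]`.
  have hbr : ∀ A ∈ U, ∀ B ∈ U, A * B - B * A ∈ U := by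
    intro A hA B hB
    obtain ⟨v, hv⟩ := hdec A hA
    obtain ⟨w, hw⟩ := hdec B hB
    have hθ : ∀ᶠ x in 𝓝 q, ∀ v, logDeriv T x v ∈ U :=
      hmem.mono fun x hx v => (hUS _).2 (by simpa using hx v 0 isZero_zero)
    have k1 := logDeriv_bracket_mem U hT hTu hθ v w
    have k2 := hzbr _ (hθ.self_of_nhds v) _ hw
    have k3 := hzbr B hB _ hv
    have := U.sub_mem (U.add_mem k1 k2) k3
    convert! this using 1
    noncomm_ring
  -- the space is graded
  have hgr : ∀ A ∈ U, s.p * A * s.p' ∈ U ∧ s.p' * A * s.p ∈ U := by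
    intro A hA
    have e : ∀ c : ℝ, (hc : c ≠ 0) → (c⁻¹ * c⁻¹ - 1) • (s.p * A * s.p') +
        (c * c - 1) • (s.p' * A * s.p) ∈ U := by
      intro c hc
      have h1 := U.sub_mem (hconj _ (isStab_gradingUnit hc) A hA) hA
      convert! h1 using 1
      rw [gradingUnit_inv_coe, gradingUnit_val]
      have e1 : (c⁻¹ • s.p + c • s.p') * A * (c • s.p + c⁻¹ • s.p') =
          s.p * A * s.p + (c⁻¹ * c⁻¹) • (s.p * A * s.p') + (c * c) • (s.p' * A * s.p) +
            s.p' * A * s.p' := by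
        simp only [add_mul, mul_add, smul_add, smul_mul_assoc, mul_smul_comm, smul_smul,
          inv_mul_cancel₀ hc, mul_inv_cancel₀ hc, one_smul]
        abel
      rw [e1]
      refine eq_sub_of_add_eq ?_
      conv_lhs => enter [2]; rw [s.eq_add_components A]
      simp only [sub_smul, one_smul]
      abel
    -- For `c = 2` the coefficients are `-3/4` and `3`, for `c = 3` they are `-8/9` and `8`. These
    -- two combinations are independent, and the constants below solve the linear system.
    have e2 := e 2 (by norm_num)
    have e3 := e 3 (by norm_num)
    constructor
    · convert! U.smul_mem (9 / 10 : ℝ) (U.sub_mem e3 (U.smul_mem (8 / 3 : ℝ) e2)) using 1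
      module
    · convert! U.smul_mem (9 / 40 : ℝ) (U.sub_mem e3 (U.smul_mem (32 / 27 : ℝ) e2)) using 1
      module
  have hcomp : ∀ A ∈ U, s.p * A * s.p' ∈ s.up ∧ s.p' * A * s.p ∈ s.down := by
    intro A hA
    rw [hUS, ← hSq _ hadq] at hA
    exact ⟨up_component_mem hF.differentiableAt hu hA, down_component_mem hF.differentiableAt hu hA⟩
  -- At the frame `T q` the element `b` corresponds to a direction `v` of the leaf. The velocity of
  -- the section along `v` lies in `U` and has `b` as its component of weight `2`.
  have hup : ∀ b ∈ s.up, b ∈ U := by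
    intro b hb
    obtain ⟨-, h, e1, e2, e3, -⟩ := hadq
    obtain ⟨v, hv⟩ := (e3 b).1 hb
    obtain ⟨c, τ, h0, h1, h2, h3, h4, h5, h6⟩ :=
      exists_curve_of_section hu hT hsec v (isZero_zero (s := s))
    have key := conj_up_component hF.differentiableAt hu h1 h2 h3 h4 h5 h6 e1 e2
    rw [h0, ← hv, Units.mul_left_inj, Units.mul_right_inj, add_zero] at key
    rw [← key]
    exact (hgr _ ((hUS _).2 (by simpa using hmemq v 0 isZero_zero))).1
  have hdown : ∀ b ∈ s.down, b ∈ U := by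
    intro b hb
    obtain ⟨-, h, e1, e2, -, e4⟩ := hadq
    obtain ⟨v, hv⟩ := (e4 b).1 hb
    obtain ⟨c, τ, h0, h1, h2, h3, h4, h5, h6⟩ :=
      exists_curve_of_section hu hT hsec v (isZero_zero (s := s))
    have key := conj_up_component (s := s.swap) hF.differentiableAt hu h1 h2 h3 h4
      (h5.mono fun t ht => ht.swap) h6 e1 (s.commute_p' e2)
    simp only [swap_p, swap_p'] at key
    rw [h0, ← hv, Units.mul_left_inj, Units.mul_right_inj, add_zero] at key
    rw [← key]
    exact (hgr _ ((hUS _).2 (by simpa using hmemq v 0 isZero_zero))).2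
  -- Brackets of `A` with `up` and `down` stay in `U` and are purely of weight `±2`. The components
  -- of these weights of elements of `U` lie in `up` and `down`, so `A` normalizes both.
  have hzero' : ∀ A ∈ U, A * s.p = s.p * A → s.IsZero A := by
    intro A hA hp
    refine ⟨conformal_component_mem (F := F) (q := q) (T := T q) (by rwa [hSq _ hadq]), hp,
      fun b hb => ?_, fun b hb => ?_⟩
    · rw [← lie_up_component hp hb]
      exact (hcomp _ (hbr A hA b (hup b hb))).1
    · rw [← lie_up_component (s := s.swap) (s.commute_p' hp) hb]
      exact (hcomp _ (hbr A hA b (hdown b hb))).2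
  refine ⟨fun a ha b hb => hzero' _ (hbr a (hdown a ha) b (hup b hb)) (lie_down_up_commute ha hb),
    fun A => ⟨fun hA => ?_, ?_⟩⟩
  · obtain ⟨h1, h2⟩ := hgr A hA
    obtain ⟨h3, h4⟩ := hcomp A hA
    refine ⟨_, h4, s.p * A * s.p + s.p' * A * s.p', hzero' _ ?_ ?_, _, h3,
      s.eq_add_components A⟩
    · convert! U.sub_mem (U.sub_mem ((hUS A).2 hA) h1) h2 using 1
      conv_rhs => enter [1, 1]; rw [s.eq_add_components A]
      abel
    · simp only [add_mul, mul_add, mul_assoc, s.p_mul_p, s.mul_eq_zero', mul_zero, add_zero]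
      simp only [← mul_assoc, s.p_mul_p, s.mul_eq_zero, zero_mul, add_zero]
  · rintro ⟨d, hd, z, hz, u, hu, rfl⟩
    exact U.add_mem (U.add_mem (hdown d hd) (hzero z hz)) (hup u hu)

end AlgebraSymbol

end

noncomputable section

/-! ## The algebra symbol of a CR symbol -/

namespace CRSymbol

section Form

variable {W : Type*} [AddCommGroup W] [Module ℂ W] {r : ℕ} (g : CRSymbol W r)

lemma form_ext {a b : W} (h : ∀ y, g.form a y = g.form b y) : a = b := by
  rw [← sub_eq_zero]
  refine g.nondegenerate.1 _ fun y => ?_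
  rw [map_sub, LinearMap.sub_apply, h, sub_self]

/-- The projection to `𝔤_{-1,1}` along `𝔤_{-1,-1}`. -/
def posProj : Module.End ℂ W := g.pos.projection g.neg g.isCompl.symm

/-- The projection to `𝔤_{-1,-1}` along `𝔤_{-1,1}`. -/
def negProj : Module.End ℂ W := g.neg.projection g.pos g.isCompl

lemma posProj_mem (x : W) : g.posProj x ∈ g.pos := Submodule.projection_apply_mem _ _

lemma negProj_mem (x : W) : g.negProj x ∈ g.neg := Submodule.projection_apply_mem _ _

lemma posProj_add_negProj (x : W) : g.posProj x + g.negProj x = x :=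
  Submodule.projection_add_projection_eq_self _ _

lemma posProj_of_mem_pos {x : W} (hx : x ∈ g.pos) : g.posProj x = x :=
  Submodule.projection_apply_of_mem_left _ hx

lemma negProj_of_mem_neg {x : W} (hx : x ∈ g.neg) : g.negProj x = x :=
  Submodule.projection_apply_of_mem_left _ hx

lemma posProj_eq_zero_iff {x : W} : g.posProj x = 0 ↔ x ∈ g.neg :=
  Submodule.projection_apply_eq_zero_iff _

lemma negProj_eq_zero_iff {x : W} : g.negProj x = 0 ↔ x ∈ g.pos :=
  Submodule.projection_apply_eq_zero_iff _

/-- Both summands are isotropic, so the form only pairs `neg` with `pos`; the adjoint of one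
projection is therefore the other. -/
lemma form_posProj (x y : W) : g.form x (g.posProj y) = g.form (g.negProj x) y := by
  have h1 : g.form (g.posProj x) (g.posProj y) = 0 :=
    (g.pos_lagrangian _).1 (g.posProj_mem x) _ (g.posProj_mem y)
  have h2 : g.form (g.negProj x) (g.negProj y) = 0 :=
    (g.neg_lagrangian _).1 (g.negProj_mem x) _ (g.negProj_mem y)
  calc g.form x (g.posProj y) = g.form (g.posProj x + g.negProj x) (g.posProj y) := by
        rw [posProj_add_negProj]
    _ = g.form (g.negProj x) (g.posProj y + g.negProj y) := by
        rw [map_add, LinearMap.add_apply, map_add, h1, h2, zero_add, add_zero]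
    _ = _ := by rw [posProj_add_negProj]

lemma form_negProj (x y : W) : g.form x (g.negProj y) = g.form (g.posProj x) y := by
  have h1 : g.negProj y = y - g.posProj y := eq_sub_of_add_eq' (g.posProj_add_negProj y)
  have h2 : g.posProj x = x - g.negProj x := eq_sub_of_add_eq (g.posProj_add_negProj x)
  rw [h1, h2, map_sub, map_sub, LinearMap.sub_apply, form_posProj]

end Form

variable {W : Type*} [NormedAddCommGroup W] [NormedSpace ℂ W] [FiniteDimensional ℂ W] {r : ℕ}
  (g : CRSymbol W r)

/-- The adjunction of the symplectic form. -/
def adjunction : (W →L[ℂ] W) →ₗ[ℂ] (W →L[ℂ] W) where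
  toFun A := LinearMap.toContinuousLinearMap
    (g.form.leftAdjointOfNondegenerate g.nondegenerate (A : W →ₗ[ℂ] W))
  map_add' A B := by
    ext x
    refine g.form_ext fun y => ?_
    have h := fun C : W →L[ℂ] W => g.form.isAdjointPairLeftAdjointOfNondegenerate g.nondegenerate
      (C : W →ₗ[ℂ] W) x y
    simp only [add_apply, LinearMap.coe_toContinuousLinearMap', map_add, LinearMap.add_apply]
    erw [h, h, h]
    simp
  map_smul' c A := by
    ext x
    refine g.form_ext fun y => ?_
    have h := fun C : W →L[ℂ] W => g.form.isAdjointPairLeftAdjointOfNondegenerate g.nondegenerate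
      (C : W →ₗ[ℂ] W) x y
    simp only [LinearMap.coe_toContinuousLinearMap', map_smul, LinearMap.smul_apply,
      RingHom.id_apply, smul_apply]
    erw [h, h]
    simp

lemma form_adjunction (A : W →L[ℂ] W) (x y : W) :
    g.form (g.adjunction A x) y = g.form x (A y) :=
  g.form.isAdjointPairLeftAdjointOfNondegenerate g.nondegenerate (A : W →ₗ[ℂ] W) x y

lemma adjunction_eq_iff {A B : W →L[ℂ] W} :
    g.adjunction A = B ↔ ∀ x y, g.form (B x) y = g.form x (A y) := by
  refine ⟨fun h x y => by rw [← h, form_adjunction], fun h => ?_⟩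
  ext x
  exact g.form_ext fun y => by rw [form_adjunction, h]

/-- The endomorphisms of `W` as an algebra of continuous linear maps. -/
abbrev toCLM : Module.End ℂ W ≃ₐ[ℂ] (W →L[ℂ] W) := Module.End.toContinuousLinearMap W

lemma toCLM_apply (A : Module.End ℂ W) (x : W) : toCLM A x = A x := rfl

/-- The algebra symbol of a CR symbol. -/
@[simps]
def algebraSymbol : AlgebraSymbol (W →L[ℂ] W) where
  p := toCLM g.posProj
  p' := toCLM g.negProj
  add_eq_one := by ext x; exact g.posProj_add_negProj x
  mul_eq_zero := by ext x; exact g.posProj_eq_zero_iff.2 (g.negProj_mem x)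
  mul_eq_zero' := by ext x; exact g.negProj_eq_zero_iff.2 (g.posProj_mem x)
  ι := g.adjunction
  ι_mul A B := g.adjunction_eq_iff.2 fun x y => by
    simp only [mul_apply_eq_comp, form_adjunction]
  ι_one := g.adjunction_eq_iff.2 fun x y => rfl
  ι_p := g.adjunction_eq_iff.2 fun x y => (g.form_posProj x y).symm
  ι_p' := g.adjunction_eq_iff.2 fun x y => (g.form_negProj x y).symm
  up := g.up.map (toCLM (W := W)).toLinearMap
  down := g.down.map (toCLM (W := W)).toLinearMap
  up_mem := by
    rintro _ ⟨A, hA, rfl⟩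
    obtain ⟨h1, h2, -⟩ := g.up_mem A hA
    ext x
    change g.posProj (A (g.negProj x)) = A x
    rw [g.posProj_of_mem_pos (h2 _ (g.negProj_mem x))]
    conv_rhs => rw [← g.posProj_add_negProj x, map_add, h1 _ (g.posProj_mem x), zero_add]
  down_mem := by
    rintro _ ⟨A, hA, rfl⟩
    obtain ⟨h1, h2, -⟩ := g.down_mem A hA
    ext x
    change g.negProj (A (g.posProj x)) = A x
    rw [g.negProj_of_mem_neg (h2 _ (g.posProj_mem x))]
    conv_rhs => rw [← g.posProj_add_negProj x, map_add, h1 _ (g.negProj_mem x), add_zero]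
  ι_up := by
    rintro _ ⟨A, hA, rfl⟩
    refine g.adjunction_eq_iff.2 fun x y => ?_
    have := (g.up_mem A hA).2.2 x y
    change g.form (-(A x)) y = g.form x (A y)
    rw [map_neg, LinearMap.neg_apply]
    linear_combination -this
  ι_down := by
    rintro _ ⟨A, hA, rfl⟩
    refine g.adjunction_eq_iff.2 fun x y => ?_
    have := (g.down_mem A hA).2.2 x y
    change g.form (-(A x)) y = g.form x (A y)
    rw [map_neg, LinearMap.neg_apply]
    linear_combination -this

lemma toCLM_mem_up {A : Module.End ℂ W} : toCLM A ∈ g.algebraSymbol.up ↔ A ∈ g.up :=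
  Submodule.mem_map_equiv g.up (e := (toCLM (W := W)).toLinearEquiv)

lemma toCLM_mem_down {A : Module.End ℂ W} : toCLM A ∈ g.algebraSymbol.down ↔ A ∈ g.down :=
  Submodule.mem_map_equiv g.down (e := (toCLM (W := W)).toLinearEquiv)

lemma adjunction_mul_self_eq_smul_one_iff {T : W →L[ℂ] W} {c : ℂ} :
    g.adjunction T * T = c • 1 ↔ ∀ x y, g.form (T x) (T y) = c * g.form x y := by
  constructor
  · intro h x y
    rw [← form_adjunction]
    change g.form ((g.adjunction T * T) x) y = _
    rw [h]
    simp
  · intro h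
    ext x
    refine g.form_ext fun y => ?_
    rw [mul_apply_eq_comp, form_adjunction, h]
    simp

lemma commute_posProj_iff {A : W →L[ℂ] W} :
    A * toCLM g.posProj = toCLM g.posProj * A ↔
      (∀ x ∈ g.neg, A x ∈ g.neg) ∧ ∀ x ∈ g.pos, A x ∈ g.pos := by
  constructor
  · intro h
    have h' : ∀ x, A (g.posProj x) = g.posProj (A x) := fun x =>
      congrArg (fun B : W →L[ℂ] W => B x) h
    refine ⟨fun x hx => ?_, fun x hx => ?_⟩
    · rw [← g.posProj_eq_zero_iff, ← h', g.posProj_eq_zero_iff.2 hx, map_zero]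
    · rw [← g.posProj_of_mem_pos hx, h']
      exact g.posProj_mem _
  · rintro ⟨h1, h2⟩
    ext x
    change A (g.posProj x) = g.posProj (A x)
    conv_rhs => rw [← g.posProj_add_negProj x, map_add, map_add,
      g.posProj_of_mem_pos (h2 _ (g.posProj_mem x)),
      g.posProj_eq_zero_iff.2 (h1 _ (g.negProj_mem x)), add_zero]

lemma isZero_toCLM_iff {A : Module.End ℂ W} : g.algebraSymbol.IsZero (toCLM A) ↔ A ∈ g.zero := by
  have hcsp : (∃ c : ℂ, toCLM A + g.algebraSymbol.ι (toCLM A) = c • 1) ↔ IsCsp g.form A := by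
    refine exists_congr fun c => ⟨fun h x y => ?_, fun h => ?_⟩
    · have h1 := congrArg (fun B : W →L[ℂ] W => g.form (B x) y) h
      simpa [form_adjunction, toCLM_apply] using h1
    · ext x
      refine g.form_ext fun y => ?_
      simpa [form_adjunction, toCLM_apply] using h x y
  have hbr : ∀ B : Module.End ℂ W, toCLM A * toCLM B - toCLM B * toCLM A = toCLM ⁅A, B⁆ := by
    intro B
    rw [Ring.lie_def, map_sub, map_mul, map_mul]
  have hup : (∀ b ∈ g.algebraSymbol.up, toCLM A * b - b * toCLM A ∈ g.algebraSymbol.up) ↔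
      ∀ B ∈ g.up, ⁅A, B⁆ ∈ g.up := by
    refine ⟨fun h B hB => ?_, ?_⟩
    · rw [← toCLM_mem_up, ← hbr]
      exact h _ (g.toCLM_mem_up.2 hB)
    · rintro h _ ⟨B, hB, rfl⟩
      exact (hbr B).symm ▸ g.toCLM_mem_up.2 (h B hB)
  have hdown : (∀ b ∈ g.algebraSymbol.down, toCLM A * b - b * toCLM A ∈ g.algebraSymbol.down) ↔
      ∀ B ∈ g.down, ⁅A, B⁆ ∈ g.down := by
    refine ⟨fun h B hB => ?_, ?_⟩
    · rw [← toCLM_mem_down, ← hbr]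
      exact h _ (g.toCLM_mem_down.2 hB)
    · rintro h _ ⟨B, hB, rfl⟩
      exact (hbr B).symm ▸ g.toCLM_mem_down.2 (h B hB)
  have hp := g.commute_posProj_iff (A := toCLM A)
  rw [AlgebraSymbol.IsZero, hcsp, hup, hdown, algebraSymbol_p, hp, and_assoc]
  rfl

/-- Constancy of the velocities of adapted frames in the language of CR symbols. -/
theorem isRegular_and_eq_of_velocities_eq {E : Type*} [NormedAddCommGroup E] [NormedSpace ℝ E]
    {F : E → (W →L[ℂ] W)} {q : E} (hF : AnalyticAt ℝ F q) (hu : IsUnit (F q))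
    (hex : ∀ᶠ x in 𝓝 q, ∃ T, g.algebraSymbol.IsAdapted F x T) {S : Set (Module.End ℂ W)}
    (hS : ∀ᶠ x in 𝓝 q, ∀ T, g.algebraSymbol.IsAdapted F x T →
      ∀ A, toCLM A ∈ g.algebraSymbol.velocities F x T ↔ A ∈ S) :
    g.IsRegular ∧ S = g.degreeZero := by
  have : FiniteDimensional ℂ (W →L[ℂ] W) := (toCLM (W := W)).toLinearEquiv.finiteDimensional
  obtain ⟨h1, h2⟩ := AlgebraSymbol.regular_of_velocities_eq (s := g.algebraSymbol) hF hu hex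
    (S := toCLM '' S) (by
      filter_upwards [hS] with x hx T hT
      ext A
      obtain ⟨A, rfl⟩ := (toCLM (W := W)).surjective A
      rw [hx T hT, (toCLM (W := W)).injective.mem_set_image])
  refine ⟨fun A hA B hB => ?_, ?_⟩
  · rw [← isZero_toCLM_iff, Ring.lie_def, map_sub, map_mul, map_mul]
    exact h1 _ (g.toCLM_mem_down.2 hA) _ (g.toCLM_mem_up.2 hB)
  · ext A
    rw [← (toCLM (W := W)).injective.mem_set_image, h2, degreeZero, SetLike.mem_coe]
    simp only [Submodule.mem_sup]
    constructor
    · rintro ⟨_, ⟨d, hd, rfl⟩, z, hz, _, ⟨u, hu, rfl⟩, h⟩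
      obtain ⟨z, rfl⟩ := (toCLM (W := W)).surjective z
      refine ⟨d + z, ⟨d, hd, z, g.isZero_toCLM_iff.1 hz, rfl⟩, u, hu, ?_⟩
      exact (toCLM (W := W)).injective h.symm
    · rintro ⟨_, ⟨d, hd, z, hz, rfl⟩, u, hu, rfl⟩
      exact ⟨_, g.toCLM_mem_down.2 hd, _, g.isZero_toCLM_iff.2 hz, _, g.toCLM_mem_up.2 hu, rfl⟩

end CRSymbol

end

noncomputable section

/-! ## Charts of the fibres of a submersion and moving frames -/

/-- An analytic chart of the fibre of a holomorphic submersion. -/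
theorem exists_fibre_chart {X Y : Type*} [NormedAddCommGroup X] [NormedSpace ℂ X]
    [FiniteDimensional ℂ X] [NormedAddCommGroup Y] [NormedSpace ℂ Y] [CompleteSpace Y]
    {f : X → Y} {a : X} (hf : AnalyticAt ℂ f a) (hs : Function.Surjective (fderiv ℂ f a)) :
    ∃ (E : Submodule ℂ X) (φ : E → X) (κ : X → E), AnalyticAt ℝ φ 0 ∧ φ 0 = a ∧
      (∀ z, AnalyticAt ℝ κ z) ∧ κ a = 0 ∧ (∀ᶠ q in 𝓝 0, f (φ q) = f a ∧ κ (φ q) = q) ∧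
      ∀ᶠ z in 𝓝 a, f z = f a → φ (κ z) = z := by
  let E := LinearMap.ker (fderiv ℂ f a).toLinearMap
  have hE : ∀ u : E, fderiv ℂ f a u = 0 := fun u => u.2
  obtain ⟨E', hE'⟩ := Submodule.exists_isCompl E
  let P : X →L[ℂ] E := LinearMap.toContinuousLinearMap (E.projectionOnto E' hE')
  have hP : ∀ u : E, P u = u := fun u => Submodule.projectionOnto_apply_left hE' u
  have : CompleteSpace E := FiniteDimensional.complete ℂ E
  let κ : X → E := fun z => P z - P a
  have hκ : ∀ z, AnalyticAt ℂ κ z := fun z => (P.analyticAt z).sub analyticAt_const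
  -- The submersion is completed to a local diffeomorphism by a projection onto the kernel of its
  -- derivative. The fibre through `a` is then the slice `{f a} × E`.
  let Ψ : X → Y × E := fun z => (f z, κ z)
  have hΨ : AnalyticAt ℂ Ψ a := hf.prod (hκ a)
  have hΨd : HasFDerivAt Ψ ((fderiv ℂ f a).prod P) a :=
    hf.differentiableAt.hasFDerivAt.prodMk (P.hasFDerivAt.sub_const _)
  have hbij : Function.Bijective ((fderiv ℂ f a).prod P) := by
    constructor
    · rw [injective_iff_map_eq_zero]
      intro v hv
      obtain ⟨h1, h2⟩ := Prod.ext_iff.1 hv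
      have h3 : P v = ⟨v, h1⟩ := hP ⟨v, h1⟩
      rw [show P v = 0 from h2] at h3
      exact congrArg Subtype.val h3.symm
    · rintro ⟨y, u⟩
      obtain ⟨v, hv⟩ := hs y
      refine ⟨v - P v + u, Prod.ext ?_ ?_⟩
      · simp [hv, hE]
      · simp [hP]
  obtain ⟨e, he, hea, hes⟩ := hΨ.exists_openPartialHomeomorph_of_bijective hΨd hbij
  have hκa : κ a = 0 := sub_self _
  have hΨa : Ψ a = (f a, 0) := by simp only [Ψ, hκa]
  rw [hΨa] at hes
  have hcont : ContinuousAt (fun q : E => (f a, q)) 0 := by fun_prop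
  refine ⟨E, fun q => e.symm (f a, q), κ, ?_, ?_, fun z => (hκ z).restrictScalars, hκa, ?_, ?_⟩
  · exact hes.restrictScalars.comp₂ (h := fun y : Y × E => e.symm y) analyticAt_const analyticAt_id
  · change e.symm (f a, 0) = a
    rw [← hΨa, ← he, e.left_inv hea]
  · have ht : (f a, (0 : E)) ∈ e.target := by
      rw [← hΨa, ← he]; exact e.map_source hea
    filter_upwards [hcont.eventually (e.open_target.eventually_mem ht)] with q hq
    have := e.right_inv hq
    rw [he] at this
    exact Prod.ext_iff.1 this
  · filter_upwards [e.open_source.eventually_mem hea] with z hz hfz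
    rw [← hfz]
    change e.symm (Ψ z) = z
    rw [← he, e.left_inv hz]

/-- The complex conjugate of a span. -/
lemma conjSub_span {d : ℕ} {ι : Type*} (v : ι → Fin d → ℂ) :
    conjSub (Submodule.span ℂ (range v)) = Submodule.span ℂ (range fun i => star (v i)) := by
  have key : ∀ w : ι → Fin d → ℂ, Submodule.span ℂ (range fun i => star (w i)) ≤
      conjSub (Submodule.span ℂ (range w)) := by
    intro w
    refine Submodule.span_le.2 ?_
    rintro _ ⟨i, rfl⟩
    change star (star (w i)) ∈ Submodule.span ℂ (range w)
    rw [star_star]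
    exact Submodule.subset_span ⟨i, rfl⟩
  refine le_antisymm (fun z hz => ?_) (key v)
  have h := key (fun i => star (v i))
  simp only [star_star] at h
  have h2 : star (star z) ∈ Submodule.span ℂ (range fun i => star (v i)) := h hz
  rwa [star_star] at h2

/-- A field of subspaces which is spanned near `z` by real analytic vector fields. -/
def IsAnalyticallySpanned {X Y : Type*} [NormedAddCommGroup X] [NormedSpace ℝ X]
    [NormedAddCommGroup Y] [NormedSpace ℂ Y] (D : X → Submodule ℂ Y) (z : X) : Prop :=
  ∃ (m : ℕ) (e : Fin m → X → Y), (∀ i, AnalyticAt ℝ (e i) z) ∧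
    ∀ᶠ y in 𝓝 z, Submodule.span ℂ (range fun i => e i y) = D y

/-- A linear map into the value at `z` of an analytically spanned field of subspaces extends to an
analytic family of linear maps into the field. -/
lemma IsAnalyticallySpanned.exists_family {X Y : Type*} [NormedAddCommGroup X] [NormedSpace ℝ X]
    [NormedAddCommGroup Y] [NormedSpace ℂ Y] {D : X → Submodule ℂ Y} {z : X}
    (hD : IsAnalyticallySpanned D z) {W : Type*} [AddCommGroup W] [Module ℂ W]
    (T : W →ₗ[ℂ] Y) (hT : ∀ w, T w ∈ D z) :
    ∃ G : X → W →ₗ[ℂ] Y, G z = T ∧ (∀ w, AnalyticAt ℝ (fun y => G y w) z) ∧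
      (∀ w, T w = 0 → ∀ y, G y w = 0) ∧ ∀ᶠ y in 𝓝 z, ∀ w, G y w ∈ D y := by
  obtain ⟨m, e, he, hspan⟩ := hD
  let L : X → (Fin m → ℂ) →ₗ[ℂ] Y := fun y => Fintype.linearCombination ℂ fun i => e i y
  have hL : ∀ y, LinearMap.range (L y) = Submodule.span ℂ (range fun i => e i y) := fun y =>
    Fintype.range_linearCombination ℂ _
  have hTr : ∀ w, T w ∈ LinearMap.range (L z) := by
    intro w; rw [hL, hspan.self_of_nhds]; exact hT w
  -- Coefficients with respect to the spanning fields are chosen linearly at `z` and then kept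
  -- constant, so the family vanishes wherever `T` does.
  obtain ⟨R, hR⟩ := (L z).rangeRestrict.exists_rightInverse_of_surjective
    (LinearMap.range_rangeRestrict _)
  let c : W →ₗ[ℂ] (Fin m → ℂ) := R ∘ₗ (T.codRestrict _ hTr)
  have hc : ∀ w, L z (c w) = T w := by
    intro w
    have := congrArg (fun f => ((f (T.codRestrict _ hTr w) : LinearMap.range (L z)) : Y)) hR
    exact this
  refine ⟨fun y => L y ∘ₗ c, LinearMap.ext hc, fun w => ?_, fun w hw y => ?_, ?_⟩
  · have : (fun y => (L y ∘ₗ c) w) = fun y => ∑ i, c w i • e i y := by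
      ext y
      simp [L, Fintype.linearCombination_apply]
    rw [this]
    exact Finset.analyticAt_fun_sum _ fun i _ => (he i).fun_const_smul
  · have : T.codRestrict _ hTr w = 0 := Subtype.ext hw
    simp [c, this]
  · filter_upwards [hspan] with y hy w
    rw [← hy, ← hL]
    exact ⟨_, rfl⟩

/-- A family of operators on a finite dimensional space is analytic if it is so pointwise. -/
lemma analyticAt_clm_of_apply {X W : Type*} [NormedAddCommGroup X] [NormedSpace ℝ X]
    [NormedAddCommGroup W] [NormedSpace ℂ W] [FiniteDimensional ℂ W] {F : X → W →L[ℂ] W} {x : X}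
    (h : ∀ w, AnalyticAt ℝ (fun y => F y w) x) : AnalyticAt ℝ F x := by
  let b := Module.finBasis ℂ W
  let Λ : (Fin (Module.finrank ℂ W) → W) →ₗ[ℂ] (W →L[ℂ] W) :=
    LinearMap.toContinuousLinearMap.toLinearMap ∘ₗ (b.constr ℂ).toLinearMap
  have hF : F = fun y => Λ fun i => F y (b i) := by
    ext1 y
    refine ContinuousLinearMap.coe_injective (b.ext fun i => ?_)
    simp [Λ]
  rw [hF]
  have h2 : AnalyticAt ℝ (fun y i => F y (b i)) x := analyticAt_pi_iff.2 fun i => h (b i)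
  exact ((LinearMap.toContinuousLinearMap Λ).analyticAt _).restrictScalars.fun_comp h2

lemma contDiffAt_clm_of_apply {W : Type*}
    [NormedAddCommGroup W] [NormedSpace ℂ W] [FiniteDimensional ℂ W] {F : ℝ → W →L[ℂ] W} {x : ℝ}
    (h : ∀ w, ContDiffAt ℝ ∞ (fun y => F y w) x) : ContDiffAt ℝ ∞ F x := by
  let b := Module.finBasis ℂ W
  let Λ : (Fin (Module.finrank ℂ W) → W) →ₗ[ℂ] (W →L[ℂ] W) :=
    LinearMap.toContinuousLinearMap.toLinearMap ∘ₗ (b.constr ℂ).toLinearMap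
  have hF : F = fun y => Λ fun i => F y (b i) := by
    ext1 y
    refine ContinuousLinearMap.coe_injective (b.ext fun i => ?_)
    simp [Λ]
  rw [hF]
  have h2 : ContDiffAt ℝ ∞ (fun y i => F y (b i)) x := contDiffAt_pi.2 fun i => h (b i)
  exact ((LinearMap.toContinuousLinearMap Λ).restrictScalars ℝ).contDiff.contDiffAt.comp x h2

namespace LeviComplexification

variable {n r k : ℕ} {Ω : Set (Fin (2 * n + 1) → ℝ)}
  {H₀ : (Fin (2 * n + 1) → ℝ) → Submodule ℂ (Fin (2 * n + 1) → ℂ)}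
  (C : LeviComplexification Ω H₀ r k)

lemma isAnalyticallySpanned_map {H : (Fin (2 * n + 1) → ℂ) → Submodule ℂ (Fin (2 * n + 1) → ℂ)}
    {z : Fin (2 * n + 1) → ℂ} (hz : z ∈ C.U) (hH : IsAnalyticallySpanned H z) :
    IsAnalyticallySpanned (fun y => (H y).map (fderiv ℂ C.π y).toLinearMap) z := by
  obtain ⟨m, e, he, hspan⟩ := hH
  refine ⟨m, fun i y => fderiv ℂ C.π y (e i y), fun i => ?_, ?_⟩
  · have h1 : (fun y => fderiv ℂ C.π y (e i y)) =
        fun y => ∑ j, e i y j • fderiv ℂ C.π y (Pi.single j 1) := by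
      ext1 y
      conv_lhs => rw [pi_eq_sum_univ' (e i y)]
      simp [map_sum, map_smul]
    change AnalyticAt ℝ (fun y => fderiv ℂ C.π y (e i y)) z
    rw [h1]
    refine Finset.analyticAt_fun_sum _ fun j _ => ?_
    have h2 : AnalyticAt ℝ (fun y => e i y j) z := analyticAt_pi_iff.1 (he i) j
    have h3 : AnalyticAt ℂ (fun y => fderiv ℂ C.π y (Pi.single j 1)) z :=
      ((ContinuousLinearMap.apply ℂ (Fin k → ℂ)
        (Pi.single j (1 : ℂ) : Fin (2 * n + 1) → ℂ)).analyticAt _).fun_comp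
        (C.holomorphic_π z hz).fderiv
    exact h2.fun_smul h3.restrictScalars
  · filter_upwards [hspan] with y hy
    rw [← hy, Submodule.map_span, ← range_comp]
    rfl

lemma isAnalyticallySpanned_posAt {z : Fin (2 * n + 1) → ℂ} (hz : z ∈ C.U) :
    IsAnalyticallySpanned C.posAt z := by
  obtain ⟨X, hX, hs⟩ := C.holomorphic_H z hz
  exact C.isAnalyticallySpanned_map hz
    ⟨n, X, fun i => (hX i).restrictScalars, hs.mono fun y hy => hy.2⟩

/-- The fields spanning the conjugate distribution are `star (X i (star y))`. Conjugation is only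
real linear, so each step is checked for real analyticity. -/
lemma isAnalyticallySpanned_negAt {z : Fin (2 * n + 1) → ℂ} (hz : z ∈ C.U) :
    IsAnalyticallySpanned C.negAt z := by
  obtain ⟨X, hX, hs⟩ := C.holomorphic_H (star z) (C.star_mem z hz)
  let st : ∀ m : ℕ, (Fin m → ℂ) →L[ℝ] (Fin m → ℂ) := fun m =>
    ((starL' ℝ : (Fin m → ℂ) ≃L[ℝ] (Fin m → ℂ)) : (Fin m → ℂ) →L[ℝ] (Fin m → ℂ))
  refine C.isAnalyticallySpanned_map hz (H := conjDist C.H)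
    ⟨n, fun i y => star (X i (star y)), fun i => ?_, ?_⟩
  · have h1 : AnalyticAt ℝ (fun y => X i (star y)) z :=
      AnalyticAt.fun_comp (f := fun y => star y) (hX i).restrictScalars ((st _).analyticAt z)
    exact ((st _).analyticAt _).fun_comp h1
  · have : Tendsto (fun y : Fin (2 * n + 1) → ℂ => star y) (𝓝 z) (𝓝 (star z)) :=
      (st _).continuous.tendsto z
    filter_upwards [this.eventually hs] with y hy
    rw [← conjSub_span, hy.2]
    rfl

end LeviComplexification

end

/-! ### Moving frames along a leaf and the velocities of the splitting. -/

noncomputable section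

/-- A moving frame for two complementary fields of subspaces `N`, `P` along `φ`, spanned at the
origin by the images of two complementary subspaces under `T₀`. -/
lemma exists_moving_frame {E X Y W : Type*} [NormedAddCommGroup E] [NormedSpace ℝ E]
    [NormedAddCommGroup X] [NormedSpace ℝ X] [NormedAddCommGroup Y] [NormedSpace ℂ Y]
    [FiniteDimensional ℂ Y] [NormedAddCommGroup W] [NormedSpace ℂ W] [FiniteDimensional ℂ W] {r : ℕ}
    (g : CRSymbol W r) {N P : X → Submodule ℂ Y} {φ : E → X} (hφ : AnalyticAt ℝ φ 0)
    (hN : IsAnalyticallySpanned N (φ 0)) (hP : IsAnalyticallySpanned P (φ 0)) {T₀ : W →ₗ[ℂ] Y}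
    (hT₀ : Function.Injective T₀) (hN0 : ∀ w ∈ g.neg, T₀ w ∈ N (φ 0))
    (hP0 : ∀ w ∈ g.pos, T₀ w ∈ P (φ 0))
    (hr : ∀ᶠ q in 𝓝 0, N (φ q) ≤ LinearMap.range T₀ ∧ P (φ q) ≤ LinearMap.range T₀)
    (hd : ∀ᶠ q in 𝓝 0, Module.finrank ℂ (N (φ q)) = Module.finrank ℂ g.neg ∧
      Module.finrank ℂ (P (φ q)) = Module.finrank ℂ g.pos) :
    ∃ F : E → (W →L[ℂ] W), AnalyticAt ℝ F 0 ∧ F 0 = 1 ∧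
      (∀ᶠ q in 𝓝 0, ∀ w, T₀ (F q w) ∈ N (φ q) ↔ w ∈ g.neg) ∧
      ∀ᶠ q in 𝓝 0, ∀ w, T₀ (F q w) ∈ P (φ q) ↔ w ∈ g.pos := by
  obtain ⟨L₀, hL₀⟩ := LinearMap.exists_leftInverse_of_injective T₀ (LinearMap.ker_eq_bot.2 hT₀)
  have hL : ∀ w, L₀ (T₀ w) = w := fun w => congrArg (fun f : W →ₗ[ℂ] W => f w) hL₀
  obtain ⟨G, hG0, hGa, hGk, hGm⟩ := hN.exists_family (T₀ ∘ₗ g.negProj)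
    fun w => hN0 _ (g.negProj_mem w)
  obtain ⟨G', hG'0, hG'a, hG'k, hG'm⟩ := hP.exists_family (T₀ ∘ₗ g.posProj)
    fun w => hP0 _ (g.posProj_mem w)
  -- The extensions from `neg` and from `pos` are added and read off through the left inverse of
  -- `T₀`. Since `F 0 = 1`, nearby values are invertible.
  let F : E → (W →L[ℂ] W) := fun q => CRSymbol.toCLM (L₀ ∘ₗ (G (φ q) + G' (φ q)))
  have hF : ∀ q w, F q w = L₀ (G (φ q) w + G' (φ q) w) := fun q w => rfl
  have hF0 : F 0 = 1 := by
    ext w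
    rw [hF, hG0, hG'0]
    change L₀ (T₀ (g.negProj w) + T₀ (g.posProj w)) = w
    rw [← map_add, hL, add_comm, g.posProj_add_negProj]
  have hFa : AnalyticAt ℝ F 0 := by
    refine analyticAt_clm_of_apply fun w => ?_
    have h1 := ((hGa w).fun_comp hφ).add ((hG'a w).fun_comp hφ)
    exact ((LinearMap.toContinuousLinearMap L₀).analyticAt _).restrictScalars.fun_comp h1
  have : FiniteDimensional ℂ (W →L[ℂ] W) :=
    (CRSymbol.toCLM (W := W)).toLinearEquiv.finiteDimensional
  have hunit := AlgebraSymbol.eventually_isUnit_comp hFa.continuousAt (by rw [hF0]; exact isUnit_one)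
  -- Equality of dimensions turns the inclusion of the image of `V` in `D` into an equality, hence
  -- into an equivalence for vectors.
  have key : ∀ (D : Submodule ℂ Y) (V : Submodule ℂ W) (A : W →L[ℂ] W), IsUnit A →
      D ≤ LinearMap.range T₀ → Module.finrank ℂ D = Module.finrank ℂ V →
      (∀ w ∈ V, T₀ (A w) ∈ D) → ∀ w, T₀ (A w) ∈ D ↔ w ∈ V := by
    rintro D V _ ⟨A, rfl⟩ hD hf hV w
    refine ⟨fun hw => ?_, hV w⟩
    have hinj : Function.Injective (A : W →L[ℂ] W) := fun x y hxy => by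
      have := congrArg (fun z => (↑A⁻¹ : W →L[ℂ] W) z) hxy
      simpa [← mul_apply_eq_comp] using this
    have hle : V.map (A : W →L[ℂ] W).toLinearMap ≤ D.comap T₀ := by
      rintro _ ⟨v, hv, rfl⟩
      exact hV v hv
    have heq := Submodule.eq_of_le_of_finrank_eq hle (by
      rw [← LinearEquiv.finrank_eq (Submodule.equivMapOfInjective
          (A : W →L[ℂ] W).toLinearMap hinj V), ← hf,
        LinearEquiv.finrank_eq (Submodule.equivMapOfInjective T₀ hT₀ (D.comap T₀)),
        Submodule.map_comap_eq_of_le hD])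
    obtain ⟨v, hv, hvw⟩ : (A : W →L[ℂ] W) w ∈ V.map (A : W →L[ℂ] W).toLinearMap := by
      rw [heq]; exact hw
    rwa [← hinj hvw]
  have hT₀L : ∀ y ∈ LinearMap.range T₀, T₀ (L₀ y) = y := by
    rintro _ ⟨w, rfl⟩
    rw [hL]
  refine ⟨F, hFa, hF0, ?_, ?_⟩
  · filter_upwards [hunit, hr, hd, hφ.continuousAt.eventually hGm] with q h1 h2 h3 h4
    refine key _ _ _ h1 h2.1 h3.1 fun w hw => ?_
    rw [hF, hG'k w (by simp [g.posProj_eq_zero_iff.2 hw]), add_zero, hT₀L _ (h2.1 (h4 w))]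
    exact h4 w
  · filter_upwards [hunit, hr, hd, hφ.continuousAt.eventually hG'm] with q h1 h2 h3 h4
    refine key _ _ _ h1 h2.2 h3.2 fun w hw => ?_
    rw [hF, hGk w (by simp [g.negProj_eq_zero_iff.2 hw]), zero_add, hT₀L _ (h2.2 (h4 w))]
    exact h4 w

namespace LeviComplexification

variable {n r k : ℕ} {Ω : Set (Fin (2 * n + 1) → ℝ)}
  {H₀ : (Fin (2 * n + 1) → ℝ) → Submodule ℂ (Fin (2 * n + 1) → ℂ)}
  (C : LeviComplexification Ω H₀ r k)

section MovingFrame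

variable {W : Type*} [NormedAddCommGroup W] [NormedSpace ℂ W]
  {E : Type*} [NormedAddCommGroup E] [NormedSpace ℝ E]

/-- `A` is, in the frame `T`, the velocity of the subspaces `N` along a curve in the leaf of `z`,
extended by zero to `P`. -/
def MovesBy (N P : (Fin (2 * n + 1) → ℂ) → Submodule ℂ (Fin k → ℂ)) (z : Fin (2 * n + 1) → ℂ)
    {W : Type*} [AddCommGroup W] [Module ℂ W] (T : W →ₗ[ℂ] (Fin k → ℂ)) (A : Module.End ℂ W) :
    Prop :=
  (∀ x, T x ∈ P z → A x = 0) ∧ (∀ x, T x ∈ N z → T (A x) ∈ P z) ∧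
    ∃ c, C.IsLeafCurve z c ∧ ∀ x : ℝ → (Fin k → ℂ), ContDiffAt ℝ ∞ x 0 →
      (∀ᶠ t in 𝓝 0, x t ∈ N (c t)) → ∀ w, T w = x 0 → deriv x 0 - T (A w) ∈ N (c 0)

/-- Near `q` the map `φ` is a chart of a leaf with inverse `κ`, and `T₀ ∘ F` carries the splitting of
`W` defined by `s` to the fields of subspaces `N`, `P`. -/
structure IsMovingFrame (s : AlgebraSymbol (W →L[ℂ] W)) (T₀ : W →ₗ[ℂ] (Fin k → ℂ))
    (N P : (Fin (2 * n + 1) → ℂ) → Submodule ℂ (Fin k → ℂ)) (φ : E → (Fin (2 * n + 1) → ℂ))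
    (κ : (Fin (2 * n + 1) → ℂ) → E) (F : E → (W →L[ℂ] W)) (q : E) : Prop where
  injective : Function.Injective T₀
  analyticAt_F : AnalyticAt ℝ F q
  isUnit_F : IsUnit (F q)
  analyticAt_φ : AnalyticAt ℝ φ q
  analyticAt_κ : ∀ z, AnalyticAt ℝ κ z
  chart : ∀ᶠ x in 𝓝 q, φ x ∈ C.U ∧ C.π (φ x) = C.π (φ q) ∧ κ (φ x) = x
  chart_inv : ∀ᶠ z in 𝓝 (φ q), C.π z = C.π (φ q) → φ (κ z) = z
  mem_N : ∀ᶠ x in 𝓝 q, ∀ w, T₀ (F x w) ∈ N (φ x) ↔ s.p w = 0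
  mem_P : ∀ᶠ x in 𝓝 q, ∀ w, T₀ (F x w) ∈ P (φ x) ↔ s.p' w = 0
  le_range : ∀ᶠ x in 𝓝 q, N (φ x) ≤ LinearMap.range T₀ ∧ P (φ x) ≤ LinearMap.range T₀

variable {C} {s : AlgebraSymbol (W →L[ℂ] W)} {T₀ : W →ₗ[ℂ] (Fin k → ℂ)}
    {N P : (Fin (2 * n + 1) → ℂ) → Submodule ℂ (Fin k → ℂ)} {φ : E → (Fin (2 * n + 1) → ℂ)}
    {κ : (Fin (2 * n + 1) → ℂ) → E} {F : E → (W →L[ℂ] W)} {q : E}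

lemma IsMovingFrame.swap (h : C.IsMovingFrame s T₀ N P φ κ F q) :
    C.IsMovingFrame s.swap T₀ P N φ κ F q :=
  { h with
    mem_N := h.mem_P
    mem_P := h.mem_N
    le_range := h.le_range.mono fun _ hx => hx.symm }

lemma evalCLM_hasDerivAt {f : ℝ → W →L[ℂ] W} {f' : W →L[ℂ] W} {y : ℝ → W} {y' : W} {t : ℝ}
    (hf : HasDerivAt f f' t) (hy : HasDerivAt y y' t) :
    HasDerivAt (fun u => f u (y u)) (f' (y t) + f t y') t := by
  have h := (ContinuousLinearMap.restrictScalarsL ℂ W W ℝ ℝ).hasFDerivAt.comp_hasDerivAt t hf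
  exact h.clm_apply hy

lemma evalCLM_contDiffAt {f : ℝ → W →L[ℂ] W} {y : ℝ → W} {t : ℝ}
    (hf : ContDiffAt ℝ ∞ f t) (hy : ContDiffAt ℝ ∞ y t) :
    ContDiffAt ℝ ∞ (fun u => f u (y u)) t := by
  have h := (ContinuousLinearMap.restrictScalarsL ℂ W W ℝ ℝ).contDiff.contDiffAt.comp t hf
  exact h.clm_apply hy

variable [FiniteDimensional ℂ W]

/-- Needed because a curve of adapted frames passes through neighbouring points of the leaf. -/
lemma IsMovingFrame.eventually (h : C.IsMovingFrame s T₀ N P φ κ F q) :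
    ∀ᶠ x in 𝓝 q, C.IsMovingFrame s T₀ N P φ κ F x := by
  have : FiniteDimensional ℂ (W →L[ℂ] W) :=
    (CRSymbol.toCLM (W := W)).toLinearEquiv.finiteDimensional
  filter_upwards [h.analyticAt_F.eventually_analyticAt,
    AlgebraSymbol.eventually_isUnit_comp h.analyticAt_F.continuousAt h.isUnit_F,
    h.analyticAt_φ.eventually_analyticAt, h.chart.eventually_nhds,
    h.analyticAt_φ.continuousAt.eventually h.chart_inv.eventually_nhds,
    h.mem_N.eventually_nhds, h.mem_P.eventually_nhds, h.le_range.eventually_nhds] with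
    x h1 h2 h3 h4 h5 h6 h7 h8
  have hx := h4.self_of_nhds.2.1
  exact ⟨h.injective, h1, h2, h3, h.analyticAt_κ,
    h4.mono fun y hy => ⟨hy.1, hy.2.1.trans hx.symm, hy.2.2⟩,
    h5.mono fun z hz hz' => hz (hz'.trans hx), h6, h7, h8⟩

/-- The velocities of the field `N` along the leaf, in terms of the moving frame. -/
theorem IsMovingFrame.movesBy_iff [CompleteSpace E] (h : C.IsMovingFrame s T₀ N P φ κ F q) {u : (W →L[ℂ] W)ˣ}
    (hu : (u : W →L[ℂ] W) * s.p = s.p * u) {T : W →ₗ[ℂ] (Fin k → ℂ)}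
    (hT : ∀ w, T w = T₀ (F q ((u : W →L[ℂ] W) w))) (A : Module.End ℂ W) :
    C.MovesBy N P (φ q) T A ↔ ∃ v, (u : W →L[ℂ] W) * CRSymbol.toCLM A * ↑u⁻¹ =
      s.p * AlgebraSymbol.logDeriv F q v * s.p' := by
  have : FiniteDimensional ℂ (W →L[ℂ] W) :=
    (CRSymbol.toCLM (W := W)).toLinearEquiv.finiteDimensional
  have hup : ∀ w, s.p ((u : W →L[ℂ] W) w) = (u : W →L[ℂ] W) (s.p w) := fun w =>
    congrArg (fun B : W →L[ℂ] W => B w) hu.symm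
  have hup' : ∀ w, s.p' ((u : W →L[ℂ] W) w) = (u : W →L[ℂ] W) (s.p' w) := fun w =>
    congrArg (fun B : W →L[ℂ] W => B w) (s.commute_p' hu).symm
  have hpp' : ∀ w, s.p (s.p' w) = 0 := fun w => congrArg (fun B : W →L[ℂ] W => B w) s.mul_eq_zero
  have hp'p : ∀ w, s.p' (s.p w) = 0 := fun w => congrArg (fun B : W →L[ℂ] W => B w) s.mul_eq_zero'
  have hpp : ∀ w, s.p (s.p w) = s.p w := fun w => congrArg (fun B : W →L[ℂ] W => B w) s.p_mul_p
  have hadd : ∀ w, s.p w + s.p' w = w := fun w => congrArg (fun B : W →L[ℂ] W => B w) s.add_eq_one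
  have huinj : ∀ w, (u : W →L[ℂ] W) w = 0 → w = 0 := fun w hw => by
    have := congrArg (fun z => (↑u⁻¹ : W →L[ℂ] W) z) hw
    simpa [← mul_apply_eq_comp] using this
  have hFinv : ∀ w, F q (Ring.inverse (F q) w) = w := fun w =>
    congrArg (fun B : W →L[ℂ] W => B w) (Ring.mul_inverse_cancel _ h.isUnit_F)
  have hFinv' : ∀ w, Ring.inverse (F q) (F q w) = w := fun w =>
    congrArg (fun B : W →L[ℂ] W => B w) (Ring.inverse_mul_cancel _ h.isUnit_F)
  have hθ : ∀ v w, F q (AlgebraSymbol.logDeriv F q v w) = fderiv ℝ F q v w := fun v w => hFinv _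
  have hN := h.mem_N.self_of_nhds
  have hP := h.mem_P.self_of_nhds
  let T₀c : W →L[ℝ] (Fin k → ℂ) := (LinearMap.toContinuousLinearMap T₀).restrictScalars ℝ
  have hT₀c : ∀ w, T₀c w = T₀ w := fun w => rfl
  constructor
  · rintro ⟨h1, h2, c, ⟨c0, csm, cleaf⟩, hc⟩
    let c' : ℝ → E := fun t => κ (c t)
    have hc'0 : c' 0 = q := by
      simp only [c', c0]
      exact h.chart.self_of_nhds.2.2
    have hc's : ContDiffAt ℝ ∞ c' 0 := (h.analyticAt_κ _).contDiffAt.comp (0 : ℝ) csm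
    have dc' : HasDerivAt c' (deriv c' 0) 0 := (hc's.differentiableAt (by simp)).hasDerivAt
    have hct : Tendsto c (𝓝 0) (𝓝 (φ q)) := c0 ▸ csm.continuousAt.tendsto
    have hc't : Tendsto c' (𝓝 0) (𝓝 q) := hc'0 ▸ hc's.continuousAt.tendsto
    have hφc : ∀ᶠ t in 𝓝 0, φ (c' t) = c t := by
      filter_upwards [cleaf, hct.eventually h.chart_inv] with t k1 k2 using k2 k1.2
    have dF : HasDerivAt (fun t => F (c' t)) (fderiv ℝ F q (deriv c' 0)) 0 := by
      have : HasFDerivAt F (fderiv ℝ F q) (c' 0) := by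
        rw [hc'0]; exact h.analyticAt_F.differentiableAt.hasFDerivAt
      exact this.comp_hasDerivAt (0 : ℝ) dc'
    have sF : ContDiffAt ℝ ∞ (fun t => F (c' t)) 0 := by
      have : ContDiffAt ℝ ∞ F (c' 0) := by rw [hc'0]; exact h.analyticAt_F.contDiffAt
      exact this.comp (0 : ℝ) hc's
    -- The test curve is the fixed vector `u w` carried by the moving frame, which stays in `N`.
    -- Modulo `N` only the `p`-component of its derivative survives.
    have main : ∀ w, s.p w = 0 → s.p (AlgebraSymbol.logDeriv F q (deriv c' 0)
        ((u : W →L[ℂ] W) w)) = s.p ((u : W →L[ℂ] W) (A w)) := by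
      intro w hw
      have hm := hc (fun t => T₀c (F (c' t) ((u : W →L[ℂ] W) w)))
        (T₀c.contDiff.contDiffAt.comp (0 : ℝ) (evalCLM_contDiffAt sF contDiffAt_const)) (by
          filter_upwards [hφc, hc't.eventually h.mem_N] with t k1 k2
          rw [hT₀c, ← k1, k2, hup, hw, map_zero]) w (by rw [hT, hT₀c, hc'0])
      have hd := T₀c.hasFDerivAt.comp_hasDerivAt (0 : ℝ)
        (evalCLM_hasDerivAt dF (hasDerivAt_const (0 : ℝ) ((u : W →L[ℂ] W) w)))
      have hd' : deriv (fun t => T₀c (F (c' t) ((u : W →L[ℂ] W) w))) 0 = _ := hd.deriv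
      rw [hd', hT₀c, map_zero, add_zero, hT, c0, ← hθ, ← map_sub, ← map_sub, hN, map_sub,
        sub_eq_zero] at hm
      exact hm
    refine ⟨deriv c' 0, ?_⟩
    rw [Units.mul_inv_eq_iff_eq_mul]
    ext w
    change (u : W →L[ℂ] W) (A w) =
      s.p (AlgebraSymbol.logDeriv F q (deriv c' 0) (s.p' ((u : W →L[ℂ] W) w)))
    have k1 : A (s.p w) = 0 := h1 _ (by rw [hT, hP, hup', hp'p, map_zero])
    have k2 : A w = A (s.p' w) := by
      conv_lhs => rw [← hadd w, map_add, k1, zero_add]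
    have k3 : s.p' ((u : W →L[ℂ] W) (A (s.p' w))) = 0 := by
      rw [← hP, ← hT]
      exact h2 _ (by rw [hT, hN, hup, hpp', map_zero])
    rw [hup', main _ (hpp' w), k2]
    conv_lhs => rw [← hadd ((u : W →L[ℂ] W) (A (s.p' w))), k3, add_zero]
  · rintro ⟨v, hv⟩
    rw [Units.mul_inv_eq_iff_eq_mul] at hv
    have hA : ∀ w, (u : W →L[ℂ] W) (A w) =
        s.p (AlgebraSymbol.logDeriv F q v (s.p' ((u : W →L[ℂ] W) w))) := fun w =>
      congrArg (fun B : W →L[ℂ] W => B w) hv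
    obtain ⟨L₀, hL₀⟩ := LinearMap.exists_leftInverse_of_injective T₀
      (LinearMap.ker_eq_bot.2 h.injective)
    have hL : ∀ w, L₀ (T₀ w) = w := fun w => congrArg (fun f : W →ₗ[ℂ] W => f w) hL₀
    let L₀c : (Fin k → ℂ) →L[ℝ] W := (LinearMap.toContinuousLinearMap L₀).restrictScalars ℝ
    -- The required curve in the leaf is a straight line in the chart.
    have hd : HasDerivAt (fun t : ℝ => q + t • v) v 0 := by
      simpa using ((hasDerivAt_id (0 : ℝ)).smul_const v).const_add q
    have hc : ContDiffAt ℝ ∞ (fun t : ℝ => q + t • v) 0 := by fun_prop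
    have hq0 : q + (0 : ℝ) • v = q := by simp
    have hct : Tendsto (fun t : ℝ => q + t • v) (𝓝 0) (𝓝 q) := by
      simpa using hc.continuousAt.tendsto
    have dF : HasDerivAt (fun t : ℝ => F (q + t • v)) (fderiv ℝ F q v) 0 := by
      have : HasFDerivAt F (fderiv ℝ F q) (q + (0 : ℝ) • v) := by
        rw [hq0]; exact h.analyticAt_F.differentiableAt.hasFDerivAt
      exact this.comp_hasDerivAt (0 : ℝ) hd
    refine ⟨fun x hx => ?_, fun x hx => ?_, fun t => φ (q + t • v), ⟨by simp, ?_, ?_⟩, ?_⟩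
    · rw [hT, hP] at hx
      exact huinj _ (by rw [hA, hx, map_zero, map_zero])
    · rw [hT, hP, hA, hp'p]
    · have : ContDiffAt ℝ ∞ φ (q + (0 : ℝ) • v) := by rw [hq0]; exact h.analyticAt_φ.contDiffAt
      exact this.comp (0 : ℝ) hc
    · exact (hct.eventually h.chart).mono fun t ht => ⟨ht.1, ht.2.1⟩
    · intro x hx hxN w hw
      -- These are the coordinates of `x` in the moving frame. They stay in the kernel of `p`, so
      -- `y'` contributes nothing modulo `N` and only the motion of the frame is seen.
      let y : ℝ → W := fun t => Ring.inverse (F (q + t • v)) (L₀ (x t))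
      have dx : HasDerivAt x (deriv x 0) 0 := (hx.differentiableAt (by simp)).hasDerivAt
      have dy : ∃ y', HasDerivAt y y' 0 :=
        ⟨_, evalCLM_hasDerivAt (AlgebraSymbol.hasDerivAt_inverse dF (by rw [hq0]; exact h.isUnit_F))
          (L₀c.hasFDerivAt.comp_hasDerivAt (0 : ℝ) dx)⟩
      obtain ⟨y', dy⟩ := dy
      have hxy : ∀ᶠ t in 𝓝 0, T₀ (F (q + t • v) (y t)) = x t ∧ s.p (y t) = 0 := by
        filter_upwards [hct.eventually h.mem_N, hct.eventually h.le_range, hxN,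
          AlgebraSymbol.eventually_isUnit_comp dF.continuousAt (by rw [hq0]; exact h.isUnit_F)]
          with t k1 k2 k3 k4
        have e1 : F (q + t • v) (y t) = L₀ (x t) :=
          congrArg (fun B : W →L[ℂ] W => B (L₀ (x t))) (Ring.mul_inverse_cancel _ k4)
        have e2 : T₀ (F (q + t • v) (y t)) = x t := by
          obtain ⟨a, ha⟩ := k2.1 k3
          rw [e1, ← ha, hL]
        exact ⟨e2, by rw [← k1, e2]; exact k3⟩
      have hpy : s.p y' = 0 := by
        have d1 := evalCLM_hasDerivAt (hasDerivAt_const (0 : ℝ) s.p) dy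
        have d2 := (hasDerivAt_const (0 : ℝ) (0 : W)).congr_of_eventuallyEq
          (hxy.mono fun t ht => ht.2)
        simpa using d1.unique d2
      have dx' : deriv x 0 = T₀ (fderiv ℝ F q v (y 0) + F q y') := by
        have d1 := T₀c.hasFDerivAt.comp_hasDerivAt (0 : ℝ) (evalCLM_hasDerivAt dF dy)
        rw [hq0] at d1
        exact (d1.congr_of_eventuallyEq (hxy.mono fun t ht => ht.1.symm)).deriv
      obtain ⟨hx0, hpy0⟩ := hxy.self_of_nhds
      rw [hq0] at hx0
      have hy0 : y 0 = (u : W →L[ℂ] W) w := by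
        rw [← hw, hT] at hx0
        have := h.injective hx0
        rw [← hFinv' (y 0), this, hFinv']
      have hp'y : s.p' ((u : W →L[ℂ] W) w) = (u : W →L[ℂ] W) w := by
        have := hadd ((u : W →L[ℂ] W) w)
        rwa [← hy0, hpy0, zero_add, hy0] at this
      change _ ∈ N (φ (q + (0 : ℝ) • v))
      rw [dx', hq0, hT, ← hθ, hA, hp'y, ← map_add, ← map_sub, ← map_sub, hN, map_sub, map_add, hpy,
        hpp, hy0, add_zero, sub_self]

end MovingFrame

end LeviComplexification

end

noncomputable section

/-! ## Contact forms and adapted frames in the ambient space of the leaf space -/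

/-- The differentials of two 1-forms with the same kernels are proportional on the kernel. -/
lemma exists_fderiv_eq_mul_of_ker_eq {Y : Type*} [NormedAddCommGroup Y] [NormedSpace ℂ Y]
    {α β : Y → Y →L[ℂ] ℂ} {γ : Y} (hα : DifferentiableAt ℂ α γ) (hβ : DifferentiableAt ℂ β γ)
    (hk : ∀ᶠ x in 𝓝 γ, LinearMap.ker (α x).toLinearMap = LinearMap.ker (β x).toLinearMap)
    (h0 : α γ = 0 → ∀ᶠ x in 𝓝 γ, α x = 0) :
    ∃ μ : ℂ, μ ≠ 0 ∧ ∀ x y, α γ y = 0 → fderiv ℂ β γ x y = μ * fderiv ℂ α γ x y := by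
  have hk' : ∀ᶠ x in 𝓝 γ, ∀ y, α x y = 0 ↔ β x y = 0 := hk.mono fun x hx y => by
    have : y ∈ LinearMap.ker (α x).toLinearMap ↔ y ∈ LinearMap.ker (β x).toLinearMap := by rw [hx]
    exact this
  -- When `α γ = 0`, `h0` makes both forms vanish near `γ`, and `μ = 1` will do.
  by_cases hα0 : α γ = 0
  · have h1 : α =ᶠ[𝓝 γ] fun _ => 0 := h0 hα0
    have h2 : β =ᶠ[𝓝 γ] fun _ => 0 := by
      filter_upwards [h1, hk'] with x hx hx'
      ext y
      exact (hx' y).1 (by rw [hx]; rfl)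
    refine ⟨1, one_ne_zero, fun x y _ => ?_⟩
    rw [h1.fderiv_eq, h2.fderiv_eq]
    simp
  · obtain ⟨e, he⟩ : ∃ e, α γ e ≠ 0 := by
      by_contra! h
      exact hα0 (ContinuousLinearMap.ext h)
    have he' : β γ e ≠ 0 := fun h => he ((hk'.self_of_nhds e).2 h)
    refine ⟨β γ e / α γ e, div_ne_zero he' he, fun x y hy => ?_⟩
    have hy' := (hk'.self_of_nhds y).1 hy
    -- `α(e) y - α(y) e` lies in the common kernel. Differentiating the resulting identity at `γ`,
    -- where both forms vanish on `y`, gives the ratio of the differentials.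
    have key : (fun z => α z e * β z y) =ᶠ[𝓝 γ] fun z => β z e * α z y := by
      filter_upwards [hk'] with z hz
      have := (hz (α z e • y - α z y • e)).1 (by simp [mul_comm])
      simp only [map_sub, map_smul, smul_eq_mul] at this
      linear_combination this
    have ev : ∀ {f : Y → Y →L[ℂ] ℂ} (_ : DifferentiableAt ℂ f γ) (v : Y),
        HasFDerivAt (fun z => f z v) ((ContinuousLinearMap.apply ℂ ℂ v).comp (fderiv ℂ f γ)) γ :=
      fun hf v => (ContinuousLinearMap.apply ℂ ℂ v).hasFDerivAt.comp γ hf.hasFDerivAt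
    have h1 := ((ev hα e).mul (ev hβ y)).unique
      (((ev hβ e).mul (ev hα y)).congr_of_eventuallyEq key)
    have h2 := congrArg (fun L : Y →L[ℂ] ℂ => L x) h1
    simp [hy, hy'] at h2
    field_simp
    linear_combination h2

namespace LeviComplexification

variable {n r k : ℕ} {Ω : Set (Fin (2 * n + 1) → ℝ)}
  {H₀ : (Fin (2 * n + 1) → ℝ) → Submodule ℂ (Fin (2 * n + 1) → ℂ)}
  {C : LeviComplexification Ω H₀ r k}

section Frames

variable {W : Type*} [AddCommGroup W] [Module ℂ W] {g : CRSymbol W r}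

/-- The degree `-1` part of an adapted frame, as a map to the ambient space. -/
def P0.map (ψ : C.P0 g) : W →ₗ[ℂ] (Fin k → ℂ) :=
  (C.contactD (C.π ψ.pt)).subtype ∘ₗ ψ.frame.toLinearMap

variable (C g) in
/-- `T` is a conformal symplectic isomorphism of `W` with the contact hyperplane at `γ`. -/
def IsConformalAt (γ : Fin k → ℂ) (T : W →ₗ[ℂ] (Fin k → ℂ)) : Prop :=
  Function.Injective T ∧ LinearMap.range T = C.contactD γ ∧ ∃ α, C.IsContactForm γ α ∧
    ∀ x y : W, fderiv ℂ α γ (T x) (T y) - fderiv ℂ α γ (T y) (T x) = g.form x y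

variable (C g) in
/-- `T` is the degree `-1` part of an adapted frame at `z`. -/
def IsFrameAt (z : Fin (2 * n + 1) → ℂ) (T : W →ₗ[ℂ] (Fin k → ℂ)) : Prop :=
  z ∈ C.U ∧ C.IsConformalAt g (C.π z) T ∧
    (∀ x, T x ∈ C.negAt z ↔ x ∈ g.neg) ∧ (∀ x, T x ∈ C.posAt z ↔ x ∈ g.pos) ∧
    (∀ A, C.MovesBy C.negAt C.posAt z T A ↔ A ∈ g.up) ∧
    ∀ A, C.MovesBy C.posAt C.negAt z T A ↔ A ∈ g.down

lemma conj_mem_upAt_iff {z : Fin (2 * n + 1) → ℂ} (f : W ≃ₗ[ℂ] C.contactD (C.π z))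
    {T : W →ₗ[ℂ] (Fin k → ℂ)} (hT : ∀ w, (f w : Fin k → ℂ) = T w) (A : Module.End ℂ W) :
    f.conj A ∈ C.upAt z ↔ C.MovesBy C.negAt C.posAt z T A := by
  simp only [upAt, MovesBy, IsVelocity, mem_ofPred_eq, f.surjective.forall, LinearEquiv.conj_apply_apply,
    LinearEquiv.symm_apply_apply, hT, LinearEquiv.map_eq_zero_iff]

lemma conj_mem_downAt_iff {z : Fin (2 * n + 1) → ℂ} (f : W ≃ₗ[ℂ] C.contactD (C.π z))
    {T : W →ₗ[ℂ] (Fin k → ℂ)} (hT : ∀ w, (f w : Fin k → ℂ) = T w) (A : Module.End ℂ W) :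
    f.conj A ∈ C.downAt z ↔ C.MovesBy C.posAt C.negAt z T A := by
  simp only [downAt, MovesBy, IsVelocity, mem_ofPred_eq, f.surjective.forall, LinearEquiv.conj_apply_apply,
    LinearEquiv.symm_apply_apply, hT, LinearEquiv.map_eq_zero_iff]

/-- With `IsFrameAt.exists_P0` this trades the dependent target of `frame` for maps into one ambient
space, so that frames at different points can be compared and differentiated. -/
lemma P0.isFrameAt (ψ : C.P0 g) : C.IsFrameAt g ψ.pt ψ.map := by
  refine ⟨ψ.pt_mem, ⟨Subtype.val_injective.comp ψ.frame.injective, ?_, ψ.conformal⟩, ψ.map_neg,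
    ψ.map_pos, fun A => ?_, fun A => ?_⟩
  · rw [P0.map, LinearMap.range_comp, LinearEquiv.range, Submodule.map_top, Submodule.range_subtype]
  · rw [← ψ.conj_up, conj_mem_upAt_iff (T := ψ.map) _ fun _ => rfl]
  · rw [← ψ.conj_down, conj_mem_downAt_iff (T := ψ.map) _ fun _ => rfl]

lemma IsFrameAt.exists_P0 {z : Fin (2 * n + 1) → ℂ} {T : W →ₗ[ℂ] (Fin k → ℂ)}
    (h : C.IsFrameAt g z T) : ∃ ψ : C.P0 g, ψ.pt = z ∧ ψ.map = T := by
  obtain ⟨hz, ⟨hi, hr, hα⟩, h1, h2, h3, h4⟩ := h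
  let f : W ≃ₗ[ℂ] C.contactD (C.π z) :=
    (LinearEquiv.ofInjective T hi).trans (LinearEquiv.ofEq _ _ hr)
  exact ⟨⟨z, hz, f, hα, h1, h2, fun A => (conj_mem_upAt_iff f (fun _ => rfl) A).trans (h3 A),
    fun A => (conj_mem_downAt_iff f (fun _ => rfl) A).trans (h4 A)⟩, rfl, rfl⟩

/-- A submersion is open, so every leaf near `C.π z` passes through a point of `C.U`, where a frame
identifies its hyperplane with `W`. -/
lemma HasConstantSymbol.eventually_finrank_contactD (hg : C.HasConstantSymbol g)
    {z : Fin (2 * n + 1) → ℂ} (hz : z ∈ C.U) :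
    ∀ᶠ γ in 𝓝 (C.π z), Module.finrank ℂ (C.contactD γ) = Module.finrank ℂ W := by
  have hs := (C.holomorphic_π z hz).hasStrictFDerivAt.map_nhds_eq_of_surj
    (LinearMap.range_eq_top.2 (C.submersion z hz))
  rw [← hs, eventually_map]
  filter_upwards [C.isOpen.mem_nhds hz] with y hy
  obtain ⟨ψ, rfl⟩ := hg y hy
  exact ψ.frame.symm.finrank_eq

/-- The conformal class does not depend on the contact form. Constant rank settles the degenerate
case: if a form vanishes at one point, its kernel is everything there, hence at all nearby points.
-/
lemma HasConstantSymbol.exists_proportional (hg : C.HasConstantSymbol g)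
    {z : Fin (2 * n + 1) → ℂ} (hz : z ∈ C.U) {α β : (Fin k → ℂ) → ((Fin k → ℂ) →L[ℂ] ℂ)}
    (hα : C.IsContactForm (C.π z) α) (hβ : C.IsContactForm (C.π z) β) :
    ∃ μ : ℂ, μ ≠ 0 ∧ ∀ x ∈ C.contactD (C.π z), ∀ y ∈ C.contactD (C.π z),
      fderiv ℂ β (C.π z) x y - fderiv ℂ β (C.π z) y x =
        μ * (fderiv ℂ α (C.π z) x y - fderiv ℂ α (C.π z) y x) := by
  have hfin := hg.eventually_finrank_contactD hz
  obtain ⟨μ, hμ, h⟩ := exists_fderiv_eq_mul_of_ker_eq hα.1.differentiableAt hβ.1.differentiableAt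
    (by filter_upwards [hα.2, hβ.2] with x h1 h2 using h1.trans h2.symm) (fun h0 => by
      have hW : Module.finrank ℂ W = Module.finrank ℂ (Fin k → ℂ) := by
        have h1 := hα.2.self_of_nhds
        rw [h0] at h1
        rw [← hfin.self_of_nhds, ← h1, ← finrank_top ℂ (Fin k → ℂ)]
        have h2 : LinearMap.ker (0 : (Fin k → ℂ) →L[ℂ] ℂ).toLinearMap = ⊤ := LinearMap.ker_zero
        rw [h2]
      filter_upwards [hfin, hα.2] with x h1 h2
      have h3 : C.contactD x = ⊤ := Submodule.eq_top_of_finrank_eq (h1.trans hW)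
      rw [h3, LinearMap.ker_eq_top] at h2
      ext1 y
      exact congrArg (fun f : (Fin k → ℂ) →ₗ[ℂ] ℂ => f y) h2)
  have hD : ∀ y ∈ C.contactD (C.π z), α (C.π z) y = 0 := fun y hy => by
    rw [← hα.2.self_of_nhds] at hy
    exact hy
  exact ⟨μ, hμ, fun x hx y hy => by rw [h x y (hD y hy), h y x (hD x hx), mul_sub]⟩

end Frames

/-! ### Adapted frames and modified symbols in a moving frame, and the proof of the theorem. -/

section NormedFrames

variable {W : Type*} [NormedAddCommGroup W] [NormedSpace ℂ W] [FiniteDimensional ℂ W]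
  {g : CRSymbol W r}
  {E : Type*} [NormedAddCommGroup E] [NormedSpace ℝ E] [CompleteSpace E]
  {T₀ : W →ₗ[ℂ] (Fin k → ℂ)} {φ : E → (Fin (2 * n + 1) → ℂ)} {κ : (Fin (2 * n + 1) → ℂ) → E}
  {F : E → (W →L[ℂ] W)} {q : E}

/-- The conformal symplectic operators, in terms of a fixed conformal isomorphism. -/
lemma HasConstantSymbol.isConformalAt_comp_iff (hg : C.HasConstantSymbol g)
    {z : Fin (2 * n + 1) → ℂ} (hz : z ∈ C.U) (hT₀ : C.IsConformalAt g (C.π z) T₀)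
    (S : W →L[ℂ] W) : C.IsConformalAt g (C.π z) (T₀ ∘ₗ S.toLinearMap) ↔
      IsUnit S ∧ ∃ c : ℂ, c ≠ 0 ∧ g.adjunction S * S = c • 1 := by
  obtain ⟨hi, hr, α, hα, hform⟩ := hT₀
  have hmem : ∀ w, T₀ w ∈ C.contactD (C.π z) := fun w => hr ▸ LinearMap.mem_range_self T₀ w
  simp only [g.adjunction_mul_self_eq_smul_one_iff]
  constructor
  · rintro ⟨hi', -, β, hβ, hform'⟩
    have hSi : Function.Injective S.toLinearMap := Function.Injective.of_comp hi'
    refine ⟨?_, ?_⟩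
    · exact ((LinearMap.isUnit_iff_ker_eq_bot S.toLinearMap).2 (LinearMap.ker_eq_bot.2 hSi)).map
        (CRSymbol.toCLM (W := W))
    · obtain ⟨μ, hμ, h⟩ := hg.exists_proportional hz hα hβ
      refine ⟨μ⁻¹, inv_ne_zero hμ, fun x y => ?_⟩
      have h1 := hform' x y
      have h2 := h _ (hmem (S x)) _ (hmem (S y))
      rw [hform] at h2
      change fderiv ℂ β (C.π z) (T₀ (S x)) (T₀ (S y)) -
        fderiv ℂ β (C.π z) (T₀ (S y)) (T₀ (S x)) = _ at h1
      rw [← h1, h2, inv_mul_cancel_left₀ hμ]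
  · rintro ⟨hS, c, hc, h⟩
    obtain ⟨u, rfl⟩ := hS
    have hinj : Function.Injective (u : W →L[ℂ] W) := fun x y hxy => by
      have := congrArg (fun z => (↑u⁻¹ : W →L[ℂ] W) z) hxy
      simpa [← mul_apply_eq_comp] using this
    have hsurj : Function.Surjective (u : W →L[ℂ] W).toLinearMap := fun y =>
      ⟨(↑u⁻¹ : W →L[ℂ] W) y, congrArg (fun B : W →L[ℂ] W => B y) u.mul_inv⟩
    refine ⟨hi.comp hinj, ?_, fun x => c⁻¹ • α x, ⟨?_, ?_⟩, fun x y => ?_⟩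
    · rw [LinearMap.range_comp, LinearMap.range_eq_top.2 hsurj, Submodule.map_top, hr]
    · exact hα.1.fun_const_smul
    · filter_upwards [hα.2] with x hx
      rw [← hx]
      exact LinearMap.ker_smul _ _ (inv_ne_zero hc)
    · rw [fderiv_fun_const_smul hα.1.differentiableAt]
      have := hform ((u : W →L[ℂ] W) x) ((u : W →L[ℂ] W) y)
      rw [h] at this
      change c⁻¹ * fderiv ℂ α (C.π z) (T₀ ((u : W →L[ℂ] W) x)) (T₀ ((u : W →L[ℂ] W) y)) -
        c⁻¹ * fderiv ℂ α (C.π z) (T₀ ((u : W →L[ℂ] W) y)) (T₀ ((u : W →L[ℂ] W) x)) = _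
      rw [← mul_sub, this, inv_mul_cancel_left₀ hc]

/-- Adapted frames, in terms of a moving frame. -/
theorem IsMovingFrame.isAdapted_iff
    (h : C.IsMovingFrame g.algebraSymbol T₀ C.negAt C.posAt φ κ F q)
    (hg : C.HasConstantSymbol g) (hT₀ : C.IsConformalAt g (C.π (φ q)) T₀) (S : W →L[ℂ] W) :
    g.algebraSymbol.IsAdapted F q S ↔ C.IsFrameAt g (φ q) (T₀ ∘ₗ S.toLinearMap) := by
  have hU := h.chart.self_of_nhds.1
  have hN : ∀ w, T₀ (F q w) ∈ C.negAt (φ q) ↔ w ∈ g.neg := fun w =>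
    (h.mem_N.self_of_nhds w).trans g.posProj_eq_zero_iff
  have hP : ∀ w, T₀ (F q w) ∈ C.posAt (φ q) ↔ w ∈ g.pos := fun w =>
    (h.mem_P.self_of_nhds w).trans g.negProj_eq_zero_iff
  constructor
  · rintro ⟨hc, u, hSu, hu, h3, h4⟩
    have hS : IsUnit S := hSu ▸ h.isUnit_F.mul u.isUnit
    have hT : ∀ w, (T₀ ∘ₗ S.toLinearMap) w = T₀ (F q ((u : W →L[ℂ] W) w)) := fun w => by
      rw [hSu]; rfl
    have hui : ∀ {V : Submodule ℂ W} (_ : ∀ x ∈ V, (u : W →L[ℂ] W) x ∈ V) (w : W),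
        (u : W →L[ℂ] W) w ∈ V ↔ w ∈ V := by
      intro V hV w
      refine ⟨fun hw => ?_, hV w⟩
      have hinj : Function.Injective (u : W →L[ℂ] W).toLinearMap := fun x y hxy => by
        have := congrArg (fun z => (↑u⁻¹ : W →L[ℂ] W) z)
          (show (u : W →L[ℂ] W) x = (u : W →L[ℂ] W) y from hxy)
        simpa [← mul_apply_eq_comp] using this
      have hmap : V.map (u : W →L[ℂ] W).toLinearMap = V :=
        Submodule.eq_of_le_of_finrank_eq (Submodule.map_le_iff_le_comap.2 hV)
          (LinearEquiv.finrank_eq (Submodule.equivMapOfInjective _ hinj V)).symm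
      rw [← hmap] at hw
      obtain ⟨v, hv, hvw⟩ := hw
      rwa [← hinj hvw]
    obtain ⟨k1, k2⟩ := g.commute_posProj_iff.1 hu
    refine ⟨hU, (hg.isConformalAt_comp_iff hU hT₀ S).2 ⟨hS, hc⟩, fun x => ?_, fun x => ?_,
      fun A => ?_, fun A => ?_⟩
    · rw [hT, hN, hui k1]
    · rw [hT, hP, hui k2]
    · rw [h.movesBy_iff hu hT, ← g.toCLM_mem_up, h3]
    · rw [h.swap.movesBy_iff (g.algebraSymbol.commute_p' hu) hT, ← g.toCLM_mem_down, h4]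
      rfl
  · rintro ⟨-, hconf, h1, h2, h3, h4⟩
    obtain ⟨hS, hc⟩ := (hg.isConformalAt_comp_iff hU hT₀ S).1 hconf
    obtain ⟨u, hu'⟩ : ∃ u : (W →L[ℂ] W)ˣ, S = F q * u :=
      ⟨h.isUnit_F.unit⁻¹ * hS.unit, by
        rw [Units.val_mul, ← mul_assoc, IsUnit.mul_val_inv, one_mul, IsUnit.unit_spec]⟩
    have hT : ∀ w, (T₀ ∘ₗ S.toLinearMap) w = T₀ (F q ((u : W →L[ℂ] W) w)) := fun w => by
      rw [hu']; rfl
    have hu : (u : W →L[ℂ] W) * g.algebraSymbol.p = g.algebraSymbol.p * u :=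
      g.commute_posProj_iff.2 ⟨fun x hx => by rw [← hN, ← hT, h1]; exact hx,
        fun x hx => by rw [← hP, ← hT, h2]; exact hx⟩
    refine ⟨hc, u, hu', hu, fun a => ?_, fun a => ?_⟩
    · obtain ⟨A, rfl⟩ := (CRSymbol.toCLM (W := W)).surjective a
      rw [← h.movesBy_iff hu hT, h3, g.toCLM_mem_up]
    · obtain ⟨A, rfl⟩ := (CRSymbol.toCLM (W := W)).surjective a
      rw [g.toCLM_mem_down, ← h4, h.swap.movesBy_iff (g.algebraSymbol.commute_p' hu) hT]
      rfl

/-- The modified symbol, in terms of a moving frame. -/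
theorem IsMovingFrame.mem_modZero_iff
    (h : C.IsMovingFrame g.algebraSymbol T₀ C.negAt C.posAt φ κ F q)
    (hg : C.HasConstantSymbol g) (hT₀ : C.IsConformalAt g (C.π (φ q)) T₀) {S : W →L[ℂ] W}
    {ψ : C.P0 g} (hψ : ψ.pt = φ q) (hψS : ψ.map = T₀ ∘ₗ S.toLinearMap) (A : Module.End ℂ W) :
    A ∈ C.modZero ψ ↔ CRSymbol.toCLM A ∈ g.algebraSymbol.velocities F q S := by
  have hS : g.algebraSymbol.IsAdapted F q S := by
    rw [h.isAdapted_iff hg hT₀, ← hψ, ← hψS]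
    exact ψ.isFrameAt
  have hψS' : ∀ w, (ψ.frame w : Fin k → ℂ) = T₀ (S w) := fun w =>
    congrArg (fun f : W →ₗ[ℂ] (Fin k → ℂ) => f w) hψS
  have hev := h.eventually.and h.chart
  constructor
  · rintro ⟨c, c0, cleaf, cpt, cfr⟩
    obtain ⟨L₀, hL₀⟩ := LinearMap.exists_leftInverse_of_injective T₀
      (LinearMap.ker_eq_bot.2 h.injective)
    have hL : ∀ w, L₀ (T₀ w) = w := fun w => congrArg (fun f : W →ₗ[ℂ] W => f w) hL₀
    let L₀c : (Fin k → ℂ) →L[ℝ] W := (LinearMap.toContinuousLinearMap L₀).restrictScalars ℝ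
    let c' : ℝ → E := fun t => κ (c t).pt
    -- The curve in `P⁰` is read in the chart of the leaf and in the coordinates given by `T₀`.
    let τ : ℝ → (W →L[ℂ] W) := fun t => CRSymbol.toCLM (L₀ ∘ₗ (c t).map)
    have hτ : ∀ t w, τ t w = L₀c ((c t).frame w) := fun t w => rfl
    have hc'0 : c' 0 = q := by
      simp only [c', c0, hψ]
      exact h.chart.self_of_nhds.2.2
    have hc's : ContDiffAt ℝ ∞ c' 0 := (h.analyticAt_κ _).contDiffAt.comp (0 : ℝ) cpt
    have hτs : ∀ w, ContDiffAt ℝ ∞ (fun t => τ t w) 0 := fun w =>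
      L₀c.contDiff.contDiffAt.comp (0 : ℝ) (cfr w).1
    have hct : Tendsto (fun t => (c t).pt) (𝓝 0) (𝓝 (φ q)) := by
      have := cpt.continuousAt.tendsto
      rwa [c0, hψ] at this
    have hc't : Tendsto c' (𝓝 0) (𝓝 q) := hc'0 ▸ hc's.continuousAt.tendsto
    refine ⟨c', τ, hc'0, ?_, hc's, contDiffAt_clm_of_apply hτs, ?_, ?_⟩
    · ext w
      rw [hτ, c0, hψS']
      exact hL _
    · filter_upwards [cleaf, hct.eventually h.chart_inv, hc't.eventually hev] with t k1 k2 k3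
      rw [hψ] at k1
      have hpt : φ (c' t) = (c t).pt := k2 k1
      rw [k3.1.isAdapted_iff hg (by rw [k3.2.2.1]; exact hT₀), hpt]
      convert (c t).isFrameAt using 1
      ext1 w
      obtain ⟨w', hw'⟩ : (c t).map w ∈ LinearMap.range T₀ := by
        rw [hT₀.2.1, ← k1]
        exact ((c t).frame w).2
      change T₀ (L₀ ((c t).map w)) = _
      rw [← hw', hL]
    · have dτ : HasDerivAt τ (deriv τ 0) 0 :=
        ((contDiffAt_clm_of_apply hτs).differentiableAt (by simp)).hasDerivAt
      ext w
      have d1 := evalCLM_hasDerivAt dτ (hasDerivAt_const (0 : ℝ) w)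
      have d2 := L₀c.hasFDerivAt.comp_hasDerivAt (0 : ℝ)
        ((cfr w).1.differentiableAt (by simp)).hasDerivAt
      rw [(cfr w).2, hψS'] at d2
      have d3 := d1.unique d2
      rw [map_zero, add_zero] at d3
      rw [d3]
      exact hL _
  · rintro ⟨c', τ, hc'0, hτ0, hc's, hτs, had, hd⟩
    have hc't : Tendsto c' (𝓝 0) (𝓝 q) := hc'0 ▸ hc's.continuousAt.tendsto
    classical
    let Q : ℝ → C.P0 g → Prop := fun t χ => χ.pt = φ (c' t) ∧ χ.map = T₀ ∘ₗ (τ t).toLinearMap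
    -- Points of `P⁰` over the given curve are picked one at a time. No smoothness is lost, since
    -- the base point and the map determined by `Q` are smooth in `t`; the value at `0` is
    -- prescribed.
    let c : ℝ → C.P0 g := fun t =>
      if t = 0 then ψ else if hQ : ∃ χ, Q t χ then hQ.choose else ψ
    have hc0 : c 0 = ψ := if_pos rfl
    have hQ : ∀ᶠ t in 𝓝 0, Q t (c t) := by
      filter_upwards [had, hc't.eventually hev] with t k1 k3
      by_cases ht : t = 0
      · rw [ht, hc0]
        exact ⟨by rw [hc'0, hψ], by rw [hτ0, hψS]⟩
      · have hex : ∃ χ, Q t χ :=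
          ((k3.1.isAdapted_iff hg (by rw [k3.2.2.1]; exact hT₀) _).1 k1).exists_P0
        have : c t = hex.choose := by simp only [c, if_neg ht, dif_pos hex]
        rw [this]
        exact hex.choose_spec
    let T₀c : W →L[ℝ] (Fin k → ℂ) := (LinearMap.toContinuousLinearMap T₀).restrictScalars ℝ
    have hfr : ∀ w, (fun t => ((c t).frame w : Fin k → ℂ)) =ᶠ[𝓝 0] fun t => T₀c (τ t w) := fun w =>
      hQ.mono fun t ht => congrArg (fun f : W →ₗ[ℂ] (Fin k → ℂ) => f w) ht.2
    have hφs : ContDiffAt ℝ ∞ φ (c' 0) := by rw [hc'0]; exact h.analyticAt_φ.contDiffAt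
    refine ⟨c, hc0, ?_, (hφs.comp (0 : ℝ) hc's).congr_of_eventuallyEq (hQ.mono fun t ht => ht.1),
      fun w => ⟨?_, ?_⟩⟩
    · filter_upwards [hQ, hc't.eventually hev] with t k1 k2
      rw [k1.1, k2.2.2.1, hψ]
    · exact (T₀c.contDiff.contDiffAt.comp (0 : ℝ)
        (evalCLM_contDiffAt hτs contDiffAt_const)).congr_of_eventuallyEq (hfr w)
    · have dτ : HasDerivAt τ (S * CRSymbol.toCLM A) 0 :=
        hd ▸ (hτs.differentiableAt (by simp)).hasDerivAt
      have d1 := T₀c.hasFDerivAt.comp_hasDerivAt (0 : ℝ)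
        (evalCLM_hasDerivAt dτ (hasDerivAt_const (0 : ℝ) w))
      rw [(hfr w).deriv_eq, hψS']
      refine d1.deriv.trans ?_
      rw [map_zero, add_zero]
      rfl

/-- The main theorem, for a model symbol on a normed space. -/
theorem isRegular_and_modZero_eq (hg : C.HasConstantSymbol g) {S : Set (Module.End ℂ W)}
    (hS : ∀ ψ : C.P0 g, C.modZero ψ = S) : g.IsRegular ∧ S = g.degreeZero := by
  obtain ⟨z₀, hz₀⟩ := C.connected.nonempty
  obtain ⟨ψ₀, rfl⟩ := hg z₀ hz₀
  obtain ⟨E, φ, κ, hφ, hφ0, hκ, -, hchart, hinv⟩ :=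
    exists_fibre_chart (C.holomorphic_π _ hz₀) (C.submersion _ hz₀)
  have : CompleteSpace E := FiniteDimensional.complete ℂ E
  have hU : ∀ᶠ x in 𝓝 0, φ x ∈ C.U :=
    hφ.continuousAt.eventually (by rw [hφ0]; exact C.isOpen.mem_nhds hz₀)
  obtain ⟨-, hT₀, hneg, hpos, -⟩ := ψ₀.isFrameAt
  have hle : ∀ z ∈ C.U, C.negAt z ≤ C.contactD (C.π z) ∧ C.posAt z ≤ C.contactD (C.π z) := by
    intro z hz
    have : (C.H z ⊔ conjDist C.H z).map (fderiv ℂ C.π z).toLinearMap ≤ C.contactD (C.π z) :=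
      le_iSup₂_of_le (f := fun z _ => (C.H z ⊔ conjDist C.H z).map (fderiv ℂ C.π z).toLinearMap)
        z ⟨hz, rfl⟩ le_rfl
    exact ⟨(Submodule.map_mono le_sup_right).trans this, (Submodule.map_mono le_sup_left).trans this⟩
  have hfin : ∀ z ∈ C.U, Module.finrank ℂ (C.negAt z) = Module.finrank ℂ g.neg ∧
      Module.finrank ℂ (C.posAt z) = Module.finrank ℂ g.pos := by
    intro z hz
    obtain ⟨χ, rfl⟩ := hg z hz
    obtain ⟨-, hχ, h1, h2, -⟩ := χ.isFrameAt
    have key : ∀ (D : Submodule ℂ (Fin k → ℂ)) (V : Submodule ℂ W), D ≤ C.contactD (C.π χ.pt) →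
        (∀ x, χ.map x ∈ D ↔ x ∈ V) → Module.finrank ℂ D = Module.finrank ℂ V := by
      intro D V hD hV
      have hcomap : D.comap χ.map = V := Submodule.ext hV
      rw [← hcomap, LinearEquiv.finrank_eq (Submodule.equivMapOfInjective _ hχ.1 (D.comap χ.map)),
        Submodule.map_comap_eq_of_le (by rw [hχ.2.1]; exact hD)]
    exact ⟨key _ _ (hle _ hz).1 h1, key _ _ (hle _ hz).2 h2⟩
  have hrange : ∀ᶠ x in 𝓝 0, C.negAt (φ x) ≤ LinearMap.range ψ₀.map ∧
      C.posAt (φ x) ≤ LinearMap.range ψ₀.map := by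
    filter_upwards [hU, hchart] with x h1 h2
    rw [hT₀.2.1, ← h2.1]
    exact hle _ h1
  obtain ⟨F, hF, hF0, hFN, hFP⟩ := exists_moving_frame g (N := C.negAt) (P := C.posAt) hφ
    (by rw [hφ0]; exact C.isAnalyticallySpanned_negAt hz₀)
    (by rw [hφ0]; exact C.isAnalyticallySpanned_posAt hz₀) hT₀.1
    (fun w hw => by rw [hφ0]; exact (hneg w).2 hw) (fun w hw => by rw [hφ0]; exact (hpos w).2 hw)
    hrange (hU.mono fun x hx => hfin _ hx)
  have hframe : C.IsMovingFrame g.algebraSymbol ψ₀.map C.negAt C.posAt φ κ F 0 :=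
    { injective := hT₀.1
      analyticAt_F := hF
      isUnit_F := by rw [hF0]; exact isUnit_one
      analyticAt_φ := hφ
      analyticAt_κ := hκ
      chart := by
        filter_upwards [hU, hchart] with x h1 h2
        exact ⟨h1, by rw [h2.1, hφ0], h2.2⟩
      chart_inv := by rwa [hφ0]
      mem_N := hFN.mono fun x hx w => (hx w).trans g.posProj_eq_zero_iff.symm
      mem_P := hFP.mono fun x hx w => (hx w).trans g.negProj_eq_zero_iff.symm
      le_range := hrange }
  -- Being a conformal isomorphism depends only on the leaf, so the frame at the base point serves
  -- as a reference at all nearby points.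
  have hev : ∀ᶠ x in 𝓝 0, C.IsMovingFrame g.algebraSymbol ψ₀.map C.negAt C.posAt φ κ F x ∧
      C.IsConformalAt g (C.π (φ x)) ψ₀.map := by
    filter_upwards [hframe.eventually, hchart] with x h1 h2
    exact ⟨h1, by rw [h2.1]; exact hT₀⟩
  refine g.isRegular_and_eq_of_velocities_eq hF hframe.isUnit_F ?_ ?_
  · filter_upwards [hev] with x hx
    obtain ⟨χ, hχ⟩ := hg (φ x) hx.1.chart.self_of_nhds.1
    obtain ⟨L₀, hL₀⟩ := LinearMap.exists_leftInverse_of_injective ψ₀.map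
      (LinearMap.ker_eq_bot.2 hT₀.1)
    refine ⟨CRSymbol.toCLM (L₀ ∘ₗ χ.map), (hx.1.isAdapted_iff hg hx.2 _).2 ?_⟩
    rw [← hχ]
    convert χ.isFrameAt using 1
    ext1 w
    obtain ⟨w', hw'⟩ : χ.map w ∈ LinearMap.range ψ₀.map := by
      rw [hx.2.2.1, ← hχ]
      exact (χ.frame w).2
    change ψ₀.map (L₀ (χ.map w)) = _
    rw [← hw']
    exact congrArg (fun f : W →ₗ[ℂ] W => ψ₀.map (f w')) hL₀
  · filter_upwards [hev] with x hx T hT A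
    obtain ⟨ψ, h1, h2⟩ := ((hx.1.isAdapted_iff hg hx.2 T).1 hT).exists_P0
    rw [← hS ψ]
    exact (hx.1.mem_modZero_iff hg hx.2 h1 h2 A).symm

end NormedFrames

end LeviComplexification

end

theorem mainTheorem3 {n r k : ℕ} {M : Type*} [TopologicalSpace M]
    [ChartedSpace (Fin (2 * n + 1) → ℝ) M]
    [IsManifold 𝓘(ℝ, Fin (2 * n + 1) → ℝ) ω M]
    (H : ∀ p : M, Submodule ℂ (ℂ ⊗[ℝ] TangentSpace 𝓘(ℝ, Fin (2 * n + 1) → ℝ) p))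
    (hH : IsTwoNondegenerateCRStructure H r)
    (e : OpenPartialHomeomorph M (Fin (2 * n + 1) → ℝ))
    (he : e ∈ IsManifold.maximalAtlas 𝓘(ℝ, Fin (2 * n + 1) → ℝ) ω M)
    (C : LeviComplexification e.target (coordExpr H e) r k)
    {W : Type*} [AddCommGroup W] [Module ℂ W] [FiniteDimensional ℂ W]
    (g : CRSymbol W r) (hg : C.HasConstantSymbol g)
    (gmod : Set ((W × ℂ) × Module.End ℂ W))
    (hmod : ∀ ψ : C.P0 g, C.modifiedSymbol ψ = gmod) :
    g.IsRegular ∧ gmod = (g.total : Set ((W × ℂ) × Module.End ℂ W)) := by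
  -- The statement involves no norm on `W`; any norm will do for the calculus, and one is
  -- transported from coordinates.
  let f := (Module.finBasis ℂ W).equivFun
  let _ : NormedAddCommGroup W := NormedAddCommGroup.induced W _ f f.injective
  let _ : NormedSpace ℂ W := NormedSpace.induced ℂ W _ f
  obtain ⟨z, hz⟩ := C.connected.nonempty
  obtain ⟨ψ₀, -⟩ := hg z hz
  obtain ⟨h1, h2⟩ := LeviComplexification.isRegular_and_modZero_eq hg (S := C.modZero ψ₀)
    fun ψ => Set.ext fun A => by
      have h : ((0, A) : (W × ℂ) × Module.End ℂ W) ∈ C.modifiedSymbol ψ ↔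
          ((0, A) : (W × ℂ) × Module.End ℂ W) ∈ C.modifiedSymbol ψ₀ := by rw [hmod, hmod]
      exact h
  refine ⟨h1, ?_⟩
  rw [← hmod ψ₀]
  ext u
  change u.2 ∈ C.modZero ψ₀ ↔ u ∈ (⊤ : Submodule ℂ (W × ℂ)).prod g.degreeZero
  rw [h2, Submodule.mem_prod]
  simp
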